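/- Let $n\ge1$ be an integer, $0<\alpha<n$, $\epsilon,R>0$, and write $p=\frac n\alpha$, $\beta=\frac n{n-\alpha}$. Let $g\in L^{\beta}(S^{n-1})$ (surface measure $d\omega$) and let $K_\alpha:\mathbb R^n\setminus\{0\}\to\mathbb R$ be measurable, with $$\big|K_\alpha(x)-g(x^*)|x|^{\alpha-n}\big|\le M|x|^{\alpha-n+\epsilon},\quad 0<|x|\le R,\; x^*=\tfrac{x}{|x|},\qquad\text{and}\qquad K_\alpha\in L^{\beta}\cap L^\infty(|x|\ge R)$$ for some constant $M$. Put $A_g=\frac1n\int_{S^{n-1}}|g(\omega)|^{\beta}\,d\omega$ and $\exp_N(t)=e^t-\sum_{k=0}^N\frac{t^k}{k!}$, $N:=\lceil p-2\rceil$. (1) For each $f\in L^{p}(\mathbb R^n)$ the integral $K_\alpha*f(x)=\int K_\alpha(x-y)f(y)\,dy$ converges absolutely (so it is finite) for a.e. $x$. Assume from now on that $g$ is not a.e. zero, i.e. $A_g>0$. (2) There is a constant $C>0$ such that for all $f\in L^{p}(\mathbb R^n)$ with $\|f\|_{p}\le1$ and all measurable $E\subseteq\mathbb R^n$ with $|E|<\infty$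 $$\int_E\exp\Big[\tfrac1{A_g}|K_\alpha*f|^{\beta}\Big]dx\le C(1+|E|)\quad(\ast)\qquad\text{and}\qquad \int_{\mathbb R^n}\exp_{N}\Big[\tfrac1{A_g}|K_\alpha*f|^{\beta}\Big]dx\le C\big(1+\|K_\alpha*f\|_{p}^{p}\big)\quad(\ast\ast)$$ (the right side of $(\ast\ast)$ may be $+\infty$). (3) If $g$ is smooth ($C^\infty$), then the exponential constant $A_g^{-1}$ is sharp: (a) in $(\ast)$: for every measurable $E$ with $0<|E|<\infty$ and every $c>A_g^{-1}$ there is no constant $C$ for which $(\ast)$, with $c$ in place of $\frac1{A_g}$, holds for all $f$ with $\|f\|_{p}\le1$; (b) in $(\ast\ast)$, for every such $K_\alpha$: there is a sequence $f_j$ with $\|f_j\|_p\le1$ along which $\int_{\mathbb R^n}\exp_N[c|K_\alpha*f_j|^\beta]dx$ stays bounded for $c=A_g^{-1}$ but tends to $+\infty$ for every $c>A_g^{-1}$; (c) in $(\ast\ast)$, if $\alpha\le\frac n2$, or if there is an $m\ge0$ such that $K_\alpha*f\in L^p$ for every compactly supported $f\in L^p$ with $\int P f=0$ for all polynomials $P$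 of degree $<m$: for every $c>A_g^{-1}$ there is no constant $C$ for which $(\ast\ast)$, with $c$ in place of $\frac1{A_g}$, holds for all $f$ with $\|f\|_{p}\le1$. -/

import Mathlib

open MeasureTheory Filter Topology

noncomputable section

namespace CriticalPotential

/-- Euclidean space `ℝⁿ`. -/
abbrev Rn (n : ℕ) : Type := EuclideanSpace ℝ (Fin n)

/-- The unit sphere `S^{n-1}` of `ℝⁿ`. -/
abbrev Sn (n : ℕ) : Type := Metric.sphere (0 : Rn n) 1

/-- The surface measure of `S^{n-1}` (for `n = 1` the counting measure on two points). -/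
abbrev surf (n : ℕ) : Measure (Sn n) := (volume : Measure (Rn n)).toSphere

/-- The critical exponent `n / α` of the densities `f`. -/
def pExp (n : ℕ) (α : ℝ) : ℝ := n / α

/-- The conjugate exponent `n / (n - α)`. -/
def qExp (n : ℕ) (α : ℝ) : ℝ := n / (n - α)

/-- `A_g = (1/n) ∫_{S^{n-1}} |g|^{n/(n-α)} dω`. -/
def sphConst (n : ℕ) (α : ℝ) (g : Sn n → ℝ) : ℝ :=
  (1 / (n : ℝ)) * ∫ ω, |g ω| ^ qExp n α ∂(surf n)

/-- The convolution `(K * f)(x) = ∫ K(y) f(x - y) dy = ∫ K(x - y) f(y) dy`. -/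
def pot {n : ℕ} (K f : Rn n → ℝ) : Rn n → ℝ :=
  convolution K f (ContinuousLinearMap.mul ℝ ℝ) volume

/-- `exp_N(t) = e^t - ∑_{k=0}^{N} t^k / k!`. -/
def expReg (N : ℕ) (t : ℝ) : ℝ :=
  Real.exp t - ∑ k ∈ Finset.range (N + 1), t ^ k / (k.factorial : ℝ)

/-- The number of subtracted terms is governed by `⌈n/α - 2⌉`, which is nonnegative
when `0 < α < n`. -/
def regOrder (n : ℕ) (α : ℝ) : ℕ := ⌈(n : ℝ) / α - 2⌉₊

/-- `∫_E exp(c |K * f|^{n/(n-α)}) dx`, with values in `[0, ∞]`. -/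
def expInt {n : ℕ} (α : ℝ) (K : Rn n → ℝ) (c : ℝ) (E : Set (Rn n)) (f : Rn n → ℝ) : ENNReal :=
  ∫⁻ x in E, ENNReal.ofReal (Real.exp (c * |pot K f x| ^ qExp n α))

/-- `∫_{ℝⁿ} exp_{⌈n/α - 2⌉}(c |K * f|^{n/(n-α)}) dx`, with values in `[0, ∞]`. -/
def regExpInt {n : ℕ} (α : ℝ) (K : Rn n → ℝ) (c : ℝ) (f : Rn n → ℝ) : ENNReal :=
  ∫⁻ x, ENNReal.ofReal (expReg (regOrder n α) (c * |pot K f x| ^ qExp n α))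

/-- `f ∈ L^{n/α}(ℝⁿ)`. -/
def InLp {n : ℕ} (α : ℝ) (f : Rn n → ℝ) : Prop :=
  MemLp f (ENNReal.ofReal (pExp n α)) volume

/-- `‖f‖_{n/α}`, with values in `[0, ∞]`. -/
def normLp {n : ℕ} (α : ℝ) (f : Rn n → ℝ) : ENNReal :=
  eLpNorm f (ENNReal.ofReal (pExp n α)) volume

/-- Near the origin, `K(x) = g(x/|x|) |x|^{α-n} + O(|x|^{α-n+ε})` for `0 < |x| ≤ R`;
here `x = r ω` in polar coordinates. -/
def LocalExpansion {n : ℕ} (α ε R : ℝ) (K : Rn n → ℝ) (g : Sn n → ℝ) : Prop :=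
  ∃ M : ℝ, ∀ (ω : Sn n) (r : ℝ), 0 < r → r ≤ R →
    |K (r • (ω : Rn n)) - g ω * r ^ (α - n)| ≤ M * r ^ (α - n + ε)

/-- `K ∈ L^{n/(n-α)} ∩ L^∞` on `{|x| ≥ R}`. -/
def TailCondition {n : ℕ} (α R : ℝ) (K : Rn n → ℝ) : Prop :=
  MemLp K (ENNReal.ofReal (qExp n α)) (volume.restrict {x : Rn n | R ≤ ‖x‖}) ∧
    MemLp K ⊤ (volume.restrict {x : Rn n | R ≤ ‖x‖})

/-- A smooth (`C^∞`) function on the sphere: the restriction of a smooth function on `ℝⁿ`. -/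
def SmoothOnSphere {n : ℕ} (g : Sn n → ℝ) : Prop :=
  ∃ G : Rn n → ℝ, ContDiff ℝ (⊤ : ℕ∞) G ∧ ∀ ω : Sn n, G (ω : Rn n) = g ω

/-- All moments of `f` of order less than `m` vanish (no condition if `m = 0`). -/
def VanishingMoments {n : ℕ} (m : ℕ) (f : Rn n → ℝ) : Prop :=
  ∀ P : MvPolynomial (Fin n) ℝ, P.totalDegree < m →
    ∫ y, MvPolynomial.eval (fun i => y i) P * f y = 0

/-- For some `m`, the potential `K * f` lies in `L^{n/α}` for every compactly supported
`f ∈ L^{n/α}` whose moments of order less than `m` vanish. -/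
def PotentialsInLp {n : ℕ} (α : ℝ) (K : Rn n → ℝ) : Prop :=
  ∃ m : ℕ, ∀ f : Rn n → ℝ, InLp α f → HasCompactSupport f → VanishingMoments m f →
    InLp α (pot K f)

end CriticalPotential

end

noncomputable section

namespace CriticalPotential

open scoped ENNReal

set_option linter.unusedSectionVars false

/-! ### Inequalities for lower Lebesgue integrals -/

/-! Write p = n/α, q = n/(n-α). The exponential inequality is proved for F ↦ ∫ k(x,y) F(y) dy with
an abstract nonnegative kernel (`CriticalKernel`) whose truncations satisfy ∫ min(k,κ)^q ≤ A log κ^q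
+ O(1) and whose excess above κ is of weak-type size. If the potential is at least σ on a set E,
averaging over E and exchanging integrals gives σ ≤ ∫ F·`avg` E k, and Hölder's inequality brings in
the L^q norm of the averaged kernel. Averaging over E smooths the singularity at height κ =
|E|^(-1/q), so the q-th power of this norm is at most A log(1/|E|) + O(1)
(`CriticalKernel.exists_split`). Hence for large τ the set where the potential exceeds (Aτ)^(1/q)
has measure O(e^(-τ)) (`CriticalKernel.level_le`).

This alone only bounds the terms of the series Σ e^i |E_i| over the superlevel sets E_i. Its
convergence comes from comparing two levels (`CriticalKernel.two_level`). Let E₂ ⊆ E₁ be superlevel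
sets whose terms are not too small, and let T be the set where the average over E₂ of the excess of
k above |E₁|^(-1/q) is large. Then |T| is O(|E₁|), so T contributes little at the lower level, and
near equality in Hölder's inequality there forces F to carry little L^p mass on T. Growth of the
potential from the lower to the higher level, however, can only come from T. So if both terms are at
least e^(-j), then either the lower index or the gap between the indices is O(j). Only O(j) indices
have a term of size e^(-j) or more, and Σ j e^(-j) converges (`tsum_le_of_level_gaps`).

For K itself, polar coordinates and the expansion at the origin give the truncation bound with A =
A_g (`lintegral_min_near`, `criticalKernel_of_expansion`). The regularized inequality uses the
previous one on the set where |K*f| ≥ 1; elsewhere the first surviving power of the exponential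
series is dominated by |K*f|^p.

Sharpness uses the equality case of Hölder's inequality on the annulus δ < |z| < r. There the
density has ‖ψ‖_p^p equal to its pairing with the homogeneous kernel, both being J = A n log(r/δ).
Since g is smooth, the potential of the reflected density is J + O(1) on |x| ≤ δ/2, so after
normalization |K*f|^q is asymptotically at least A n log(1/δ), and exp(c|K*f|^q) outweighs the
volume δ^n as soon as c > 1/A. These densities are bounded in L¹, so their potentials are bounded in
L^p + L^q, which keeps the regularized integral bounded at c = 1/A. For the last claim the
potentials must be bounded in L^p. This is immediate when q ≤ p, that is α ≤ n/2. Otherwise a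
bounded correction removes the moments of the densities and the closed graph theorem supplies the
uniform bound. -/

/-- Hölder's inequality for the factorization w v = w^(1/t) · (w^(1/s) v). With w of total mass one
it is Jensen's inequality for averages; with w a density in L¹ it yields Young's inequality. -/
theorem lintegral_mul_rpow_le {X : Type*} [MeasurableSpace X] {μ : Measure X} {s : ℝ} (hs : 1 < s)
    {w v : X → ℝ≥0∞} (hw : AEMeasurable w μ) (hv : AEMeasurable v μ) :
    (∫⁻ x, w x * v x ∂μ) ^ s ≤ (∫⁻ x, w x ∂μ) ^ (s - 1) * ∫⁻ x, w x * v x ^ s ∂μ := by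
  have hs0 : 0 < s := by linarith
  have hc := Real.HolderConjugate.conjExponent hs
  set t := Real.conjExponent s with ht
  have ht0 : 0 < t := hc.symm.pos
  have key := ENNReal.lintegral_mul_le_Lp_mul_Lq μ hc.symm (f := fun x => w x ^ (1 / t))
    (g := fun x => w x ^ (1 / s) * v x) (hw.pow_const _) ((hw.pow_const _).mul hv)
  have e1 : ∀ x, ((fun x => w x ^ (1 / t)) * fun x => w x ^ (1 / s) * v x) x = w x * v x := by
    intro x
    simp only [Pi.mul_apply]
    rw [← mul_assoc, ← ENNReal.rpow_add_of_nonneg _ _ (by positivity) (by positivity)]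
    have : 1 / t + 1 / s = 1 := by simpa using hc.symm.inv_add_inv_eq_one
    rw [this, ENNReal.rpow_one]
  have e2 : ∀ x, (w x ^ (1 / t)) ^ t = w x := by
    intro x
    rw [← ENNReal.rpow_mul, one_div_mul_cancel ht0.ne', ENNReal.rpow_one]
  have e3 : ∀ x, (w x ^ (1 / s) * v x) ^ s = w x * v x ^ s := by
    intro x
    rw [ENNReal.mul_rpow_of_nonneg _ _ hs0.le, ← ENNReal.rpow_mul, one_div_mul_cancel hs0.ne',
      ENNReal.rpow_one]
  simp only [e1, e2, e3] at key
  refine (ENNReal.rpow_le_rpow key hs0.le).trans_eq ?_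
  rw [ENNReal.mul_rpow_of_nonneg _ _ hs0.le, ← ENNReal.rpow_mul, ← ENNReal.rpow_mul,
    one_div_mul_cancel hs0.ne', ENNReal.rpow_one]
  congr 2
  have := hc.symm.div_conj_eq_sub_one
  have h2 : t⁻¹ + s⁻¹ = 1 := hc.symm.inv_add_inv_eq_one
  field_simp at h2 ⊢
  nlinarith

/-- Bernoulli's inequality at 1 - b/(a+b). The main term keeps coefficient one, which a sharp
constant demands, and the error is linear in b, so an L¹ bound on b controls it. -/
theorem add_rpow_le_real {q a b : ℝ} (hq : 1 < q) (ha : 0 ≤ a) (hb : 0 ≤ b) :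
    (a + b) ^ q ≤ a ^ q + q * (a + b) ^ (q - 1) * b := by
  rcases eq_or_lt_of_le (add_nonneg ha hb) with h | h
  · have : a = 0 := by linarith
    have : b = 0 := by linarith
    subst_vars
    simp
  · have hB := one_add_mul_self_le_rpow_one_add (s := -(b / (a + b))) (p := q)
      (by rw [neg_le_neg_iff]; exact (div_le_one h).2 (by linarith)) hq.le
    have e : 1 + -(b / (a + b)) = a / (a + b) := by field_simp; ring
    rw [e, Real.div_rpow ha h.le, le_div_iff₀ (by positivity)] at hB
    have : (a + b) ^ q = (a + b) ^ (q - 1) * (a + b) := by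
      rw [Real.rpow_sub_one h.ne']; field_simp
    have h2 : (b / (a + b)) * (a + b) ^ q = (a + b) ^ (q - 1) * b := by
      rw [this]; field_simp
    nlinarith

theorem add_rpow_le {q : ℝ} (hq : 1 < q) {a b : ℝ≥0∞} (ha : a ≠ ∞) (hb : b ≠ ∞) :
    (a + b) ^ q ≤ a ^ q + ENNReal.ofReal q * (a + b) ^ (q - 1) * b := by
  lift a to NNReal using ha
  lift b to NNReal using hb
  have h := add_rpow_le_real hq a.2 b.2
  rw [← ENNReal.coe_add, ← ENNReal.coe_rpow_of_nonneg _ (by linarith),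
    ← ENNReal.coe_rpow_of_nonneg _ (by linarith), ← ENNReal.coe_rpow_of_nonneg _ (by linarith),
    ENNReal.ofReal, ← ENNReal.coe_mul, ← ENNReal.coe_mul, ← ENNReal.coe_add, ENNReal.coe_le_coe,
    ← NNReal.coe_le_coe]
  push_cast
  rw [Real.coe_toNNReal _ (by linarith)]
  exact h

/-! ### Averages of a kernel over a set -/

section Kernel

variable {X Y : Type*} [MeasurableSpace X] [MeasurableSpace Y]

/-- The average over `E` of the kernel `k` in its first variable. -/
def avg (μ : Measure X) (E : Set X) (k : X → Y → ℝ≥0∞) (y : Y) : ℝ≥0∞ :=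
  ∫⁻ x in E, (μ E)⁻¹ * k x y ∂μ

variable {μ : Measure X} {ν : Measure Y} [SFinite μ] [SFinite ν] {E : Set X}
  {k l : X → Y → ℝ≥0∞}

theorem measurable_avg (hk : Measurable (Function.uncurry k)) : Measurable (avg μ E k) := by
  unfold avg
  have : Measurable (fun z : X × Y => (μ E)⁻¹ * k z.1 z.2) := measurable_const.mul hk
  exact this.lintegral_prod_left'

theorem avg_add (hk : Measurable (Function.uncurry k)) (y : Y) :
    avg μ E (fun x y => k x y + l x y) y = avg μ E k y + avg μ E l y := by
  unfold avg
  simp_rw [mul_add]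
  exact lintegral_add_left (measurable_const.mul hk.of_uncurry_right) _

theorem lintegral_weight (h0 : μ E ≠ 0) (ht : μ E ≠ ∞) : ∫⁻ _ in E, (μ E)⁻¹ ∂μ = 1 := by
  simp [ENNReal.inv_mul_cancel h0 ht]

theorem avg_le_const (h0 : μ E ≠ 0) (ht : μ E ≠ ∞) {c : ℝ≥0∞} (h : ∀ x y, k x y ≤ c) (y : Y) :
    avg μ E k y ≤ c := by
  calc avg μ E k y ≤ ∫⁻ _ in E, (μ E)⁻¹ * c ∂μ := lintegral_mono fun x => by gcongr; exact h x y
    _ = c := by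
      rw [lintegral_mul_const _ measurable_const, lintegral_weight h0 ht, one_mul]

theorem avg_le_div {c : ℝ≥0∞} (hk : Measurable (Function.uncurry k)) (h : ∀ y, ∫⁻ x, k x y ∂μ ≤ c)
    (y : Y) : avg μ E k y ≤ (μ E)⁻¹ * c := by
  unfold avg
  rw [lintegral_const_mul _ hk.of_uncurry_right]
  gcongr
  exact (setLIntegral_le_lintegral _ _).trans (h y)

theorem lintegral_avg_le (h0 : μ E ≠ 0) (ht : μ E ≠ ∞) (hk : Measurable (Function.uncurry k))
    {c : ℝ≥0∞} (h : ∀ x, ∫⁻ y, k x y ∂ν ≤ c) : ∫⁻ y, avg μ E k y ∂ν ≤ c := by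
  unfold avg
  rw [lintegral_lintegral_swap (by
    exact (measurable_const.mul (hk.comp measurable_swap)).aemeasurable)]
  calc _ ≤ ∫⁻ _ in E, (μ E)⁻¹ * c ∂μ := lintegral_mono fun x => by
        rw [lintegral_const_mul _ hk.of_uncurry_left]; gcongr; exact h x
    _ = c := by
      rw [lintegral_mul_const _ measurable_const, lintegral_weight h0 ht, one_mul]

theorem lintegral_avg_rpow_le {q : ℝ} (hq : 1 < q) (h0 : μ E ≠ 0) (ht : μ E ≠ ∞)
    (hk : Measurable (Function.uncurry k))
    {c : ℝ≥0∞} (h : ∀ x, ∫⁻ y, k x y ^ q ∂ν ≤ c) : ∫⁻ y, avg μ E k y ^ q ∂ν ≤ c := by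
  refine le_trans (lintegral_mono fun y => ?_)
    (lintegral_avg_le (k := fun x y => k x y ^ q) h0 ht (hk.pow_const q) h)
  unfold avg
  refine (lintegral_mul_rpow_le hq aemeasurable_const hk.of_uncurry_right.aemeasurable).trans ?_
  rw [lintegral_weight h0 ht, ENNReal.one_rpow, one_mul]

/-- Tonelli: the mean of a potential over E is the pairing of the density with the averaged kernel.
-/
theorem setLIntegral_potential_eq (h0 : μ E ≠ 0) (ht : μ E ≠ ∞)
    (hk : Measurable (Function.uncurry k)) {F : Y → ℝ≥0∞} (hF : Measurable F) :
    ∫⁻ x in E, ∫⁻ y, k x y * F y ∂ν ∂μ = μ E * ∫⁻ y, F y * avg μ E k y ∂ν := by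
  rw [lintegral_lintegral_swap (by
    exact (hk.mul (hF.comp measurable_snd)).aemeasurable)]
  have : ∀ y, F y * avg μ E k y = (μ E)⁻¹ * ∫⁻ x in E, k x y * F y ∂μ := by
    intro y
    unfold avg
    rw [lintegral_const_mul _ hk.of_uncurry_right, lintegral_mul_const _ hk.of_uncurry_right]
    ring
  simp_rw [this]
  rw [lintegral_const_mul, ← mul_assoc, ENNReal.mul_inv_cancel h0 ht, one_mul]
  exact (hk.mul (hF.comp measurable_snd)).lintegral_prod_left'

end Kernel

/-! ### Critical kernels and the L^q size of their averages -/

section Kernel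

variable {X Y : Type*} [MeasurableSpace X] [MeasurableSpace Y]

/-- Truncation bounds satisfied by a kernel whose sections have distribution function
`A s^{-q} (1 + o(1))` for large `s` and are of weak type `q`. -/
structure CriticalKernel (q A C : ℝ) (μ : Measure X) (ν : Measure Y) (k : X → Y → ℝ≥0∞) :
    Prop where
  measurable : Measurable (Function.uncurry k)
  -- The sharp constant `A` enters only through this bound; the remaining ones need only the weak
  -- type and carry an unspecified constant.
  min_le : ∀ x, ∀ κ : ℝ, 1 ≤ κ →
    ∫⁻ y, min (k x y) (.ofReal κ) ^ q ∂ν ≤ .ofReal (A * Real.log (κ ^ q) + C)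
  excess_left : ∀ x, ∀ κ : ℝ, 1 ≤ κ → ∫⁻ y, (k x y - .ofReal κ) ∂ν ≤ .ofReal (C * κ ^ (1 - q))
  excess_right : ∀ y, ∀ κ : ℝ, 1 ≤ κ → ∫⁻ x, (k x y - .ofReal κ) ∂μ ≤ .ofReal (C * κ ^ (1 - q))
  band_le : ∀ x, ∀ κ κ' : ℝ, 1 ≤ κ → κ ≤ κ' →
    ∫⁻ y, min (k x y - .ofReal κ) (.ofReal κ') ^ q ∂ν ≤ .ofReal (C * (1 + Real.log (κ' / κ)))

variable {μ : Measure X} {ν : Measure Y} [SFinite μ] [SFinite ν] {E : Set X}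
  {k : X → Y → ℝ≥0∞} {q A C : ℝ}

theorem rpow_mul_rpow_one_sub {κ q : ℝ} (hκ : 0 < κ) : κ ^ q * κ ^ (1 - q) = κ := by
  rw [← Real.rpow_add hκ]; simp

/-- The level κ is matched to the measure of E: 1/|E| ≤ κ^q turns the integrated excess C κ^(1-q)
into a pointwise bound of order κ. -/
theorem CriticalKernel.avg_excess_le (hk : CriticalKernel q A C μ ν k) {κ : ℝ}
    (hκ : 1 ≤ κ) (hE : (μ E)⁻¹ ≤ .ofReal (κ ^ q)) (y : Y) :
    avg μ E (fun x y => k x y - .ofReal κ) y ≤ .ofReal (C * κ) := by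
  have hκ0 : 0 < κ := by linarith
  refine (avg_le_div (hk.measurable.sub_const _) (fun y => hk.excess_right y κ hκ) y).trans ?_
  calc _ ≤ ENNReal.ofReal (κ ^ q) * ENNReal.ofReal (C * κ ^ (1 - q)) := by gcongr
    _ = _ := by
      rw [← ENNReal.ofReal_mul (by positivity)]
      congr 1
      have := rpow_mul_rpow_one_sub (q := q) hκ0
      linear_combination C * this

theorem avg_eq_avg_min_add (hk : Measurable (Function.uncurry k)) (c : ℝ≥0∞) (y : Y) :
    avg μ E k y = avg μ E (fun x y => min (k x y) c) y + avg μ E (fun x y => k x y - c) y := by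
  rw [← avg_add (k := fun x y => min (k x y) c) (hk.min measurable_const)]
  congr
  ext x y
  rcases le_total (k x y) c with h | h
  · simp [h, tsub_eq_zero_of_le h]
  · simp [h, add_tsub_cancel_of_le h]

theorem CriticalKernel.avg_le (hk : CriticalKernel q A C μ ν k) (hC : 0 ≤ C) {κ : ℝ}
    (hκ : 1 ≤ κ) (hE : (μ E)⁻¹ ≤ .ofReal (κ ^ q)) (h0 : μ E ≠ 0) (ht : μ E ≠ ∞) (y : Y) :
    avg μ E k y ≤ .ofReal ((1 + C) * κ) := by
  rw [avg_eq_avg_min_add hk.measurable (.ofReal κ), add_mul, one_mul,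
    ENNReal.ofReal_add (by linarith) (by positivity)]
  exact add_le_add (avg_le_const h0 ht (fun _ _ => min_le_right _ _) y)
    (hk.avg_excess_le hκ hE y)

/-- The excess above κ is cut again at height κ'. The band contributes the logarithm by Jensen's
inequality. The rest is at most C κ' pointwise and C κ'^(1-q) in L¹, and interpolating these bounds
gives the constant C^q. -/
theorem CriticalKernel.lintegral_avg_excess_rpow_le (hk : CriticalKernel q A C μ ν k)
    (hq : 1 < q) (hC : 0 ≤ C) {κ κ' : ℝ} (hκ : 1 ≤ κ) (hκκ : κ ≤ κ')
    (hE : (μ E)⁻¹ ≤ .ofReal (κ' ^ q)) (h0 : μ E ≠ 0) (ht : μ E ≠ ∞) :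
    ∫⁻ y, avg μ E (fun x y => k x y - .ofReal κ) y ^ q ∂ν ≤
      .ofReal (2 ^ q * (C + C ^ q) * (1 + Real.log (κ' / κ))) := by
  have hκ0 : 0 < κ := by linarith
  have hκ'0 : 0 < κ' := by linarith
  have hlog : 0 ≤ Real.log (κ' / κ) := Real.log_nonneg ((one_le_div hκ0).2 hκκ)
  have hm := hk.measurable
  set k1 : X → Y → ℝ≥0∞ := fun x y => k x y - .ofReal κ
  have hk1 : Measurable (Function.uncurry k1) := hm.sub_const _
  set b1 := avg μ E (fun x y => min (k1 x y) (.ofReal κ'))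
  set b2 := avg μ E (fun x y => k1 x y - .ofReal κ')
  have hb1 : ∫⁻ y, b1 y ^ q ∂ν ≤ .ofReal (C * (1 + Real.log (κ' / κ))) :=
    lintegral_avg_rpow_le hq h0 ht (hk1.min measurable_const)
      (fun x => hk.band_le x κ κ' hκ hκκ)
  have hle : ∀ x y, k1 x y - .ofReal κ' ≤ k x y - .ofReal κ' :=
    fun x y => tsub_le_tsub_right tsub_le_self _
  have hb2le : ∀ y, b2 y ≤ .ofReal (C * κ') := fun y =>
    le_trans (lintegral_mono fun x => mul_le_mul_right (hle x y) _)
      (hk.avg_excess_le (hκ.trans hκκ) hE y)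
  have hb2int : ∫⁻ y, b2 y ∂ν ≤ .ofReal (C * κ' ^ (1 - q)) :=
    lintegral_avg_le h0 ht (hk1.sub_const _) (fun x =>
      (lintegral_mono fun y => hle x y).trans (hk.excess_left x κ' (hκ.trans hκκ)))
  have hb2 : ∫⁻ y, b2 y ^ q ∂ν ≤ .ofReal (C ^ q) := by
    calc ∫⁻ y, b2 y ^ q ∂ν ≤ ∫⁻ y, .ofReal (C * κ') ^ (q - 1) * b2 y ∂ν := by
          refine lintegral_mono fun y => ?_
          have : b2 y ^ q = b2 y ^ (q - 1) * b2 y := by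
            conv_lhs => rw [show q = (q - 1) + 1 by ring]
            rw [ENNReal.rpow_add_of_nonneg _ _ (by linarith) zero_le_one, ENNReal.rpow_one]
          rw [this]
          gcongr
          exact hb2le y
      _ ≤ .ofReal (C * κ') ^ (q - 1) * .ofReal (C * κ' ^ (1 - q)) := by
          rw [lintegral_const_mul _ (measurable_avg (hk1.sub_const _))]
          gcongr
      _ = .ofReal (C ^ q) := by
          rw [ENNReal.ofReal_rpow_of_nonneg (by positivity) (by linarith),
            ← ENNReal.ofReal_mul (by positivity), Real.mul_rpow hC hκ'0.le]
          congr 1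
          have e : κ' ^ (q - 1) * κ' ^ (1 - q) = 1 := by rw [← Real.rpow_add hκ'0]; simp
          rcases hC.eq_or_lt with rfl | hC
          · rw [Real.zero_rpow (show q ≠ 0 by linarith)]; ring
          · rw [show C ^ q = C ^ (q - 1) * C by rw [Real.rpow_sub_one hC.ne']; field_simp]
            linear_combination C ^ (q - 1) * C * e
  calc _ ≤ ∫⁻ y, 2 ^ (q - 1) * (b1 y ^ q + b2 y ^ q) ∂ν := by
        refine lintegral_mono fun y => ?_
        dsimp only
        rw [avg_eq_avg_min_add hk1 (.ofReal κ')]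
        exact ENNReal.rpow_add_le_mul_rpow_add_rpow _ _ hq.le
    _ = 2 ^ (q - 1) * (∫⁻ y, b1 y ^ q ∂ν + ∫⁻ y, b2 y ^ q ∂ν) := by
        have m1 : Measurable b1 := measurable_avg (hk1.min measurable_const)
        have m2 : Measurable b2 := measurable_avg (hk1.sub_const _)
        rw [lintegral_const_mul _ (by fun_prop),
          lintegral_add_left (m1.pow_const _)]
    _ ≤ 2 ^ q * (.ofReal (C * (1 + Real.log (κ' / κ))) + .ofReal (C ^ q)) := by
        gcongr
        · exact one_le_two
        · linarith
    _ ≤ _ := by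
        have : (2 : ℝ≥0∞) = .ofReal 2 := by simp
        rw [this, ENNReal.ofReal_rpow_of_nonneg zero_le_two (by linarith),
          ← ENNReal.ofReal_add (by positivity) (by positivity),
          ← ENNReal.ofReal_mul (by positivity)]
        apply ENNReal.ofReal_le_ofReal
        rw [mul_assoc]
        gcongr
        have : 0 ≤ C ^ q := by positivity
        nlinarith

/-- The averages of a critical kernel, split at the level `κ`. -/
theorem CriticalKernel.exists_split (hk : CriticalKernel q A C μ ν k)
    (hq : 1 < q) (hA : 0 ≤ A) (hC : 0 ≤ C) :
    ∃ D : ℝ, 1 ≤ D ∧ ∀ (E : Set X) (κ κ' : ℝ), 1 ≤ κ → κ ≤ κ' →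
      (μ E)⁻¹ ≤ .ofReal (κ' ^ q) → μ E ≠ 0 → μ E ≠ ∞ →
      (∀ y, avg μ E k y ≤ .ofReal (D * κ')) ∧ ∃ T : Set Y, MeasurableSet T ∧
        ν T ≤ .ofReal (D * κ ^ (-q)) ∧
        ∫⁻ y in Tᶜ, avg μ E k y ^ q ∂ν ≤ .ofReal (A * Real.log (κ ^ q) + D) ∧
        ∫⁻ y in T, avg μ E k y ^ q ∂ν ≤ .ofReal (D * (1 + Real.log (κ' / κ))) := by
  have hq0 : 0 < q := by linarith
  set D := 1 + C + q * 2 ^ (q - 1) * C + 2 ^ q * (2 ^ q * (C + C ^ q)) with hD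
  have p1 : 0 ≤ q * 2 ^ (q - 1) * C := by positivity
  have p2 : 0 ≤ 2 ^ q * (2 ^ q * (C + C ^ q)) := by positivity
  refine ⟨D, by linarith, ?_⟩
  intro E κ κ' hκ hκκ hE h0 ht
  have hκ0 : 0 < κ := by linarith
  have hκ'0 : 0 < κ' := by linarith
  have hlog : 0 ≤ Real.log (κ' / κ) := Real.log_nonneg ((one_le_div hκ0).2 hκκ)
  have hm := hk.measurable
  refine ⟨fun y => (hk.avg_le hC (hκ.trans hκκ) hE h0 ht y).trans ?_, ?_⟩
  · apply ENNReal.ofReal_le_ofReal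
    gcongr
    linarith
  set a := avg μ E (fun x y => min (k x y) (.ofReal κ)) with ha
  set b := avg μ E (fun x y => k x y - .ofReal κ) with hb
  have mb : Measurable b := measurable_avg (hm.sub_const _)
  have ma : Measurable a := measurable_avg (hm.min measurable_const)
  have hab : ∀ y, avg μ E k y = a y + b y := avg_eq_avg_min_add hm _
  have hale : ∀ y, a y ≤ .ofReal κ := avg_le_const h0 ht (fun _ _ => min_le_right _ _)
  have hbint : ∫⁻ y, b y ∂ν ≤ .ofReal (C * κ ^ (1 - q)) :=
    lintegral_avg_le h0 ht (hm.sub_const _) (fun x => hk.excess_left x κ hκ)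
  have haint : ∫⁻ y, a y ^ q ∂ν ≤ .ofReal (A * Real.log (κ ^ q) + C) :=
    lintegral_avg_rpow_le hq h0 ht (hm.min measurable_const) (fun x => hk.min_le x κ hκ)
  -- The set T is where the averaged excess `b` is larger than κ; Chebyshev and the L¹ bound of `b`
  -- give its measure κ^(-q) up to a constant.
  have mT : MeasurableSet {y | ENNReal.ofReal κ < b y} := measurableSet_lt measurable_const mb
  refine ⟨{y | .ofReal κ < b y}, mT, ?_, ?_, ?_⟩
  · have h1 := (meas_ge_le_lintegral_div mb.aemeasurable (ε := .ofReal κ) (μ := ν)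
      (by simpa using hκ0) (by simp))
    have h2 : ν {y | ENNReal.ofReal κ < b y} ≤ ν {y | ENNReal.ofReal κ ≤ b y} :=
      measure_mono (Set.ofPred_subset_ofPred.2 fun y hy => hy.le)
    refine h2.trans (h1.trans ?_)
    calc _ ≤ ENNReal.ofReal (C * κ ^ (1 - q)) / ENNReal.ofReal κ := by gcongr
      _ = ENNReal.ofReal (C * κ ^ (-q)) := by
        rw [← ENNReal.ofReal_div_of_pos hκ0]
        congr 1
        rw [show 1 - q = -q + 1 by ring, Real.rpow_add hκ0, Real.rpow_one]
        field_simp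
      _ ≤ _ := by
        apply ENNReal.ofReal_le_ofReal
        gcongr
        linarith
  -- Off T both parts are at most κ, so the error in `add_rpow_le` is at most a multiple of κ^(q-1)
  -- b. Since ∫ b ≤ C κ^(1-q), it integrates to a constant and the coefficient of the logarithm
  -- remains A.
  · calc _ ≤ ∫⁻ y in {y | .ofReal κ < b y}ᶜ,
          (a y ^ q + .ofReal q * (.ofReal (2 * κ)) ^ (q - 1) * b y) ∂ν := by
          refine setLIntegral_mono (by fun_prop) fun y hy => ?_
          have hby : b y ≤ .ofReal κ := not_lt.1 hy
          rw [hab]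
          refine (add_rpow_le hq ((hale y).trans_lt ENNReal.ofReal_lt_top).ne
            (hby.trans_lt ENNReal.ofReal_lt_top).ne).trans ?_
          have : a y + b y ≤ .ofReal (2 * κ) := by
            rw [two_mul, ENNReal.ofReal_add hκ0.le hκ0.le]
            exact add_le_add (hale y) hby
          gcongr
      _ ≤ ∫⁻ y, (a y ^ q + .ofReal q * (.ofReal (2 * κ)) ^ (q - 1) * b y) ∂ν :=
          setLIntegral_le_lintegral _ _
      _ ≤ .ofReal (A * Real.log (κ ^ q) + C) +
          .ofReal q * (.ofReal (2 * κ)) ^ (q - 1) * .ofReal (C * κ ^ (1 - q)) := by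
          rw [lintegral_add_left (ma.pow_const _), lintegral_const_mul _ mb]
          gcongr
      _ ≤ .ofReal (A * Real.log (κ ^ q) + C) + .ofReal (q * 2 ^ (q - 1) * C) := by
          gcongr
          rw [ENNReal.ofReal_rpow_of_nonneg (by positivity) (by linarith),
            ← ENNReal.ofReal_mul (by positivity), ← ENNReal.ofReal_mul (by positivity),
            Real.mul_rpow zero_le_two hκ0.le]
          apply le_of_eq
          congr 1
          have e : κ ^ (q - 1) * κ ^ (1 - q) = 1 := by rw [← Real.rpow_add hκ0]; simp
          linear_combination q * 2 ^ (q - 1) * C * e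
      _ ≤ .ofReal (A * Real.log (κ ^ q) + D) := by
          have : 0 ≤ Real.log (κ ^ q) := Real.log_nonneg (Real.one_le_rpow hκ hq0.le)
          rw [← ENNReal.ofReal_add (by positivity) p1]
          apply ENNReal.ofReal_le_ofReal
          linarith
  -- On T the truncated part is at most κ < b, so the whole average is at most 2b.
  · calc _ ≤ ∫⁻ y in {y | .ofReal κ < b y}, 2 ^ q * b y ^ q ∂ν := by
          refine setLIntegral_mono (by fun_prop) fun y hy => ?_
          rw [hab, ← ENNReal.mul_rpow_of_nonneg _ _ hq0.le]
          gcongr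
          rw [two_mul]
          gcongr
          exact (hale y).trans (le_of_lt hy)
      _ ≤ ∫⁻ y, 2 ^ q * b y ^ q ∂ν := setLIntegral_le_lintegral _ _
      _ ≤ 2 ^ q * .ofReal (2 ^ q * (C + C ^ q) * (1 + Real.log (κ' / κ))) := by
          rw [lintegral_const_mul _ (mb.pow_const _)]
          gcongr
          exact hk.lintegral_avg_excess_rpow_le hq hC hκ hκκ hE h0 ht
      _ ≤ _ := by
          have : (2 : ℝ≥0∞) = .ofReal 2 := by simp
          rw [this, ENNReal.ofReal_rpow_of_nonneg zero_le_two (by linarith),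
            ← ENNReal.ofReal_mul (by positivity)]
          apply ENNReal.ofReal_le_ofReal
          rw [← mul_assoc]
          gcongr
          linarith

end Kernel

/-! ### The two-level estimate -/

/-- Weighted arithmetic-geometric mean after replacing x by M x and y by M^(-u/v) y, which leaves
x^u y^v unchanged. The free parameter M shifts weight between the two terms. -/
theorem rpow_mul_rpow_le_scaled {u v M x y : ℝ} (hu : 0 < u) (hv : 0 < v) (huv : u + v = 1)
    (hM : 0 < M) (hx : 0 ≤ x) (hy : 0 ≤ y) :
    x ^ u * y ^ v ≤ u * (M * x) + v * (M ^ (-(u / v)) * y) := by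
  have h := Real.geom_mean_le_arith_mean2_weighted hu.le hv.le (p₁ := M * x)
    (p₂ := M ^ (-(u / v)) * y) (by positivity) (by positivity) huv
  refine le_trans (le_of_eq ?_) h
  rw [Real.mul_rpow hM.le hx, Real.mul_rpow (by positivity) hy, ← Real.rpow_mul hM.le]
  have : M ^ u * M ^ (-(u / v) * v) = 1 := by
    rw [← Real.rpow_add hM]
    have : u + -(u / v) * v = 0 := by field_simp; ring
    rw [this, Real.rpow_zero]
  linear_combination -(x ^ u * y ^ v) * this

/-- Multiplying the hypothesis by τ^u makes the left side τ, because u + v = 1; each product on the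
right is then linearized by the weighted mean inequality, with free weight only in the δ term. -/
theorem mass_mul_le {u v M τ δ x y : ℝ} (hu : 0 < u) (hv : 0 < v) (huv : u + v = 1) (hM : 0 < M)
    (hτ : 0 ≤ τ) (hδ : 0 ≤ δ) (hδ1 : δ ≤ 1) (hx : 0 ≤ x) (hy : 0 ≤ y)
    (h : τ ^ v ≤ (1 - δ) ^ u * x ^ v + δ ^ u * y ^ v) :
    τ ≤ u * ((1 - δ) * τ) + v * x + u * (M * (δ * τ)) + v * (M ^ (-(u / v)) * y) := by
  have h1 : τ = τ ^ v * τ ^ u := by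
    rw [← Real.rpow_add_of_nonneg hτ hv.le hu.le, add_comm, huv, Real.rpow_one]
  have hd : 0 ≤ 1 - δ := by linarith
  have h2 : τ ^ v * τ ^ u ≤ ((1 - δ) ^ u * x ^ v + δ ^ u * y ^ v) * τ ^ u := by gcongr
  have h3 : ((1 - δ) * τ) ^ u * x ^ v ≤ u * ((1 - δ) * τ) + v * x := by
    simpa using rpow_mul_rpow_le_scaled hu hv huv one_pos (mul_nonneg hd hτ) hx
  have h4 := rpow_mul_rpow_le_scaled hu hv huv hM (mul_nonneg hδ hτ) hy
  rw [Real.mul_rpow hd hτ] at h3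
  rw [Real.mul_rpow hδ hτ] at h4
  nlinarith

/-- In the application u = 1/p and v = 1/q, the τ's are normalized levels, the L's are logarithms of
inverse measures, and δ is the share of the L^p mass on T. The lower level forces δ τ₁ = O(Λ). If δ
is not small this bounds τ₁; if δ is small, the gain L₂ - L₁ enters the second inequality with a
small coefficient and can be absorbed. -/
theorem two_level_real {u v c : ℝ} (hu : 0 < u) (hv : 0 < v) (huv : u + v = 1) (hc : 0 ≤ c) :
    ∃ B : ℝ, ∀ τ₁ τ₂ L₁ L₂ Λ δ : ℝ, 0 ≤ τ₁ → τ₁ ≤ τ₂ → 0 ≤ L₁ → L₁ ≤ L₂ → 1 ≤ Λ →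
      L₁ ≤ τ₁ + Λ → L₂ ≤ τ₂ + Λ → 0 ≤ δ → δ ≤ 1 →
      τ₁ ^ v ≤ (1 - δ) ^ u * (L₁ + c) ^ v + δ ^ u * c ^ v →
      τ₂ ^ v ≤ (1 - δ) ^ u * (L₁ + c) ^ v + δ ^ u * (c * (1 + (L₂ - L₁))) ^ v →
      τ₁ ≤ B * Λ ∨ τ₂ - τ₁ ≤ B * Λ := by
  set K₀ : ℝ := (1 / 2 : ℝ) ^ (-(u / v)) with hK₀
  have hK₀0 : 0 < K₀ := by positivity
  -- Chosen so that M^(-u/v) = 1/(4c+1), which reduces the coefficient of L₂ - L₁ below one quarter.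
  set M : ℝ := (4 * c + 1) ^ (v / u) with hM
  have hM0 : 0 < M := by positivity
  have hMp : M ^ (-(u / v)) = (4 * c + 1)⁻¹ := by
    rw [hM, ← Real.rpow_mul (by positivity), ← Real.rpow_neg_one]
    congr 1
    field_simp
  set C₃ := 2 * v * (1 + c + K₀ * c) / u with hC₃
  have hC₃0 : 0 ≤ C₃ := by positivity
  set C₄ := v + v * c + M * u * C₃ + v * (2 + 2 * c) with hC₄
  refine ⟨max (4 * M * u * C₃ / v) (2 / v * C₄), ?_⟩
  intro τ₁ τ₂ L₁ L₂ Λ δ hτ₁ hτ hL₁ hL hΛ h1 h2 hδ hδ1 hi hii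
  -- The weight 1/2 leaves half of u δ τ₁ to be bounded, giving δ τ₁ ≤ C₃ Λ. The weight 1 gives L₁ ≥
  -- τ₁ - 2c. The weight `M` is used at the higher level.
  have a1 := mass_mul_le hu hv huv (M := 1 / 2) (by norm_num) hτ₁ hδ hδ1 (by positivity) hc hi
  have a2 := mass_mul_le hu hv huv (M := 1) one_pos hτ₁ hδ hδ1 (by positivity) hc hi
  have a3 := mass_mul_le hu hv huv hM0 (hτ₁.trans hτ) hδ hδ1 (by positivity)
    (mul_nonneg hc (by linarith)) hii
  rw [Real.one_rpow] at a2
  rw [← hK₀] at a1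
  rw [hMp] at a3
  have b1 : δ * τ₁ ≤ C₃ * Λ := by
    rw [hC₃, div_mul_eq_mul_div, le_div_iff₀ hu]
    have e : u = 1 - v := by linarith
    have : c + K₀ * c ≤ (c + K₀ * c) * Λ := le_mul_of_one_le_right (by positivity) hΛ
    have : v * (c + K₀ * c) ≤ v * ((c + K₀ * c) * Λ) := by gcongr
    have : v * L₁ ≤ v * (τ₁ + Λ) := by gcongr
    have e2 : u * τ₁ + v * τ₁ = τ₁ := by rw [← add_mul, huv, one_mul]
    nlinarith
  have b2 : τ₁ - 2 * c ≤ L₁ := by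
    have e2 : u * τ₁ + v * τ₁ = τ₁ := by rw [← add_mul, huv, one_mul]
    have : v * (τ₁ - 2 * c) ≤ v * L₁ := by nlinarith
    exact le_of_mul_le_mul_left this hv
  by_cases hd : M * u * δ ≤ v / 4
  · right
    refine le_trans ?_ (mul_le_mul_of_nonneg_right (le_max_right _ _) (by linarith))
    have hcΛ : c ≤ c * Λ := le_mul_of_one_le_right hc hΛ
    have c1 : (4 * c + 1)⁻¹ * (c * (1 + (L₂ - L₁))) ≤
        (τ₂ - τ₁) / 4 + (2 + 2 * c) * Λ := by
      rw [inv_mul_le_iff₀ (by positivity)]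
      have : 1 + (L₂ - L₁) ≤ (τ₂ - τ₁) + (2 + 2 * c) * Λ := by linarith
      have : c * (1 + (L₂ - L₁)) ≤ c * ((τ₂ - τ₁) + (2 + 2 * c) * Λ) := by gcongr
      have p1 : 0 ≤ c * ((2 + 2 * c) * Λ) := by positivity
      have p2 : 0 ≤ (2 + 2 * c) * Λ := by positivity
      have e3 : (4 * c + 1) * ((τ₂ - τ₁) / 4 + (2 + 2 * c) * Λ) =
        c * ((τ₂ - τ₁) + (2 + 2 * c) * Λ) + 3 * (c * ((2 + 2 * c) * Λ)) + (τ₂ - τ₁) / 4 +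
          (2 + 2 * c) * Λ := by ring
      linarith
    have c2 : u * (M * (δ * τ₂)) ≤ M * u * (C₃ * Λ) + v / 4 * (τ₂ - τ₁) := by
      have : M * u * δ * (τ₂ - τ₁) ≤ v / 4 * (τ₂ - τ₁) := by
        apply mul_le_mul_of_nonneg_right hd; linarith
      have : M * u * (δ * τ₁) ≤ M * u * (C₃ * Λ) := by gcongr
      have e3 : u * (M * (δ * τ₂)) = M * u * (δ * τ₁) + M * u * δ * (τ₂ - τ₁) := by ring
      linarith
    have c3 : v * ((4 * c + 1)⁻¹ * (c * (1 + (L₂ - L₁)))) ≤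
      v * ((τ₂ - τ₁) / 4 + (2 + 2 * c) * Λ) := by gcongr
    have c4 : v * (L₁ + c) ≤ v * (τ₁ + Λ + c * Λ) := by
      gcongr
    have c5 : u * ((1 - δ) * τ₂) ≤ u * τ₂ := by
      have : 0 ≤ u * (δ * τ₂) := by have := hτ₁.trans hτ; positivity
      linarith
    have e2 : u * τ₂ + v * τ₂ = τ₂ := by rw [← add_mul, huv, one_mul]
    have : v * (τ₂ - τ₁) ≤ 2 * C₄ * Λ := by
      rw [hC₄]
      linarith
    rw [div_mul_eq_mul_div, div_mul_eq_mul_div, le_div_iff₀ hv]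
    linarith
  · left
    refine le_trans ?_ (mul_le_mul_of_nonneg_right (le_max_left _ _) (by linarith))
    rw [div_mul_eq_mul_div, le_div_iff₀ hv]
    have : v / 4 * τ₁ ≤ M * u * δ * τ₁ := by
      apply mul_le_mul_of_nonneg_right (not_le.1 hd).le hτ₁
    have : M * u * (δ * τ₁) ≤ M * u * (C₃ * Λ) := by gcongr
    nlinarith

/-! ### Summation over levels -/

/-- Indices with a i ≥ e^(-j) either are at most B j or lie within B j of the first such index
beyond B j. There are thus at most 2 B j + 2 of them, and Σ e^(-j) (2 B j + 2) converges. -/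
theorem tsum_le_of_level_gaps (B c : ℕ) : ∃ S : ℝ, ∀ (i₀ : ℕ) (a : ℕ → ℝ≥0∞),
    (∀ i < i₀, a i = 0) → (∀ i, a i ≤ .ofReal (Real.exp c)) →
    (∀ i₁ i₂ j : ℕ, i₁ ≤ i₂ → 1 ≤ j → i₀ ≤ i₁ → ENNReal.ofReal (Real.exp (-j)) ≤ a i₁ →
      ENNReal.ofReal (Real.exp (-j)) ≤ a i₂ → i₁ ≤ B * j ∨ i₂ ≤ i₁ + B * j) →
    ∑' i, a i ≤ .ofReal S := by
  have hsum : Summable fun j : ℕ => Real.exp (c + 1) * Real.exp (-j) * (2 * B * j + 2) := by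
    have h1 := Real.summable_pow_mul_exp_neg_nat_mul 1 one_pos
    have h0 := Real.summable_pow_mul_exp_neg_nat_mul 0 one_pos
    refine ((h1.mul_left (Real.exp (c + 1) * (2 * B))).add
      (h0.mul_left (Real.exp (c + 1) * 2))).congr fun j => ?_
    simp only [neg_mul, one_mul, pow_one, pow_zero]
    ring
  refine ⟨∑' j : ℕ, Real.exp (c + 1) * Real.exp (-j) * (2 * B * j + 2), ?_⟩
  intro i₀ a ha0 hac hgap
  have hcount : ∀ j : ℕ, 1 ≤ j →
      ∑' i, Set.indicator {i | ENNReal.ofReal (Real.exp (-j)) ≤ a i} (fun _ => (1 : ℝ≥0∞)) i ≤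
        .ofReal (2 * B * j + 2) := by
    intro j hj
    have hpos : 0 < ENNReal.ofReal (Real.exp (-j)) := by simpa using Real.exp_pos _
    have hi0 : ∀ i, ENNReal.ofReal (Real.exp (-j)) ≤ a i → i₀ ≤ i := by
      intro i hi
      by_contra h
      rw [ha0 i (not_le.1 h)] at hi
      exact absurd hi (not_le.2 hpos)
    obtain ⟨s, hs, hcard⟩ : ∃ s : Finset ℕ, (∀ i, ENNReal.ofReal (Real.exp (-j)) ≤ a i → i ∈ s) ∧
        s.card ≤ 2 * B * j + 2 := by
      by_cases hex : ∃ i, ENNReal.ofReal (Real.exp (-j)) ≤ a i ∧ B * j < i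
      · classical
        refine ⟨Finset.range (B * j + 1) ∪ Finset.Icc (Nat.find hex) (Nat.find hex + B * j),
          ?_, ?_⟩
        · intro i hi
          rw [Finset.mem_union, Finset.mem_range, Finset.mem_Icc]
          by_cases hiB : i ≤ B * j
          · left; omega
          · right
            have hmin := Nat.find_min' hex ⟨hi, not_le.1 hiB⟩
            have hsp := Nat.find_spec hex
            refine ⟨hmin, ?_⟩
            rcases hgap _ i j hmin hj (hi0 _ hsp.1) hsp.1 hi with h | h
            · omega
            · exact h
        · refine (Finset.card_union_le _ _).trans ?_
          rw [Finset.card_range, Nat.card_Icc, mul_assoc]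
          omega
      · push Not at hex
        refine ⟨Finset.range (B * j + 1), fun i hi => ?_, ?_⟩
        · rw [Finset.mem_range]; have := hex i hi; omega
        · rw [Finset.card_range, mul_assoc]; omega
    rw [tsum_eq_sum (s := s)]
    · have hone : ∀ i ∈ s, Set.indicator {i | ENNReal.ofReal (Real.exp (-j)) ≤ a i}
          (fun _ => (1 : ℝ≥0∞)) i ≤ 1 := fun i _ =>
        Set.indicator_apply_le' (fun _ => le_rfl) (fun _ => zero_le_one)
      refine (Finset.sum_le_sum hone).trans ?_
      rw [Finset.sum_const, nsmul_one, ← ENNReal.ofReal_natCast]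
      apply ENNReal.ofReal_le_ofReal
      exact_mod_cast hcard
    · intro i hi
      exact Set.indicator_of_notMem
        (s := {i | ENNReal.ofReal (Real.exp (-j)) ≤ a i}) (fun h => hi (hs i h)) _
  have hpt : ∀ i, a i ≤ ∑' j : ℕ, ENNReal.ofReal (Real.exp (c + 1) * Real.exp (-(j + 1 : ℕ))) *
      Set.indicator {i | ENNReal.ofReal (Real.exp (-(j + 1 : ℕ))) ≤ a i}
        (fun _ => (1 : ℝ≥0∞)) i := by
    intro i
    rcases eq_or_ne (a i) 0 with h0 | h0
    · rw [h0]; exact zero_le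
    have hat : a i ≠ ∞ := ((hac i).trans_lt ENNReal.ofReal_lt_top).ne
    obtain ⟨r, hr0, hr⟩ : ∃ r : ℝ, 0 < r ∧ a i = .ofReal r :=
      ⟨(a i).toReal, ENNReal.toReal_pos h0 hat, (ENNReal.ofReal_toReal hat).symm⟩
    suffices ∃ j : ℕ, Real.exp (-(j + 1 : ℕ)) ≤ r ∧
        r ≤ Real.exp (c + 1) * Real.exp (-(j + 1 : ℕ)) by
      obtain ⟨j, hj1, hj2⟩ := this
      refine le_trans ?_ (ENNReal.le_tsum j)
      rw [Set.indicator_of_mem (by rw [Set.mem_ofPred_eq, hr]; exact ENNReal.ofReal_le_ofReal hj1),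
        mul_one, hr]
      exact ENNReal.ofReal_le_ofReal hj2
    have hrc : r ≤ Real.exp c := by
      have := hac i
      rw [hr] at this
      exact (ENNReal.ofReal_le_ofReal_iff (Real.exp_pos _).le).1 this
    -- If r > 1 the natural floor is 0, and the bound r ≤ e^c takes over; this is why the weight
    -- carries e^(c+1). The shift to j + 1 respects the requirement 1 ≤ j in the gap hypothesis.
    refine ⟨⌊-Real.log r⌋₊, ?_, ?_⟩
    · rw [← Real.le_log_iff_exp_le hr0]
      have := Nat.lt_floor_add_one (-Real.log r)
      push_cast
      linarith
    · rw [← Real.exp_add, ← Real.log_le_iff_le_exp hr0]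
      push_cast
      rcases le_total 0 (-Real.log r) with h | h
      · have := Nat.floor_le h
        have : (0 : ℝ) ≤ c := Nat.cast_nonneg c
        linarith
      · rw [Nat.floor_of_nonpos h]
        have := (Real.log_le_iff_le_exp hr0).2 hrc
        push_cast
        linarith
  calc ∑' i, a i ≤ ∑' i, ∑' j : ℕ, ENNReal.ofReal (Real.exp (c + 1) * Real.exp (-(j + 1 : ℕ))) *
      Set.indicator {i | ENNReal.ofReal (Real.exp (-(j + 1 : ℕ))) ≤ a i}
        (fun _ => (1 : ℝ≥0∞)) i := ENNReal.tsum_le_tsum hpt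
    _ = ∑' j : ℕ, ENNReal.ofReal (Real.exp (c + 1) * Real.exp (-(j + 1 : ℕ))) *
      ∑' i, Set.indicator {i | ENNReal.ofReal (Real.exp (-(j + 1 : ℕ))) ≤ a i}
        (fun _ => (1 : ℝ≥0∞)) i := by
        rw [ENNReal.tsum_comm]
        simp_rw [ENNReal.tsum_mul_left]
    _ ≤ ∑' j : ℕ, ENNReal.ofReal (Real.exp (c + 1) * Real.exp (-(j + 1 : ℕ)) *
          (2 * B * (j + 1 : ℕ) + 2)) := by
        refine ENNReal.tsum_le_tsum fun j => ?_
        rw [ENNReal.ofReal_mul (p := _ * _) (by positivity)]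
        gcongr
        exact hcount (j + 1) (by omega)
    _ ≤ ∑' j : ℕ, ENNReal.ofReal (Real.exp (c + 1) * Real.exp (-j) * (2 * B * j + 2)) :=
        ENNReal.tsum_comp_le_tsum_of_injective (add_left_injective 1) _
    _ = _ := (ENNReal.ofReal_tsum_of_nonneg (fun j => by positivity) hsum).symm

/-! ### Superlevel sets of potentials and the exponential inequality for critical kernels -/

section Kernel

variable {X Y : Type*} [MeasurableSpace X] [MeasurableSpace Y]
  {μ : Measure X} {ν : Measure Y} [SFinite μ] [SFinite ν] {E : Set X}
  {k : X → Y → ℝ≥0∞} {p q A C : ℝ}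

/-- Averaging the pointwise lower bound over E transfers it to the pairing of F with the averaged
kernel. -/
theorem le_lintegral_mul_avg (hk : Measurable (Function.uncurry k)) {F : Y → ℝ≥0∞}
    (hF : Measurable F) (h0 : μ E ≠ 0) (ht : μ E ≠ ∞) (hE : MeasurableSet E) {σ : ℝ≥0∞}
    (h : ∀ x ∈ E, σ ≤ ∫⁻ y, k x y * F y ∂ν) : σ ≤ ∫⁻ y, F y * avg μ E k y ∂ν := by
  have h1 : μ E * σ ≤ ∫⁻ x in E, ∫⁻ y, k x y * F y ∂ν ∂μ := by
    rw [mul_comm, ← setLIntegral_const]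
    exact setLIntegral_mono' hE h
  rw [setLIntegral_potential_eq h0 ht hk hF] at h1
  exact (ENNReal.mul_le_mul_iff_right h0 ht).1 h1

/-- Hölder's inequality on a set and on its complement. -/
theorem le_of_split (hpq : p.HolderConjugate q) {F h : Y → ℝ≥0∞} (hF : Measurable F)
    (hh : Measurable h) (hF1 : ∫⁻ y, F y ^ p ∂ν ≤ 1) {T : Set Y} (hT : MeasurableSet T)
    {s a b : ℝ} (ha : 0 ≤ a) (hb : 0 ≤ b)
    (hs : ENNReal.ofReal s ≤ ∫⁻ y, F y * h y ∂ν)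
    (hTc : ∫⁻ y in Tᶜ, h y ^ q ∂ν ≤ .ofReal a) (hT' : ∫⁻ y in T, h y ^ q ∂ν ≤ .ofReal b) :
    s ≤ (1 - (∫⁻ y in T, F y ^ p ∂ν).toReal) ^ (1 / p) * a ^ (1 / q) +
      (∫⁻ y in T, F y ^ p ∂ν).toReal ^ (1 / p) * b ^ (1 / q) := by
  have hp0 := hpq.pos
  have hq0 := hpq.symm.pos
  have hsplit := lintegral_add_compl (μ := ν) (fun y => F y ^ p) hT
  set d := ∫⁻ y in T, F y ^ p ∂ν
  set e := ∫⁻ y in Tᶜ, F y ^ p ∂ν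
  have hde : d + e ≤ 1 := hsplit.trans_le hF1
  have hd1 : d ≤ 1 := le_self_add.trans hde
  have hdt : d ≠ ∞ := (hd1.trans_lt ENNReal.one_lt_top).ne
  have he1 : e ≤ .ofReal (1 - d.toReal) := by
    rw [ENNReal.ofReal_sub _ ENNReal.toReal_nonneg, ENNReal.ofReal_toReal hdt, ENNReal.ofReal_one]
    exact ENNReal.le_sub_of_add_le_left hdt hde
  have hdr : d.toReal ≤ 1 := by simpa using ENNReal.toReal_mono ENNReal.one_ne_top hd1
  have hT1 := ENNReal.lintegral_mul_le_Lp_mul_Lq (ν.restrict T) hpq hF.aemeasurable hh.aemeasurable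
  have hT2 := ENNReal.lintegral_mul_le_Lp_mul_Lq (ν.restrict Tᶜ) hpq hF.aemeasurable hh.aemeasurable
  have hs2 : ENNReal.ofReal s ≤ .ofReal ((1 - d.toReal) ^ (1 / p) * a ^ (1 / q) +
      d.toReal ^ (1 / p) * b ^ (1 / q)) := by
    rw [ENNReal.ofReal_add (by have : 0 ≤ 1 - d.toReal := by linarith
                               positivity) (by positivity),
      ENNReal.ofReal_mul (by have : 0 ≤ 1 - d.toReal := by linarith
                             positivity), ENNReal.ofReal_mul (by positivity),
      ← ENNReal.ofReal_rpow_of_nonneg (by linarith) (by positivity),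
      ← ENNReal.ofReal_rpow_of_nonneg (by positivity) (by positivity),
      ← ENNReal.ofReal_rpow_of_nonneg (by positivity) (by positivity),
      ← ENNReal.ofReal_rpow_of_nonneg (by positivity) (by positivity), ENNReal.ofReal_toReal hdt,
      add_comm]
    refine hs.trans ?_
    rw [← lintegral_add_compl (μ := ν) _ hT]
    refine add_le_add (hT1.trans ?_) (hT2.trans ?_)
    · gcongr
    · gcongr
  refine (ENNReal.ofReal_le_ofReal_iff ?_).1 hs2
  have : 0 ≤ 1 - d.toReal := by linarith
  positivity

/-- The truncation level matched to a set of measure m is m^(-1/q). -/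
theorem toReal_pos_facts {m : ℝ≥0∞} (h0 : m ≠ 0) (ht : m ≠ ∞) (hq : 0 < q) :
    m⁻¹ ≤ .ofReal (((m.toReal)⁻¹ ^ (1 / q)) ^ q) := by
  have : 0 < m.toReal := ENNReal.toReal_pos h0 ht
  rw [← Real.rpow_mul (by positivity), one_div_mul_cancel hq.ne', Real.rpow_one,
    ENNReal.ofReal_inv_of_pos this, ENNReal.ofReal_toReal ht]

/-- A level that the potential exceeds on a set of measure `m` is controlled by `log (1 / m)`. -/
theorem CriticalKernel.level_le (hk : CriticalKernel q A C μ ν k) (hpq : p.HolderConjugate q)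
    (hA : 0 ≤ A) (hC : 0 ≤ C) : ∃ D : ℝ, 0 ≤ D ∧ ∀ F : Y → ℝ≥0∞, Measurable F →
      ∫⁻ y, F y ^ p ∂ν ≤ 1 → ∀ E : Set X, MeasurableSet E → μ E ≠ 0 → μ E ≠ ∞ →
      ∀ κ τ : ℝ, 1 ≤ κ → 0 ≤ τ → (μ E)⁻¹ ≤ .ofReal (κ ^ q) →
      (∀ x ∈ E, ENNReal.ofReal (τ ^ (1 / q)) ≤ ∫⁻ y, k x y * F y ∂ν) →
      τ ≤ A * Real.log (κ ^ q) + D := by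
  have hq0 := hpq.symm.pos
  obtain ⟨D, hD1, hD⟩ := hk.exists_split hpq.symm.lt hA hC
  refine ⟨2 * D, by linarith, ?_⟩
  intro F hF hF1 E hE h0 ht κ τ hκ hτ hm hτF
  -- With both levels equal, log (κ / κ) = 0 and T contributes only a constant.
  obtain ⟨-, T, hT, -, hTc, hTi⟩ := hD E κ κ hκ le_rfl hm h0 ht
  have hκ0 : 0 < κ := by linarith
  rw [div_self hκ0.ne', Real.log_one, add_zero, mul_one] at hTi
  have hlog : 0 ≤ Real.log (κ ^ q) := Real.log_nonneg (Real.one_le_rpow hκ hq0.le)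
  have h1 := le_lintegral_mul_avg hk.measurable hF h0 ht hE hτF
  have hav := measurable_avg (μ := μ) (E := E) hk.measurable
  have h2 := h1.trans (ENNReal.lintegral_mul_le_Lp_mul_Lq ν hpq hF.aemeasurable hav.aemeasurable)
  have h3 : ∫⁻ y, avg μ E k y ^ q ∂ν ≤ .ofReal (A * Real.log (κ ^ q) + 2 * D) := by
    rw [← lintegral_add_compl _ hT]
    refine (add_le_add hTi hTc).trans ?_
    rw [← ENNReal.ofReal_add (by linarith) (by positivity)]
    apply ENNReal.ofReal_le_ofReal
    linarith
  have h4 : ENNReal.ofReal (τ ^ (1 / q)) ≤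
      1 ^ (1 / p) * ENNReal.ofReal (A * Real.log (κ ^ q) + 2 * D) ^ (1 / q) := by
    refine h2.trans ?_
    have := hpq.pos
    gcongr
  rw [ENNReal.one_rpow, one_mul, ENNReal.ofReal_rpow_of_nonneg (by positivity) (by positivity),
    ENNReal.ofReal_le_ofReal_iff (by positivity)] at h4
  exact (Real.rpow_le_rpow_iff hτ (by positivity) (by positivity)).1 h4

/-- Both levels are tested on the same set T. For the larger set T is harmless; for the smaller set
T is the only place where the averaged kernel exceeds its size at the scale of the larger set. The
share of ∫ F^p on T then serves as δ in `two_level_real`. -/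
theorem CriticalKernel.two_level (hk : CriticalKernel q A C μ ν k) (hpq : p.HolderConjugate q)
    (hA : 0 < A) (hC : 0 ≤ C) : ∃ B : ℝ, ∀ F : Y → ℝ≥0∞, Measurable F →
      ∫⁻ y, F y ^ p ∂ν ≤ 1 → ∀ E₁ E₂ : Set X, MeasurableSet E₁ → MeasurableSet E₂ → E₂ ⊆ E₁ →
      μ E₂ ≠ 0 → μ E₁ ≤ 1 → ∀ τ₁ τ₂ Λ : ℝ, 0 ≤ τ₁ → τ₁ ≤ τ₂ → 1 ≤ Λ →
      -Real.log (μ E₁).toReal ≤ τ₁ + Λ → -Real.log (μ E₂).toReal ≤ τ₂ + Λ →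
      (∀ x ∈ E₁, ENNReal.ofReal ((A * τ₁) ^ (1 / q)) ≤ ∫⁻ y, k x y * F y ∂ν) →
      (∀ x ∈ E₂, ENNReal.ofReal ((A * τ₂) ^ (1 / q)) ≤ ∫⁻ y, k x y * F y ∂ν) →
      τ₁ ≤ B * Λ ∨ τ₂ - τ₁ ≤ B * Λ := by
  have hq0 := hpq.symm.pos
  have hp0 := hpq.pos
  obtain ⟨D, hD1, hD⟩ := hk.exists_split hpq.symm.lt hA.le hC
  set D₂ := max (2 * D) (D ^ q * D) with hD₂
  have hD₂1 : 2 * D ≤ D₂ := le_max_left _ _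
  have hD₂2 : D ^ q * D ≤ D₂ := le_max_right _ _
  have hD₂0 : 0 ≤ D₂ := by linarith
  obtain ⟨B, hB⟩ := two_level_real (u := 1 / p) (v := 1 / q) (c := D₂ / A)
    (by positivity) (by positivity) (by simpa using hpq.inv_add_inv_eq_one) (by positivity)
  refine ⟨B, ?_⟩
  intro F hF hF1 E₁ E₂ hE₁ hE₂ hsub h0 hle τ₁ τ₂ Λ hτ₁ hτ hΛ hL₁ hL₂ hU₁ hU₂
  have hm : μ E₂ ≤ μ E₁ := measure_mono hsub
  have h10 : μ E₁ ≠ 0 := (pos_iff_ne_zero.2 h0 |>.trans_le hm).ne'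
  have h1t : μ E₁ ≠ ∞ := (hle.trans_lt ENNReal.one_lt_top).ne
  have h2t : μ E₂ ≠ ∞ := (hm.trans_lt h1t.lt_top).ne
  set m₁ := (μ E₁).toReal
  set m₂ := (μ E₂).toReal
  have hm₁ : 0 < m₁ := ENNReal.toReal_pos h10 h1t
  have hm₂ : 0 < m₂ := ENNReal.toReal_pos h0 h2t
  have hm₁1 : m₁ ≤ 1 := by simpa using ENNReal.toReal_mono ENNReal.one_ne_top hle
  have hm₂₁ : m₂ ≤ m₁ := ENNReal.toReal_mono h1t hm
  set κ₁ := m₁⁻¹ ^ (1 / q) with hκ₁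
  set κ₂ := m₂⁻¹ ^ (1 / q) with hκ₂
  have hκ₁1 : 1 ≤ κ₁ := Real.one_le_rpow ((one_le_inv₀ hm₁).2 hm₁1) (by positivity)
  have hκ₁₂ : κ₁ ≤ κ₂ := by
    apply Real.rpow_le_rpow (by positivity) _ (by positivity)
    gcongr
  have hκ₁0 : 0 < κ₁ := by linarith
  have hκ₂0 : 0 < κ₂ := by linarith
  have hκq : κ₁ ^ q = m₁⁻¹ := by
    rw [hκ₁, ← Real.rpow_mul (by positivity), one_div_mul_cancel hq0.ne', Real.rpow_one]
  have hlog₁ : Real.log (κ₁ ^ q) = -Real.log m₁ := by rw [hκq, Real.log_inv]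
  have hlog₂ : Real.log (κ₂ / κ₁) = (-Real.log m₂ - -Real.log m₁) / q := by
    rw [Real.log_div hκ₂0.ne' hκ₁0.ne', hκ₁, hκ₂, Real.log_rpow (by positivity),
      Real.log_rpow (by positivity), Real.log_inv, Real.log_inv]
    ring
  have hL₁0 : 0 ≤ -Real.log m₁ := by
    have := Real.log_nonpos hm₁.le hm₁1; linarith
  have hL₁₂ : -Real.log m₁ ≤ -Real.log m₂ := by
    have := Real.log_le_log hm₂ hm₂₁; linarith
  -- The kernel averaged over the small set `E₂` is split at the level κ₁ of the large set, so T has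
  -- measure of order μ E₁ and off T the logarithm is that of 1/μ E₁.
  obtain ⟨-, T, hT, hTm, hTc, hTi⟩ := hD E₂ κ₁ κ₂ hκ₁1 hκ₁₂ (toReal_pos_facts h0 h2t hq0) h0 h2t
  obtain ⟨hsup, T', hT', -, hT'c, hT'i⟩ :=
    hD E₁ κ₁ κ₁ hκ₁1 le_rfl (toReal_pos_facts h10 h1t hq0) h10 h1t
  have hav : ∀ E : Set X, Measurable (avg μ E k) := fun E => measurable_avg hk.measurable
  set x := A * -Real.log m₁ + D₂ with hx
  have hx0 : 0 ≤ x := by positivity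
  have hxA : x = A * (-Real.log m₁ + D₂ / A) := by rw [hx]; field_simp
  have b₁ : ∫⁻ y in Tᶜ, avg μ E₁ k y ^ q ∂ν ≤ .ofReal x := by
    refine (setLIntegral_le_lintegral _ _).trans ?_
    rw [← lintegral_add_compl _ hT']
    refine (add_le_add hT'i hT'c).trans ?_
    rw [div_self hκ₁0.ne', Real.log_one, add_zero, mul_one, hlog₁,
      ← ENNReal.ofReal_add (by linarith) (by positivity)]
    apply ENNReal.ofReal_le_ofReal
    linarith
  -- The supremum D κ₁ of the average over `E₁`, raised to the power q, cancels against the measure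
  -- D κ₁^(-q) of T.
  have b₂ : ∫⁻ y in T, avg μ E₁ k y ^ q ∂ν ≤ .ofReal D₂ := by
    calc _ ≤ ∫⁻ _ in T, ENNReal.ofReal (D * κ₁) ^ q ∂ν := by
          refine lintegral_mono fun y => ?_
          exact ENNReal.rpow_le_rpow (hsup y) hq0.le
      _ ≤ ENNReal.ofReal (D * κ₁) ^ q * .ofReal (D * κ₁ ^ (-q)) := by
          rw [setLIntegral_const]; gcongr
      _ = ENNReal.ofReal (D ^ q * D) := by
          rw [ENNReal.ofReal_rpow_of_nonneg (by positivity) hq0.le,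
            ← ENNReal.ofReal_mul (by positivity), Real.mul_rpow (by linarith) hκ₁0.le,
            Real.rpow_neg hκ₁0.le]
          congr 1
          field_simp
      _ ≤ _ := ENNReal.ofReal_le_ofReal hD₂2
  have b₃ : ∫⁻ y in Tᶜ, avg μ E₂ k y ^ q ∂ν ≤ .ofReal x := by
    refine hTc.trans (ENNReal.ofReal_le_ofReal ?_)
    rw [hlog₁]
    linarith
  have b₄ : ∫⁻ y in T, avg μ E₂ k y ^ q ∂ν ≤
      .ofReal (D₂ * (1 + (-Real.log m₂ - -Real.log m₁))) := by
    refine hTi.trans (ENNReal.ofReal_le_ofReal ?_)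
    rw [hlog₂]
    have : (-Real.log m₂ - -Real.log m₁) / q ≤ -Real.log m₂ - -Real.log m₁ :=
      div_le_self (by linarith) hpq.symm.lt.le
    gcongr
    · have : 0 ≤ (-Real.log m₂ - -Real.log m₁) / q := div_nonneg (by linarith) hq0.le
      linarith
  have hσ₁ := le_lintegral_mul_avg hk.measurable hF h10 h1t hE₁ hU₁
  have hσ₂ := le_lintegral_mul_avg hk.measurable hF h0 h2t hE₂ hU₂
  have i₁ := le_of_split hpq hF (hav E₁) hF1 hT hx0 hD₂0 hσ₁ b₁ b₂
  have i₂ := le_of_split hpq hF (hav E₂) hF1 hT hx0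
    (mul_nonneg hD₂0 (by linarith)) hσ₂ b₃ b₄
  have hδ1 : (∫⁻ y in T, F y ^ p ∂ν).toReal ≤ 1 := by
    simpa using ENNReal.toReal_mono ENNReal.one_ne_top
      ((setLIntegral_le_lintegral T _).trans hF1)
  have hAq : 0 < A ^ (1 / q) := by positivity
  refine hB τ₁ τ₂ (-Real.log m₁) (-Real.log m₂) Λ _ hτ₁ hτ hL₁0 hL₁₂ hΛ hL₁ hL₂
    ENNReal.toReal_nonneg hδ1 ?_ ?_
  · refine le_of_mul_le_mul_left ?_ hAq
    rw [show D₂ = A * (D₂ / A) by field_simp, hxA, Real.mul_rpow hA.le hτ₁,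
      Real.mul_rpow hA.le (by positivity), Real.mul_rpow hA.le (by positivity)] at i₁
    linarith
  · refine le_of_mul_le_mul_left ?_ hAq
    have hL : 0 ≤ 1 + (-Real.log m₂ - -Real.log m₁) := by linarith
    rw [show D₂ * (1 + (-Real.log m₂ - -Real.log m₁)) =
      A * (D₂ / A * (1 + (-Real.log m₂ - -Real.log m₁))) by field_simp, hxA,
      Real.mul_rpow hA.le (hτ₁.trans hτ), Real.mul_rpow hA.le (by positivity),
      Real.mul_rpow hA.le (by positivity)] at i₂
    linarith

/-- Low levels are finitely many and cost a multiple of μ E. Above them `level_le` bounds the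
weighted measures, `two_level` gives the gap property, and `tsum_le_of_level_gaps` sums. -/
theorem CriticalKernel.tsum_level_le (hk : CriticalKernel q A C μ ν k)
    (hpq : p.HolderConjugate q) (hA : 0 < A) (hC : 0 ≤ C) : ∃ S : ℝ, 0 ≤ S ∧
      ∀ F : Y → ℝ≥0∞, Measurable F → ∫⁻ y, F y ^ p ∂ν ≤ 1 →
      ∀ E : Set X, MeasurableSet E → μ E ≠ ∞ →
      ∑' i : ℕ, ENNReal.ofReal (Real.exp (i + 1)) *
        μ (E ∩ {x | ENNReal.ofReal ((A * i) ^ (1 / q)) ≤ ∫⁻ y, k x y * F y ∂ν}) ≤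
        ENNReal.ofReal S * (1 + μ E) := by
  have hq0 := hpq.symm.pos
  obtain ⟨D, hD0, hD⟩ := hk.level_le hpq hA.le hC
  obtain ⟨B, hB⟩ := hk.two_level hpq hA hC
  obtain ⟨S, hS⟩ := tsum_le_of_level_gaps ⌈B⌉₊ ⌈D / A⌉₊
  -- From this index on a superlevel set has measure at most one: otherwise `level_le` with κ = 1
  -- would give A i ≤ D.
  set i₀ := ⌈D / A⌉₊ + 1
  refine ⟨max (Real.exp 1 * S) (i₀ * Real.exp i₀), by positivity, ?_⟩
  intro F hF hF1 E hE hEt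
  set U : X → ℝ≥0∞ := fun x => ∫⁻ y, k x y * F y ∂ν
  have hU : Measurable U := (hk.measurable.mul (hF.comp measurable_snd)).lintegral_prod_right'
  set G : ℕ → Set X := fun i => E ∩ {x | ENNReal.ofReal ((A * i) ^ (1 / q)) ≤ U x} with hG
  have hGm : ∀ i, MeasurableSet (G i) := fun i => hE.inter (measurableSet_le measurable_const hU)
  have hGt : ∀ i, μ (G i) ≠ ∞ := fun i =>
    ((measure_mono Set.inter_subset_left).trans_lt hEt.lt_top).ne
  have hGU : ∀ i, ∀ x ∈ G i, ENNReal.ofReal ((A * i) ^ (1 / q)) ≤ U x := fun i x hx => hx.2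
  have hle1 : ∀ i, i₀ ≤ i → μ (G i) ≤ 1 := by
    intro i hi
    by_contra hcon
    have hlt : 1 < μ (G i) := not_le.1 hcon
    have := hD F hF hF1 (G i) (hGm i) (zero_lt_one.trans hlt).ne' (hGt i) 1 (A * i) le_rfl
      (by positivity) (by simpa using hlt.le) (hGU i)
    rw [Real.one_rpow, Real.log_one, mul_zero, zero_add, mul_comm, ← le_div_iff₀ hA] at this
    have h2 := Nat.le_ceil (D / A)
    have h3 : (i₀ : ℝ) ≤ i := by exact_mod_cast hi
    have h4 : (i₀ : ℝ) = ⌈D / A⌉₊ + 1 := by push_cast [i₀]; rfl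
    linarith
  set a : ℕ → ℝ≥0∞ := fun i => if i < i₀ then 0 else ENNReal.ofReal (Real.exp i) * μ (G i) with ha
  have hlow : ∀ i, i < i₀ → a i = 0 := fun i hi => by simp [ha, hi]
  have hhigh : ∀ i, i₀ ≤ i → a i = ENNReal.ofReal (Real.exp i) * μ (G i) := fun i hi => by
    simp [ha, not_lt.2 hi]
  have hup : ∀ i, a i ≤ .ofReal (Real.exp ⌈D / A⌉₊) := by
    intro i
    rcases lt_or_ge i i₀ with hi | hi
    · rw [hlow i hi]; exact zero_le
    rw [hhigh i hi]
    rcases eq_or_ne (μ (G i)) 0 with h0 | h0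
    · rw [h0, mul_zero]; exact zero_le
    have hm : 0 < (μ (G i)).toReal := ENNReal.toReal_pos h0 (hGt i)
    have hm1 : (μ (G i)).toReal ≤ 1 := by
      simpa using ENNReal.toReal_mono ENNReal.one_ne_top (hle1 i hi)
    have := hD F hF hF1 (G i) (hGm i) h0 (hGt i) ((μ (G i)).toReal⁻¹ ^ (1 / q)) (A * i)
      (Real.one_le_rpow ((one_le_inv₀ hm).2 hm1) (by positivity))
      (by positivity) (toReal_pos_facts h0 (hGt i) hq0) (hGU i)
    rw [← Real.rpow_mul (by positivity), one_div_mul_cancel hq0.ne', Real.rpow_one,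
      Real.log_inv] at this
    have h2 := Nat.le_ceil (D / A)
    have h3 : (i : ℝ) ≤ -Real.log (μ (G i)).toReal + D / A := by
      rw [← sub_le_iff_le_add', le_div_iff₀ hA]; linarith
    rw [← ENNReal.ofReal_toReal (hGt i), ← ENNReal.ofReal_mul (Real.exp_pos _).le]
    apply ENNReal.ofReal_le_ofReal
    rw [← Real.exp_log hm, ← Real.exp_add, Real.exp_le_exp]
    linarith
  have hlogm : ∀ i j : ℕ, i₀ ≤ i → ENNReal.ofReal (Real.exp (-j)) ≤ a i →
      μ (G i) ≠ 0 ∧ -Real.log (μ (G i)).toReal ≤ i + j := by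
    intro i j hi h
    rw [hhigh i hi] at h
    have h0 : μ (G i) ≠ 0 := by
      intro h0
      rw [h0, mul_zero, nonpos_iff_eq_zero, ENNReal.ofReal_eq_zero] at h
      exact absurd h (not_le.2 (Real.exp_pos _))
    refine ⟨h0, ?_⟩
    have hm : 0 < (μ (G i)).toReal := ENNReal.toReal_pos h0 (hGt i)
    rw [← ENNReal.ofReal_toReal (hGt i), ← ENNReal.ofReal_mul (Real.exp_pos _).le,
      ENNReal.ofReal_le_ofReal_iff (by positivity), ← Real.exp_log hm, ← Real.exp_add,
      Real.exp_le_exp] at h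
    linarith
  have hsum : ∑' i, a i ≤ .ofReal S := by
    -- A term of size at least e^(-j) means log(1/μ(G i)) ≤ i + j, so j plays the role of Λ in the
    -- two-level estimate.
    refine hS i₀ a hlow hup ?_
    intro i₁ i₂ j hi hj hi₀ h1 h2
    obtain ⟨-, l1⟩ := hlogm i₁ j hi₀ h1
    obtain ⟨n2, l2⟩ := hlogm i₂ j (hi₀.trans hi) h2
    have hii : (i₁ : ℝ) ≤ i₂ := by exact_mod_cast hi
    have hsub : G i₂ ⊆ G i₁ := by
      intro x hx
      refine ⟨hx.1, le_trans (ENNReal.ofReal_le_ofReal ?_) hx.2⟩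
      gcongr
    have hBj : B * j ≤ (⌈B⌉₊ : ℝ) * j := by gcongr; exact Nat.le_ceil B
    rcases hB F hF hF1 (G i₁) (G i₂) (hGm _) (hGm _) hsub n2 (hle1 i₁ hi₀) i₁ i₂ j
      (by positivity) hii (by exact_mod_cast hj) l1 l2 (hGU _) (hGU _) with h | h
    · left; exact_mod_cast h.trans hBj
    · right
      have : (i₂ : ℝ) ≤ i₁ + ⌈B⌉₊ * j := by linarith
      exact_mod_cast this
  have hterm : ∀ i : ℕ, ENNReal.ofReal (Real.exp (i + 1)) * μ (G i) ≤
      (if i < i₀ then ENNReal.ofReal (Real.exp i₀) * μ E else 0) +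
        ENNReal.ofReal (Real.exp 1) * a i := by
    intro i
    split_ifs with hi
    · refine le_add_right ?_
      gcongr
      · exact_mod_cast hi
      · exact Set.inter_subset_left
    · rw [hhigh i (not_lt.1 hi), zero_add, ← mul_assoc, ← ENNReal.ofReal_mul (Real.exp_pos _).le,
        ← Real.exp_add, add_comm]
  calc _ ≤ ∑' i : ℕ, ((if i < i₀ then ENNReal.ofReal (Real.exp i₀) * μ E else 0) +
        ENNReal.ofReal (Real.exp 1) * a i) := ENNReal.tsum_le_tsum hterm
    _ = i₀ * (ENNReal.ofReal (Real.exp i₀) * μ E) + ENNReal.ofReal (Real.exp 1) * ∑' i, a i := by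
        rw [ENNReal.tsum_add, ENNReal.tsum_mul_left, tsum_eq_sum (s := Finset.range i₀)
          (fun i hi => if_neg (by simpa using hi)), Finset.sum_congr rfl
          (fun i hi => if_pos (Finset.mem_range.1 hi))]
        simp
    _ ≤ ENNReal.ofReal (i₀ * Real.exp i₀) * μ E + ENNReal.ofReal (Real.exp 1 * S) * 1 := by
        rw [ENNReal.ofReal_mul (by positivity), ENNReal.ofReal_mul (Real.exp_pos _).le, mul_one,
          ENNReal.ofReal_natCast, mul_assoc]
        gcongr
    _ ≤ _ := by
        rw [mul_add, add_comm]
        gcongr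
        · exact le_max_left _ _
        · exact le_max_right _ _

/-- The Adams inequality for a critical kernel. -/
theorem CriticalKernel.lintegral_exp_le (hk : CriticalKernel q A C μ ν k)
    (hpq : p.HolderConjugate q) (hA : 0 < A) (hC : 0 ≤ C) : ∃ S : ℝ, 0 ≤ S ∧
      ∀ F : Y → ℝ≥0∞, Measurable F → ∫⁻ y, F y ^ p ∂ν ≤ 1 →
      ∀ E : Set X, MeasurableSet E → μ E ≠ ∞ → ∀ v : X → ℝ, (∀ x, 0 ≤ v x) →
      (∀ x, ENNReal.ofReal (v x) ≤ ∫⁻ y, k x y * F y ∂ν) →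
      ∫⁻ x in E, ENNReal.ofReal (Real.exp (1 / A * v x ^ q)) ∂μ ≤
        ENNReal.ofReal S * (1 + μ E) := by
  have hq0 := hpq.symm.pos
  obtain ⟨S, hS0, hS⟩ := hk.tsum_level_le hpq hA hC
  refine ⟨S, hS0, ?_⟩
  intro F hF hF1 E hE hEt v hv0 hv
  refine le_trans ?_ (hS F hF hF1 E hE hEt)
  set U : X → ℝ≥0∞ := fun x => ∫⁻ y, k x y * F y ∂ν
  have hU : Measurable U := (hk.measurable.mul (hF.comp measurable_snd)).lintegral_prod_right'
  set H : ℕ → Set X := fun i => {x | ENNReal.ofReal ((A * i) ^ (1 / q)) ≤ U x}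
  have hH : ∀ i, MeasurableSet (H i) := fun i => measurableSet_le measurable_const hU
  -- At each x the single term with i = ⌊v^q / A⌋ already dominates the exponential; the exponent i
  -- + 1 pays for the rounding.
  calc _ ≤ ∫⁻ x in E, ∑' i : ℕ, (H i).indicator (fun _ => ENNReal.ofReal (Real.exp (i + 1))) x ∂μ := by
        refine lintegral_mono fun x => ?_
        have hx : 0 ≤ 1 / A * v x ^ q := mul_nonneg (by positivity) (Real.rpow_nonneg (hv0 x) _)
        refine le_trans ?_ (ENNReal.le_tsum ⌊1 / A * v x ^ q⌋₊)
        rw [Set.indicator_of_mem]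
        · exact ENNReal.ofReal_le_ofReal (Real.exp_le_exp.2 (Nat.lt_floor_add_one _).le)
        · refine le_trans (ENNReal.ofReal_le_ofReal ?_) (hv x)
          rw [one_div q, Real.rpow_inv_le_iff_of_pos (by positivity) (hv0 x) hq0]
          have := Nat.floor_le hx
          calc _ ≤ A * (1 / A * v x ^ q) := by gcongr
            _ = _ := by field_simp
    _ = _ := by
        rw [lintegral_tsum (fun i => (measurable_const.indicator (hH i)).aemeasurable)]
        congr 1
        ext i
        rw [lintegral_indicator_const (hH i), Measure.restrict_apply (hH i), Set.inter_comm]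

/-- Potentials of functions in `L^p` are integrable on sets of finite measure. -/
theorem CriticalKernel.setLIntegral_potential_le (hk : CriticalKernel q A C μ ν k)
    (hpq : p.HolderConjugate q) (hA : 0 ≤ A) (hC : 0 ≤ C) {E : Set X} (hEt : μ E ≠ ∞) :
    ∃ S : ℝ, 0 ≤ S ∧ ∀ F : Y → ℝ≥0∞, Measurable F →
      ∫⁻ x in E, ∫⁻ y, k x y * F y ∂ν ∂μ ≤ .ofReal S * (∫⁻ y, F y ^ p ∂ν) ^ (1 / p) := by
  have hq0 := hpq.symm.pos
  rcases eq_or_ne (μ E) 0 with h0 | h0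
  · refine ⟨0, le_rfl, fun F _ => ?_⟩
    rw [setLIntegral_measure_zero _ _ h0]
    exact zero_le
  obtain ⟨D, hD1, hD⟩ := hk.exists_split hpq.symm.lt hA hC
  have hm : 0 < (μ E).toReal := ENNReal.toReal_pos h0 hEt
  -- The maximum with 1 covers sets of measure above one, since the kernel bounds hold only for
  -- levels at least 1.
  set κ := max 1 ((μ E).toReal⁻¹ ^ (1 / q)) with hκ
  have hκ1 : 1 ≤ κ := le_max_left _ _
  obtain ⟨-, T, hT, -, hTc, hTi⟩ := hD E κ κ hκ1 le_rfl
    ((toReal_pos_facts h0 hEt hq0).trans (by gcongr; exact le_max_right _ _)) h0 hEt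
  set Z := ENNReal.ofReal (D * (1 + Real.log (κ / κ))) + .ofReal (A * Real.log (κ ^ q) + D)
  have h3 : ∫⁻ y, avg μ E k y ^ q ∂ν ≤ Z := by
    rw [← lintegral_add_compl _ hT]
    exact add_le_add hTi hTc
  have hZ : μ E * Z ^ (1 / q) ≠ ∞ := by
    refine ENNReal.mul_ne_top hEt (ENNReal.rpow_ne_top_of_nonneg (by positivity) ?_)
    exact ENNReal.add_ne_top.2 ⟨ENNReal.ofReal_ne_top, ENNReal.ofReal_ne_top⟩
  refine ⟨(μ E * Z ^ (1 / q)).toReal, ENNReal.toReal_nonneg, fun F hF => ?_⟩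
  rw [setLIntegral_potential_eq h0 hEt hk.measurable hF, ENNReal.ofReal_toReal hZ, mul_assoc]
  gcongr
  refine (ENNReal.lintegral_mul_le_Lp_mul_Lq ν hpq hF.aemeasurable
    (measurable_avg hk.measurable).aemeasurable).trans ?_
  rw [mul_comm]
  gcongr

end Kernel

/-! ### Polar coordinates and power integrals -/

theorem lintegral_polar {n : ℕ} (hn : 0 < n) {Φ : Rn n → ℝ≥0∞} (hΦ : AEMeasurable Φ volume) :
    ∫⁻ x, Φ x = ∫⁻ ω : Sn n, (∫⁻ r in Set.Ioi (0 : ℝ),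
      ENNReal.ofReal (r ^ (n - 1)) * Φ (r • (ω : Rn n))) ∂(surf n) := by
  have : Nontrivial (Rn n) := by
    have : Nonempty (Fin n) := ⟨⟨0, hn⟩⟩
    infer_instance
  have hmp := (volume : Measure (Rn n)).measurePreserving_homeomorphUnitSphereProd
  have hemb := (homeomorphUnitSphereProd (Rn n)).measurableEmbedding
  set Ψ : Metric.sphere (0 : Rn n) 1 × Set.Ioi (0 : ℝ) → ℝ≥0∞ :=
    fun z => Φ ((z.2 : ℝ) • (z.1 : Rn n)) with hΨ
  have hcomp : ∀ x : ({0}ᶜ : Set (Rn n)), Ψ (homeomorphUnitSphereProd (Rn n) x) = Φ x := by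
    intro x
    have hx : ‖(x : Rn n)‖ ≠ 0 := norm_ne_zero_iff.2 x.2
    simp only [hΨ, homeomorphUnitSphereProd_apply_snd_coe, homeomorphUnitSphereProd_apply_fst_coe]
    rw [smul_smul, mul_inv_cancel₀ hx, one_smul]
  have h1 : ∫⁻ x, Φ x = ∫⁻ x : ({0}ᶜ : Set (Rn n)), Φ x ∂(Measure.comap Subtype.val volume) := by
    rw [lintegral_subtype_comap (measurableSet_singleton _).compl, restrict_compl_singleton]
  have hΦ' : AEMeasurable (fun x : ({0}ᶜ : Set (Rn n)) => Φ x) (Measure.comap Subtype.val volume) := by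
    have := (MeasurableEmbedding.subtype_coe
      (measurableSet_singleton (0 : Rn n)).compl).aemeasurable_map_iff (g := Φ)
      (μ := Measure.comap Subtype.val (volume : Measure (Rn n)))
    refine this.1 ?_
    rw [map_comap_subtype_coe (measurableSet_singleton _).compl]
    exact hΦ.restrict
  have hΨm : AEMeasurable Ψ ((surf n).prod (Measure.volumeIoiPow (Module.finrank ℝ (Rn n) - 1))) := by
    rw [← hmp.map_eq, hemb.aemeasurable_map_iff]
    exact hΦ'.congr (Filter.Eventually.of_forall fun x => (hcomp x).symm)
  rw [h1]
  simp_rw [← hcomp]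
  rw [hmp.lintegral_comp_emb hemb, lintegral_prod _ hΨm]
  have hdim : Module.finrank ℝ (Rn n) = n := finrank_euclideanSpace_fin
  rw [hdim]
  congr 1
  ext ω
  rw [Measure.volumeIoiPow]
  rw [lintegral_withDensity_eq_lintegral_mul_non_measurable₀]
  · simp only [Pi.mul_apply, hΨ]
    exact lintegral_subtype_comap measurableSet_Ioi
      (fun r : ℝ => ENNReal.ofReal (r ^ (n - 1)) * Φ (r • (ω : Rn n)))
  · fun_prop
  · exact Filter.Eventually.of_forall fun _ => ENNReal.ofReal_lt_top

theorem setLIntegral_polar {n : ℕ} (hn : 0 < n) {Φ : Rn n → ℝ≥0∞} (hΦ : AEMeasurable Φ volume)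
    {s : Set ℝ} (hs : MeasurableSet s) (hs0 : s ⊆ Set.Ioi 0) :
    ∫⁻ x in norm ⁻¹' s, Φ x = ∫⁻ ω : Sn n, (∫⁻ r in s,
      ENNReal.ofReal (r ^ (n - 1)) * Φ (r • (ω : Rn n))) ∂(surf n) := by
  have hms : MeasurableSet (norm ⁻¹' s : Set (Rn n)) := measurable_norm hs
  rw [← lintegral_indicator hms, lintegral_polar hn (hΦ.indicator hms)]
  congr 1
  ext ω
  conv_rhs => rw [← Set.inter_eq_self_of_subset_left hs0, ← setLIntegral_indicator hs]
  refine setLIntegral_congr_fun measurableSet_Ioi fun r hr => ?_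
  have hnorm : ‖r • (ω : Rn n)‖ = r := by
    rw [norm_smul, norm_eq_of_mem_sphere ω, mul_one, Real.norm_of_nonneg (le_of_lt hr)]
  by_cases h : r ∈ s
  · rw [Set.indicator_of_mem (by simpa [hnorm] using h), Set.indicator_of_mem h]
  · rw [Set.indicator_of_notMem (by simpa [hnorm] using h), Set.indicator_of_notMem h, mul_zero]

theorem lintegral_Ioo_rpow {b x : ℝ} (hb : 0 ≤ b) (hx : -1 < x) :
    ∫⁻ r in Set.Ioo 0 b, ENNReal.ofReal (r ^ x) = ENNReal.ofReal (b ^ (x + 1) / (x + 1)) := by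
  have hint : IntegrableOn (fun r : ℝ => r ^ x) (Set.Ioo 0 b) :=
    ((intervalIntegral.intervalIntegrable_rpow' hx).1).mono_set Set.Ioo_subset_Ioc_self
  rw [← ofReal_integral_eq_lintegral_ofReal hint, ← integral_Ioc_eq_integral_Ioo,
    ← intervalIntegral.integral_of_le hb, integral_rpow (Or.inl hx),
    Real.zero_rpow (by linarith), sub_zero]
  refine (ae_restrict_mem measurableSet_Ioo).mono fun r hr => ?_
  exact Real.rpow_nonneg hr.1.le _

theorem lintegral_Ioo_inv {a b : ℝ} (ha : 0 < a) (hab : a ≤ b) :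
    ∫⁻ r in Set.Ioo a b, ENNReal.ofReal r⁻¹ = ENNReal.ofReal (Real.log (b / a)) := by
  have hint : IntegrableOn (fun r : ℝ => r⁻¹) (Set.Icc a b) :=
    ContinuousOn.integrableOn_Icc (continuousOn_inv₀.mono fun r hr => by
      simpa using (ha.trans_le hr.1).ne')
  rw [← ofReal_integral_eq_lintegral_ofReal (hint.mono_set Set.Ioo_subset_Icc_self),
    ← integral_Ioc_eq_integral_Ioo, ← intervalIntegral.integral_of_le hab,
    integral_inv_of_pos ha (ha.trans_le hab)]
  refine (ae_restrict_mem measurableSet_Ioo).mono fun r hr => ?_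
  exact inv_nonneg.2 (ha.trans hr.1).le

theorem lintegral_Ioi_add_rpow {κ q : ℝ} (hκ : 0 < κ) (hq : 1 < q) :
    ∫⁻ t in Set.Ioi (0 : ℝ), ENNReal.ofReal ((κ + t) ^ (-q)) =
      ENNReal.ofReal (κ ^ (1 - q) / (q - 1)) := by
  have h1 := (measurePreserving_add_left volume κ).setLIntegral_comp_preimage
    (s := Set.Ioi κ) (f := fun t : ℝ => ENNReal.ofReal (t ^ (-q))) measurableSet_Ioi (by fun_prop)
  have h2 : (fun t : ℝ => κ + t) ⁻¹' Set.Ioi κ = Set.Ioi 0 := by ext t; simp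
  rw [h2] at h1
  rw [h1, ← ofReal_integral_eq_lintegral_ofReal
    (integrableOn_Ioi_rpow_of_lt (by linarith) hκ), integral_Ioi_rpow_of_lt (by linarith) hκ]
  · congr 1
    have : q - 1 ≠ 0 := by linarith
    have : -q + 1 ≠ 0 := by linarith
    rw [show -q + 1 = 1 - q by ring] at *
    field_simp
    ring
  · refine (ae_restrict_mem measurableSet_Ioi).mono fun r hr => ?_
    exact Real.rpow_nonneg (hκ.trans hr).le _

theorem lintegral_Ioo_add_inv {κ b : ℝ} (hκ : 0 < κ) (hb : 0 ≤ b) :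
    ∫⁻ t in Set.Ioo 0 b, ENNReal.ofReal (κ + t)⁻¹ = ENNReal.ofReal (Real.log ((κ + b) / κ)) := by
  have h1 := (measurePreserving_add_left volume κ).setLIntegral_comp_preimage
    (s := Set.Ioo κ (κ + b)) (f := fun t : ℝ => ENNReal.ofReal t⁻¹) measurableSet_Ioo (by fun_prop)
  have h2 : (fun t : ℝ => κ + t) ⁻¹' Set.Ioo κ (κ + b) = Set.Ioo 0 b := by ext t; simp
  rw [h2] at h1
  rw [h1, lintegral_Ioo_inv hκ (by linarith)]

/-! ### Consequences of a weak-type bound -/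

section Weak

variable {Y : Type*} [MeasurableSpace Y] {ν : Measure Y} {v : Y → ℝ} {q C : ℝ}

/-- Layer cake: the excess has distribution function |{v > κ + t}|, at most C (κ+t)^(-q), which is
integrable in t as q > 1. -/
theorem lintegral_excess_le_of_weak (hq : 1 < q) (hC : 0 ≤ C) (hv : AEMeasurable v ν)
    (hw : ∀ s, 0 < s → ν {y | s < v y} ≤ .ofReal (C * s ^ (-q))) {κ : ℝ} (hκ : 0 < κ) :
    ∫⁻ y, ENNReal.ofReal (v y - κ) ∂ν ≤ .ofReal (C / (q - 1) * κ ^ (1 - q)) := by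
  have h1 : ∀ y, ENNReal.ofReal (v y - κ) = ENNReal.ofReal (max (v y - κ) 0) := fun y => by
    rcases le_total (v y - κ) 0 with h | h
    · rw [max_eq_right h, ENNReal.ofReal_of_nonpos h, ENNReal.ofReal_zero]
    · rw [max_eq_left h]
  simp_rw [h1]
  rw [lintegral_eq_lintegral_meas_lt ν (f := fun y => max (v y - κ) 0) (Filter.Eventually.of_forall fun y => le_max_right _ _)
    ((hv.sub_const κ).max aemeasurable_const)]
  calc _ ≤ ∫⁻ t in Set.Ioi (0 : ℝ), ENNReal.ofReal C * ENNReal.ofReal ((κ + t) ^ (-q)) := by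
        refine setLIntegral_mono' measurableSet_Ioi fun t (ht : 0 < t) => ?_
        rw [← ENNReal.ofReal_mul hC]
        refine le_trans (measure_mono (Set.ofPred_subset_ofPred.2 fun y hy => ?_))
          (hw (κ + t) (by linarith))
        rcases lt_max_iff.1 hy with h | h <;> linarith
    _ = _ := by
        rw [lintegral_const_mul' _ _ ENNReal.ofReal_ne_top, lintegral_Ioi_add_rpow hκ hq,
          ← ENNReal.ofReal_mul hC]
        congr 1
        ring

/-- Layer cake with weight q t^(q-1) ≤ q (κ+t)^(q-1) against the weak-type bound leaves ∫ dt/(κ+t)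
over 0 < t < κ', which is log((κ+κ')/κ). -/
theorem lintegral_band_le_of_weak (hq : 1 < q) (hC : 0 ≤ C) (hv : AEMeasurable v ν)
    (hw : ∀ s, 0 < s → ν {y | s < v y} ≤ .ofReal (C * s ^ (-q))) {κ κ' : ℝ} (hκ : 0 < κ)
    (hκκ : κ ≤ κ') :
    ∫⁻ y, min (ENNReal.ofReal (v y - κ)) (.ofReal κ') ^ q ∂ν ≤
      .ofReal (q * C * (1 + Real.log (κ' / κ))) := by
  have hκ' : 0 < κ' := by linarith
  have hq0 : 0 < q := by linarith
  have hw0 : ∀ y, 0 ≤ max (min (v y - κ) κ') 0 := fun y => le_max_right _ _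
  have h1 : ∀ y, min (ENNReal.ofReal (v y - κ)) (.ofReal κ') ^ q =
      ENNReal.ofReal ((max (min (v y - κ) κ') 0) ^ q) := fun y => by
    rw [← ENNReal.ofReal_rpow_of_nonneg (hw0 y) hq0.le, ENNReal.ofReal_max, ENNReal.ofReal_min,
      ENNReal.ofReal_zero, max_eq_left zero_le]
  simp_rw [h1]
  rw [lintegral_rpow_eq_lintegral_meas_lt_mul ν (Filter.Eventually.of_forall hw0)
    (((hv.sub_const κ).min aemeasurable_const).max aemeasurable_const) hq0]
  calc _ ≤ ENNReal.ofReal q * ∫⁻ t in Set.Ioi (0 : ℝ), (Set.Ioo 0 κ').indicator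
          (fun t => ENNReal.ofReal C * ENNReal.ofReal (κ + t)⁻¹) t := by
        refine mul_le_mul_right (setLIntegral_mono' measurableSet_Ioi fun t (ht : 0 < t) => ?_) _
        by_cases htκ : t < κ'
        · rw [Set.indicator_of_mem (show t ∈ Set.Ioo 0 κ' from ⟨ht, htκ⟩)]
          have h2 : ν {y | t < max (min (v y - κ) κ') 0} ≤ .ofReal (C * (κ + t) ^ (-q)) := by
            refine le_trans (measure_mono (Set.ofPred_subset_ofPred.2 fun y hy => ?_))
              (hw (κ + t) (by linarith))
            rcases lt_max_iff.1 hy with h | h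
            · have := (lt_min_iff.1 h).1; linarith
            · linarith
          calc _ ≤ ENNReal.ofReal (C * (κ + t) ^ (-q)) * ENNReal.ofReal ((κ + t) ^ (q - 1)) := by
                gcongr
                linarith
            _ = _ := by
                rw [← ENNReal.ofReal_mul (by positivity), ← ENNReal.ofReal_mul hC]
                congr 1
                rw [mul_assoc, ← Real.rpow_add (by linarith), ← Real.rpow_neg_one]
                congr 2
                ring
        · have : {y | t < max (min (v y - κ) κ') 0} = ∅ := by
            refine Set.eq_empty_of_forall_notMem fun y hy => ?_
            rcases lt_max_iff.1 (show t < max (min (v y - κ) κ') 0 from hy) with h | h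
            · have := (lt_min_iff.1 h).2; linarith
            · linarith
          rw [this, measure_empty, zero_mul]
          exact zero_le
    _ = ENNReal.ofReal q * (ENNReal.ofReal C * ENNReal.ofReal (Real.log ((κ + κ') / κ))) := by
        rw [setLIntegral_indicator measurableSet_Ioo, Set.inter_eq_self_of_subset_left
          (fun t ht => ht.1), lintegral_const_mul' _ _ ENNReal.ofReal_ne_top,
          lintegral_Ioo_add_inv hκ hκ'.le]
    _ ≤ _ := by
        rw [← ENNReal.ofReal_mul hC, ← ENNReal.ofReal_mul hq0.le, ← mul_assoc]
        apply ENNReal.ofReal_le_ofReal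
        gcongr
        calc Real.log ((κ + κ') / κ) ≤ Real.log (2 * (κ' / κ)) := by
              apply Real.log_le_log (by positivity)
              rw [← mul_div_assoc]
              gcongr
              linarith
          _ ≤ _ := by
              rw [Real.log_mul two_ne_zero (by positivity)]
              linarith [Real.log_two_lt_d9]

end Weak

/-! ### Truncation bounds for the kernel -/

theorem qExp_pos {n : ℕ} {α : ℝ} (hα : 0 < α) (hαn : α < n) : 0 < qExp n α :=
  div_pos (hα.trans hαn) (by linarith)

theorem holderConjugate {n : ℕ} {α : ℝ} (hα : 0 < α) (hαn : α < n) :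
    (pExp n α).HolderConjugate (qExp n α) := by
  have hn : (0 : ℝ) < n := hα.trans hαn
  rw [Real.holderConjugate_iff]
  refine ⟨(one_lt_div hα).2 hαn, ?_⟩
  unfold pExp qExp
  have : (n : ℝ) - α ≠ 0 := by linarith
  field_simp
  ring

theorem natCast_pos_of_lt {n : ℕ} {α : ℝ} (hα : 0 < α) (hαn : α < n) : 0 < n := by
  have : (0 : ℝ) < n := hα.trans hαn
  exact_mod_cast this

theorem sub_mul_qExp {n : ℕ} {α : ℝ} (hαn : α < n) : (n - α) * qExp n α = n := by
  unfold qExp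
  have : (n : ℝ) - α ≠ 0 := by linarith
  field_simp

theorem lintegral_norm_split {n : ℕ} (hn : 0 < n) (R : ℝ) (hR : 0 < R) (Φ : Rn n → ℝ≥0∞) :
    ∫⁻ x, Φ x = (∫⁻ x in norm ⁻¹' Set.Ioo 0 R, Φ x) + ∫⁻ x in {x | R ≤ ‖x‖}, Φ x := by
  have : Nontrivial (Rn n) := by
    have : Nonempty (Fin n) := ⟨⟨0, hn⟩⟩
    infer_instance
  have hm : MeasurableSet {x : Rn n | R ≤ ‖x‖} := measurableSet_le measurable_const measurable_norm
  rw [← lintegral_add_compl Φ hm, add_comm]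
  suffices h : ({x : Rn n | R ≤ ‖x‖}ᶜ : Set (Rn n)) =ᵐ[volume] norm ⁻¹' Set.Ioo 0 R by
    rw [setLIntegral_congr h]
  have h0 : (volume : Measure (Rn n)) {0} = 0 := measure_singleton _
  have : ({x : Rn n | R ≤ ‖x‖}ᶜ : Set (Rn n)) = norm ⁻¹' Set.Ioo 0 R ∪ {0} := by
    ext x
    simp only [Set.mem_compl_iff, Set.mem_ofPred_eq, not_le, Set.union_singleton, Set.mem_insert_iff,
      Set.mem_preimage, Set.mem_Ioo, norm_pos_iff]
    constructor
    · intro h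
      by_cases hx : x = 0
      · exact Or.inl hx
      · exact Or.inr ⟨hx, h⟩
    · rintro (rfl | h)
      · simpa using hR
      · exact h.2
  rw [this]
  exact union_ae_eq_left_of_ae_eq_empty (ae_eq_empty.2 h0)

theorem ofReal_pow_mul_ofReal_rpow {n : ℕ} (hn : 0 < n) {r x : ℝ} (hr : 0 < r) :
    ENNReal.ofReal (r ^ (n - 1)) * ENNReal.ofReal (r ^ x) = ENNReal.ofReal (r ^ (n - 1 + x)) := by
  rw [← ENNReal.ofReal_mul (by positivity), ← Real.rpow_natCast, ← Real.rpow_add hr,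
    Nat.cast_sub hn, Nat.cast_one]

section Sphere

variable {n : ℕ} {α : ℝ} {g : Sn n → ℝ}

theorem integrable_rpow_sphere (hα : 0 < α) (hαn : α < n)
    (hg : MemLp g (ENNReal.ofReal (qExp n α)) (surf n)) :
    Integrable (fun ω => |g ω| ^ qExp n α) (surf n) := by
  have hq := qExp_pos hα hαn
  have := hg.integrable_norm_rpow (by simpa using hq) (by simp)
  simpa [ENNReal.toReal_ofReal hq.le] using this

theorem sphConst_nonneg : 0 ≤ sphConst n α g :=
  mul_nonneg (by positivity) (integral_nonneg fun ω => by positivity)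

theorem lintegral_rpow_sphere (hα : 0 < α) (hαn : α < n)
    (hg : MemLp g (ENNReal.ofReal (qExp n α)) (surf n)) :
    ∫⁻ ω, ENNReal.ofReal (|g ω| ^ qExp n α) ∂(surf n) = .ofReal (n * sphConst n α g) := by
  rw [← ofReal_integral_eq_lintegral_ofReal (integrable_rpow_sphere hα hαn hg)
    (Filter.Eventually.of_forall fun ω => by positivity)]
  congr 1
  have : (n : ℝ) ≠ 0 := (hα.trans hαn).ne'
  unfold sphConst
  field_simp

theorem lintegral_add_const_rpow_sphere_lt_top (hα : 0 < α) (hαn : α < n)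
    (hg : MemLp g (ENNReal.ofReal (qExp n α)) (surf n)) (B : ℝ) (hB : 0 ≤ B) :
    ∫⁻ ω, ENNReal.ofReal ((|g ω| + B) ^ qExp n α) ∂(surf n) < ∞ := by
  have hq := qExp_pos hα hαn
  have h1 : MemLp (fun ω => |g ω| + B) (ENNReal.ofReal (qExp n α)) (surf n) :=
    hg.abs.add (memLp_const B)
  have h2 := (integrable_rpow_sphere hα hαn h1).lintegral_lt_top
  refine lt_of_le_of_lt (lintegral_mono fun ω => ?_) h2
  rw [abs_of_nonneg (show 0 ≤ |g ω| + B by positivity)]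

end Sphere

section Near

variable {n : ℕ} {α ε R M : ℝ} {K : Rn n → ℝ} {g : Sn n → ℝ}

theorem abs_kernel_le (hε : 0 < ε) (hM0 : 0 ≤ M)
    (hM : ∀ (ω : Sn n) (r : ℝ), 0 < r → r ≤ R →
      |K (r • (ω : Rn n)) - g ω * r ^ (α - n)| ≤ M * r ^ (α - n + ε))
    (ω : Sn n) {r : ℝ} (hr : 0 < r) (hrR : r ≤ R) :
    |K (r • (ω : Rn n))| ≤ (|g ω| + M * R ^ ε) * r ^ (α - n) := by
  have h1 := hM ω r hr hrR
  rw [Real.rpow_add hr] at h1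
  have h2 : r ^ ε ≤ R ^ ε := Real.rpow_le_rpow hr.le hrR hε.le
  have h3 : 0 < r ^ (α - n) := Real.rpow_pos_of_pos hr _
  calc |K (r • (ω : Rn n))| = |(K (r • (ω : Rn n)) - g ω * r ^ (α - n)) + g ω * r ^ (α - n)| := by
        ring_nf
    _ ≤ M * (r ^ (α - n) * r ^ ε) + |g ω| * r ^ (α - n) := by
        refine (abs_add_le _ _).trans (add_le_add h1 ?_)
        rw [abs_mul, abs_of_pos h3]
    _ ≤ M * (r ^ (α - n) * R ^ ε) + |g ω| * r ^ (α - n) := by gcongr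
    _ = _ := by ring

/-- Along the ray ω one has |K| ≤ (|g ω| + B) r^(α-n), so |K| > s forces r < ((|g ω| + B)/s)^(q/n).
Integrating r^(n-1) and then over the sphere gives s^(-q) times a finite constant. -/
theorem weak_near (hα : 0 < α) (hαn : α < n) (hε : 0 < ε) (hR : 0 < R) (hM0 : 0 ≤ M)
    (hK : AEStronglyMeasurable K volume) (hg : MemLp g (ENNReal.ofReal (qExp n α)) (surf n))
    (hM : ∀ (ω : Sn n) (r : ℝ), 0 < r → r ≤ R →
      |K (r • (ω : Rn n)) - g ω * r ^ (α - n)| ≤ M * r ^ (α - n + ε)) :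
    ∃ C : ℝ, 0 ≤ C ∧ ∀ s, 0 < s →
      (volume.restrict (norm ⁻¹' Set.Ioo 0 R)) {x | s < |K x|} ≤ .ofReal (C * s ^ (-qExp n α)) := by
  have hn := natCast_pos_of_lt hα hαn
  have hn' : (0 : ℝ) < n := by exact_mod_cast hn
  have hq := qExp_pos hα hαn
  set q := qExp n α with hqdef
  set B := M * R ^ ε with hB
  have hB0 : 0 ≤ B := by positivity
  set W := ∫⁻ ω, ENNReal.ofReal ((|g ω| + B) ^ q) ∂(surf n) with hW
  have hWt : W < ∞ := lintegral_add_const_rpow_sphere_lt_top hα hαn hg B hB0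
  refine ⟨W.toReal / n, by positivity, fun s hs => ?_⟩
  have hnull : NullMeasurableSet {x | s < |K x|} volume :=
    nullMeasurableSet_lt aemeasurable_const hK.aemeasurable.abs
  have hmeas : (volume.restrict (norm ⁻¹' Set.Ioo 0 R)) {x : Rn n | s < |K x|} =
      ∫⁻ x in norm ⁻¹' Set.Ioo 0 R, Set.indicator {x | s < |K x|} 1 x := by
    rw [lintegral_indicator_one₀ (hnull.mono_ac Measure.restrict_le_self.absolutelyContinuous)]
  rw [hmeas, setLIntegral_polar hn (Φ := Set.indicator {x | s < |K x|} 1) (aemeasurable_one.indicator₀ hnull) measurableSet_Ioo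
    (fun r hr => hr.1)]
  calc _ ≤ ∫⁻ ω : Sn n, ENNReal.ofReal (s ^ (-q) / n) * ENNReal.ofReal ((|g ω| + B) ^ q) ∂(surf n) := by
        refine lintegral_mono fun ω => ?_
        set G := |g ω| + B with hG
        have hG0 : 0 ≤ G := by positivity
        set ρ := (G / s) ^ (q / n) with hρ
        have hρ0 : 0 ≤ ρ := by positivity
        calc _ ≤ ∫⁻ r in Set.Ioo 0 R, (Set.Ioo 0 ρ).indicator
              (fun r => ENNReal.ofReal (r ^ ((n : ℝ) - 1))) r := by
              refine setLIntegral_mono' measurableSet_Ioo fun r hr => ?_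
              by_cases hmem : s < |K (r • (ω : Rn n))|
              · have h1 := hmem.trans_le (abs_kernel_le hε hM0 hM ω hr.1 hr.2.le)
                have h2 : r < ρ := by
                  have hrp : 0 < r ^ ((n : ℝ) - α) := Real.rpow_pos_of_pos hr.1 _
                  rw [show α - n = -((n : ℝ) - α) by ring, Real.rpow_neg hr.1.le,
                    ← div_eq_mul_inv, lt_div_iff₀ hrp] at h1
                  have h3 : r ^ ((n : ℝ) - α) < G / s := by
                    rw [lt_div_iff₀ hs]; linarith
                  have h4 := Real.rpow_lt_rpow hrp.le h3 (show 0 < q / n by positivity)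
                  rw [← Real.rpow_mul hr.1.le] at h4
                  have h5 : ((n : ℝ) - α) * (q / n) = 1 := by
                    rw [← mul_div_assoc, sub_mul_qExp hαn, div_self hn'.ne']
                  rwa [h5, Real.rpow_one] at h4
                rw [Set.indicator_of_mem (show r • (ω : Rn n) ∈ {x | s < |K x|} from hmem),
                  Set.indicator_of_mem (show r ∈ Set.Ioo 0 ρ from ⟨hr.1, h2⟩), Pi.one_apply, mul_one,
                  ← Real.rpow_natCast, Nat.cast_sub hn, Nat.cast_one]
              · rw [Set.indicator_of_notMem
                  (show r • (ω : Rn n) ∉ {x | s < |K x|} from hmem), mul_zero]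
                exact zero_le
          _ ≤ ∫⁻ r in Set.Ioo 0 ρ, ENNReal.ofReal (r ^ ((n : ℝ) - 1)) := by
              rw [setLIntegral_indicator measurableSet_Ioo]
              exact lintegral_mono_set Set.inter_subset_left
          _ = _ := by
              rw [lintegral_Ioo_rpow hρ0 (by linarith), ← ENNReal.ofReal_mul (by positivity)]
              congr 1
              rw [sub_add_cancel, hρ, ← Real.rpow_mul (by positivity), div_mul_cancel₀ _ hn'.ne',
                Real.div_rpow hG0 hs.le, Real.rpow_neg hs.le]
              field_simp
    _ = _ := by
        rw [lintegral_const_mul' _ _ ENNReal.ofReal_ne_top, ← hW,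
          ← ENNReal.ofReal_toReal hWt.ne, ← ENNReal.ofReal_mul (by positivity),
          ENNReal.toReal_ofReal ENNReal.toReal_nonneg]
        congr 1
        ring

/-- The source of the sharp constant. Since |r^(α-n)|^q = r^(-n), the leading part contributes |g
ω|^q ∫ dr/r in each direction, and ∫ |g|^q = n A_g. The remainder of the expansion enters linearly
through `add_rpow_le_real` and leaves the integrable r^(ε-1). -/
theorem lintegral_min_near (hα : 0 < α) (hαn : α < n) (hε : 0 < ε) (hR : 0 < R) (hM0 : 0 ≤ M)
    (hK : AEStronglyMeasurable K volume) (hg : MemLp g (ENNReal.ofReal (qExp n α)) (surf n))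
    (hM : ∀ (ω : Sn n) (r : ℝ), 0 < r → r ≤ R →
      |K (r • (ω : Rn n)) - g ω * r ^ (α - n)| ≤ M * r ^ (α - n + ε)) :
    ∃ C : ℝ, 0 ≤ C ∧ ∀ κ : ℝ, 1 ≤ κ →
      ∫⁻ x in norm ⁻¹' Set.Ioo 0 R, ENNReal.ofReal (min |K x| κ ^ qExp n α) ≤
        .ofReal (sphConst n α g * Real.log (κ ^ qExp n α) + C) := by
  have hn := natCast_pos_of_lt hα hαn
  have hn' : (0 : ℝ) < n := by exact_mod_cast hn
  have hq := qExp_pos hα hαn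
  have hq1 : 1 < qExp n α := (holderConjugate hα hαn).symm.lt
  have hqs := sub_mul_qExp hαn
  have hlinq := lintegral_rpow_sphere hα hαn hg
  set q := qExp n α with hqdef
  set B := M * R ^ ε with hB
  have hB0 : 0 ≤ B := by positivity
  set W := ∫⁻ ω, ENNReal.ofReal ((|g ω| + (1 + B)) ^ q) ∂(surf n) with hW
  have hWt : W < ∞ := lintegral_add_const_rpow_sphere_lt_top hα hαn hg (1 + B) (by positivity)
  set c₁ := q * M * (R ^ ε / ε) with hc₁
  have hc₁0 : 0 ≤ c₁ := by positivity
  set c₂ := R ^ n / n with hc₂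
  have hc₂0 : 0 ≤ c₂ := by positivity
  refine ⟨(c₁ + c₂) * W.toReal, by positivity, fun κ hκ => ?_⟩
  have hκ0 : 0 < κ := by linarith
  have hlog : 0 ≤ Real.log (κ ^ q) := Real.log_nonneg (Real.one_le_rpow hκ hq.le)
  rw [setLIntegral_polar hn (by
    exact ((hK.aemeasurable.abs.min aemeasurable_const).pow_const q).ennreal_ofReal)
    measurableSet_Ioo (fun r hr => hr.1)]
  -- A cut radius independent of the direction: below it the bound κ^q contributes κ^q r₁^n / n =
  -- R^n / n, and above it log(R/r₁) = log(κ^q)/n exactly.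
  set r₁ := R * κ ^ (-(q / n)) with hr₁
  have hr₁0 : 0 < r₁ := by positivity
  have hr₁R : r₁ ≤ R := by
    have : κ ^ (-(q / n)) ≤ 1 := Real.rpow_le_one_of_one_le_of_nonpos hκ (by
      have : 0 < q / n := by positivity
      linarith)
    rw [hr₁]
    exact mul_le_of_le_one_right hR.le this
  have hlogr : Real.log (R / r₁) = Real.log (κ ^ q) / n := by
    rw [hr₁, ← div_div, div_self hR.ne', one_div, ← Real.rpow_neg hκ0.le, neg_neg,
      Real.log_rpow hκ0, Real.log_rpow hκ0]
    ring
  calc _ ≤ ∫⁻ ω : Sn n, (ENNReal.ofReal (Real.log (κ ^ q) / n) * ENNReal.ofReal (|g ω| ^ q) +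
        ENNReal.ofReal (c₁ + c₂) * ENNReal.ofReal ((|g ω| + (1 + B)) ^ q)) ∂(surf n) := by
        refine lintegral_mono fun ω => ?_
        set G := |g ω| with hG
        have hG0 : 0 ≤ G := abs_nonneg _
        have hpt : ∀ r ∈ Set.Ioo 0 R, ENNReal.ofReal (r ^ (n - 1)) *
            ENNReal.ofReal (min |K (r • (ω : Rn n))| κ ^ q) ≤
            ((Set.Ioo 0 r₁).indicator (fun r => ENNReal.ofReal (κ ^ q) *
              ENNReal.ofReal (r ^ ((n : ℝ) - 1))) r +
            (Set.Ico r₁ R).indicator (fun r => ENNReal.ofReal (G ^ q) * ENNReal.ofReal r⁻¹) r) +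
            ENNReal.ofReal (q * (G + B) ^ (q - 1) * M) * ENNReal.ofReal (r ^ (ε - 1)) := by
          intro r hr
          have hr0 := hr.1
          set t := r ^ (α - n) with ht
          have ht0 : 0 < t := Real.rpow_pos_of_pos hr0 _
          have hKle : min |K (r • (ω : Rn n))| κ ≤ min (G * t) κ + M * r ^ (α - n + ε) := by
            have h1 := hM ω r hr0 hr.2.le
            have h2 : |K (r • (ω : Rn n))| ≤ G * t + M * r ^ (α - n + ε) := by
              have := abs_sub_abs_le_abs_sub (K (r • (ω : Rn n))) (g ω * t)
              rw [abs_mul, abs_of_pos ht0] at this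
              linarith
            have h3 : 0 ≤ M * r ^ (α - n + ε) := by positivity
            rcases le_total (G * t) κ with h | h
            · rw [min_eq_left h]; exact (min_le_left _ _).trans h2
            · rw [min_eq_right h]; exact (min_le_right _ _).trans (by linarith)
          have ha0 : 0 ≤ min (G * t) κ := le_min (by positivity) hκ0.le
          have hb0 : 0 ≤ M * r ^ (α - n + ε) := by positivity
          have hsum : min (G * t) κ + M * r ^ (α - n + ε) ≤ (G + B) * t := by
            have h2 : r ^ ε ≤ R ^ ε := Real.rpow_le_rpow hr0.le hr.2.le hε.le
            have h3 : M * r ^ (α - n + ε) ≤ B * t := by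
              rw [Real.rpow_add hr0, ← ht, hB]
              calc M * (t * r ^ ε) ≤ M * (t * R ^ ε) := by gcongr
                _ = _ := by ring
            have := min_le_left (G * t) κ
            linarith
          have hmain : min |K (r • (ω : Rn n))| κ ^ q ≤ min (G * t) κ ^ q +
              q * (G + B) ^ (q - 1) * M * r ^ (ε - n) := by
            calc _ ≤ (min (G * t) κ + M * r ^ (α - n + ε)) ^ q := by
                  have : 0 ≤ min |K (r • (ω : Rn n))| κ := le_min (abs_nonneg _) hκ0.le
                  gcongr
              _ ≤ _ := add_rpow_le_real hq1 ha0 hb0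
              _ ≤ min (G * t) κ ^ q + q * ((G + B) * t) ^ (q - 1) * (M * r ^ (α - n + ε)) := by
                  gcongr
              _ = _ := by
                  have e : t ^ (q - 1) * r ^ (α - n + ε) = r ^ (ε - n) := by
                    rw [ht, ← Real.rpow_mul hr0.le, ← Real.rpow_add hr0]
                    congr 1
                    linarith
                  rw [Real.mul_rpow (by positivity) ht0.le]
                  linear_combination (q * (G + B) ^ (q - 1) * M) * e
          have hpow : r ^ (n - 1) = r ^ ((n : ℝ) - 1) := by
            rw [← Real.rpow_natCast, Nat.cast_sub hn, Nat.cast_one]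
          have hlast : ENNReal.ofReal (r ^ (n - 1)) *
              ENNReal.ofReal (q * (G + B) ^ (q - 1) * M * r ^ (ε - n)) =
              ENNReal.ofReal (q * (G + B) ^ (q - 1) * M) * ENNReal.ofReal (r ^ (ε - 1)) := by
            rw [← ENNReal.ofReal_mul (by positivity), ← ENNReal.ofReal_mul (by positivity), hpow]
            congr 1
            rw [show ε - 1 = ((n : ℝ) - 1) + (ε - n) by ring, Real.rpow_add hr0]
            ring
          refine (mul_le_mul_right (ENNReal.ofReal_le_ofReal hmain) _).trans ?_
          rw [ENNReal.ofReal_add (by positivity) (by positivity), mul_add, hlast]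
          gcongr
          rcases lt_or_ge r r₁ with h | h
          · rw [Set.indicator_of_mem (show r ∈ Set.Ioo 0 r₁ from ⟨hr0, h⟩), hpow, mul_comm]
            refine le_add_right ?_
            gcongr
            exact min_le_right _ _
          · rw [Set.indicator_of_mem (show r ∈ Set.Ico r₁ R from ⟨h, hr.2⟩)]
            refine le_add_left ?_
            rw [← ENNReal.ofReal_mul (by positivity), ← ENNReal.ofReal_mul (by positivity), hpow]
            apply ENNReal.ofReal_le_ofReal
            calc _ ≤ r ^ ((n : ℝ) - 1) * (G * t) ^ q := by gcongr; exact min_le_left _ _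
              _ = _ := by
                rw [Real.mul_rpow hG0 ht0.le, ht, ← Real.rpow_mul hr0.le, ← Real.rpow_neg_one]
                have : ((n : ℝ) - 1) + (α - n) * q = -1 := by linarith
                rw [← this, Real.rpow_add hr0]
                ring
        refine (setLIntegral_mono' measurableSet_Ioo hpt).trans ?_
        have m1 : Measurable fun r : ℝ => ENNReal.ofReal (κ ^ q) *
              ENNReal.ofReal (r ^ ((n : ℝ) - 1)) := by fun_prop
        have m2 : Measurable fun r : ℝ => ENNReal.ofReal (G ^ q) * ENNReal.ofReal r⁻¹ := by fun_prop
        have m12 : Measurable fun r => (Set.Ioo 0 r₁).indicator (fun r => ENNReal.ofReal (κ ^ q) *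
            ENNReal.ofReal (r ^ ((n : ℝ) - 1))) r +
            (Set.Ico r₁ R).indicator (fun r => ENNReal.ofReal (G ^ q) * ENNReal.ofReal r⁻¹) r :=
          (m1.indicator measurableSet_Ioo).add (m2.indicator measurableSet_Ico)
        rw [lintegral_add_left m12, lintegral_add_left (m1.indicator measurableSet_Ioo),
          setLIntegral_indicator measurableSet_Ioo, setLIntegral_indicator measurableSet_Ico]
        have i1 : ∫⁻ r in Set.Ioo 0 r₁ ∩ Set.Ioo 0 R, ENNReal.ofReal (κ ^ q) *
            ENNReal.ofReal (r ^ ((n : ℝ) - 1)) ≤ ENNReal.ofReal c₂ := by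
          refine (lintegral_mono_set Set.inter_subset_left).trans ?_
          rw [lintegral_const_mul' _ _ ENNReal.ofReal_ne_top,
            lintegral_Ioo_rpow hr₁0.le (by linarith), ← ENNReal.ofReal_mul (by positivity)]
          apply le_of_eq
          congr 1
          rw [sub_add_cancel, hr₁, Real.mul_rpow hR.le (by positivity), ← Real.rpow_mul hκ0.le,
            hc₂, Real.rpow_natCast]
          have : κ ^ q * κ ^ (-(q / n) * n) = 1 := by
            rw [← Real.rpow_add hκ0]
            have : q + -(q / n) * n = 0 := by field_simp; ring
            rw [this, Real.rpow_zero]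
          linear_combination (R ^ n / n) * this
        have i2 : ∫⁻ r in Set.Ico r₁ R ∩ Set.Ioo 0 R, ENNReal.ofReal (G ^ q) * ENNReal.ofReal r⁻¹ ≤
            ENNReal.ofReal (Real.log (κ ^ q) / n) * ENNReal.ofReal (G ^ q) := by
          refine (lintegral_mono_set Set.inter_subset_left).trans ?_
          rw [lintegral_const_mul' _ _ ENNReal.ofReal_ne_top, setLIntegral_congr Ioo_ae_eq_Ico.symm,
            lintegral_Ioo_inv hr₁0 hr₁R, hlogr, mul_comm]
        have i3 : ∫⁻ r in Set.Ioo 0 R, ENNReal.ofReal (q * (G + B) ^ (q - 1) * M) *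
            ENNReal.ofReal (r ^ (ε - 1)) ≤
            ENNReal.ofReal c₁ * ENNReal.ofReal ((G + (1 + B)) ^ q) := by
          rw [lintegral_const_mul' _ _ ENNReal.ofReal_ne_top,
            lintegral_Ioo_rpow hR.le (by linarith), ← ENNReal.ofReal_mul (by positivity),
            ← ENNReal.ofReal_mul hc₁0, sub_add_cancel]
          apply ENNReal.ofReal_le_ofReal
          have : (G + B) ^ (q - 1) ≤ (G + (1 + B)) ^ q := by
            calc (G + B) ^ (q - 1) ≤ (G + (1 + B)) ^ (q - 1) := by
                  apply Real.rpow_le_rpow (by positivity) (by linarith) (by linarith)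
              _ ≤ _ := Real.rpow_le_rpow_of_exponent_le (by linarith) (by linarith)
          calc q * (G + B) ^ (q - 1) * M * (R ^ ε / ε) = c₁ * (G + B) ^ (q - 1) := by
                rw [hc₁]; ring
            _ ≤ _ := by gcongr
        have h1W : ENNReal.ofReal c₂ ≤ ENNReal.ofReal c₂ * ENNReal.ofReal ((G + (1 + B)) ^ q) := by
          rw [← ENNReal.ofReal_mul hc₂0]
          apply ENNReal.ofReal_le_ofReal
          exact le_mul_of_one_le_right hc₂0 (Real.one_le_rpow (by linarith) hq.le)
        refine (add_le_add (add_le_add (i1.trans h1W) i2) i3).trans (le_of_eq ?_)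
        rw [ENNReal.ofReal_add hc₁0 hc₂0]
        ring
    _ = ENNReal.ofReal (Real.log (κ ^ q) / n) * ENNReal.ofReal (n * sphConst n α g) +
        ENNReal.ofReal (c₁ + c₂) * W := by
        rw [lintegral_add_left', lintegral_const_mul' _ _ ENNReal.ofReal_ne_top,
          lintegral_const_mul' _ _ ENNReal.ofReal_ne_top, hlinq]
        exact ((hg.aestronglyMeasurable.aemeasurable.abs.pow_const q).ennreal_ofReal).const_mul _
    _ = _ := by
        have hA0 : 0 ≤ sphConst n α g := sphConst_nonneg
        rw [← ENNReal.ofReal_mul (by positivity)]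
        conv_lhs => rw [← ENNReal.ofReal_toReal hWt.ne]
        rw [← ENNReal.ofReal_mul (by positivity), ← ENNReal.ofReal_add (by positivity)
          (by positivity)]
        congr 1
        field_simp

theorem lintegral_rpow_far_lt_top {s : Set (Rn n)} (hα : 0 < α) (hαn : α < n)
    (h : MemLp K (ENNReal.ofReal (qExp n α)) (volume.restrict s)) :
    ∫⁻ x in s, ENNReal.ofReal (|K x| ^ qExp n α) < ∞ := by
  have hq := qExp_pos hα hαn
  have := (h.integrable_norm_rpow (by simpa using hq) (by simp)).lintegral_lt_top
  simpa [ENNReal.toReal_ofReal hq.le] using this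

/-- A kernel with the local expansion and the decay at infinity is of weak type. -/
theorem weak_kernel (hα : 0 < α) (hαn : α < n) (hε : 0 < ε) (hR : 0 < R)
    (hK : AEStronglyMeasurable K volume) (hg : MemLp g (ENNReal.ofReal (qExp n α)) (surf n))
    (hM0 : 0 ≤ M) (hM : ∀ (ω : Sn n) (r : ℝ), 0 < r → r ≤ R →
      |K (r • (ω : Rn n)) - g ω * r ^ (α - n)| ≤ M * r ^ (α - n + ε))
    (htail : TailCondition α R K) :
    ∃ C : ℝ, 0 ≤ C ∧ ∀ s, 0 < s → volume {x | s < |K x|} ≤ .ofReal (C * s ^ (-qExp n α)) := by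
  have hq := qExp_pos hα hαn
  obtain ⟨C, hC0, hC⟩ := weak_near hα hαn hε hR hM0 hK hg hM
  set V := ∫⁻ x in {x : Rn n | R ≤ ‖x‖}, ENNReal.ofReal (|K x| ^ qExp n α) with hV
  have hVt : V < ∞ := lintegral_rpow_far_lt_top hα hαn htail.1
  refine ⟨C + V.toReal, by positivity, fun s hs => ?_⟩
  have hnull : NullMeasurableSet {x | s < |K x|} volume :=
    nullMeasurableSet_lt aemeasurable_const hK.aemeasurable.abs
  have hmeas : ∀ t : Set (Rn n), (volume.restrict t) {x : Rn n | s < |K x|} =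
      ∫⁻ x in t, Set.indicator {x | s < |K x|} 1 x := fun t => by
    rw [lintegral_indicator_one₀ (hnull.mono_ac Measure.restrict_le_self.absolutelyContinuous)]
  have hfar : (volume.restrict {x : Rn n | R ≤ ‖x‖}) {x : Rn n | s < |K x|} ≤
      .ofReal (V.toReal * s ^ (-qExp n α)) := by
    have h1 := meas_ge_le_lintegral_div (μ := volume.restrict {x : Rn n | R ≤ ‖x‖})
      (f := fun x => ENNReal.ofReal (|K x| ^ qExp n α))
      ((hK.aemeasurable.abs.pow_const _).ennreal_ofReal.restrict)
      (ε := ENNReal.ofReal (s ^ qExp n α)) (by simpa using Real.rpow_pos_of_pos hs _) (by simp)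
    refine le_trans (measure_mono (Set.ofPred_subset_ofPred.2 fun x hx => ?_)) (h1.trans ?_)
    · have : s < |K x| := hx
      gcongr
    · rw [← hV]
      conv_lhs => rw [← ENNReal.ofReal_toReal hVt.ne]
      rw [← ENNReal.ofReal_div_of_pos (by positivity), Real.rpow_neg hs.le, div_eq_mul_inv]
  have hsplit := lintegral_norm_split (natCast_pos_of_lt hα hαn) R hR
    (Set.indicator {x | s < |K x|} 1)
  rw [lintegral_indicator_one₀ hnull, ← hmeas, ← hmeas] at hsplit
  rw [hsplit, add_mul, ENNReal.ofReal_add (by positivity) (by positivity)]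
  exact add_le_add (hC s hs) hfar

theorem lintegral_min_kernel (hα : 0 < α) (hαn : α < n) (hε : 0 < ε) (hR : 0 < R)
    (hK : AEStronglyMeasurable K volume) (hg : MemLp g (ENNReal.ofReal (qExp n α)) (surf n))
    (hM0 : 0 ≤ M) (hM : ∀ (ω : Sn n) (r : ℝ), 0 < r → r ≤ R →
      |K (r • (ω : Rn n)) - g ω * r ^ (α - n)| ≤ M * r ^ (α - n + ε))
    (htail : TailCondition α R K) :
    ∃ C : ℝ, 0 ≤ C ∧ ∀ κ : ℝ, 1 ≤ κ → ∫⁻ x, ENNReal.ofReal (min |K x| κ ^ qExp n α) ≤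
        .ofReal (sphConst n α g * Real.log (κ ^ qExp n α) + C) := by
  have hq := qExp_pos hα hαn
  obtain ⟨C, hC0, hC⟩ := lintegral_min_near hα hαn hε hR hM0 hK hg hM
  set V := ∫⁻ x in {x : Rn n | R ≤ ‖x‖}, ENNReal.ofReal (|K x| ^ qExp n α) with hV
  have hVt : V < ∞ := lintegral_rpow_far_lt_top hα hαn htail.1
  refine ⟨C + V.toReal, by positivity, fun κ hκ => ?_⟩
  have hlog : 0 ≤ Real.log (κ ^ qExp n α) := Real.log_nonneg (Real.one_le_rpow hκ hq.le)
  have hA0 : 0 ≤ sphConst n α g := sphConst_nonneg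
  rw [lintegral_norm_split (natCast_pos_of_lt hα hαn) R hR, ← add_assoc,
    ENNReal.ofReal_add (by positivity) (by positivity), ENNReal.ofReal_toReal hVt.ne]
  refine add_le_add (hC κ hκ) (lintegral_mono fun x => ?_)
  have : 0 ≤ min |K x| κ := le_min (abs_nonneg _) (by linarith)
  gcongr
  exact min_le_left _ _

/-- Each section of (x, y) ↦ K(x - y) is a translate of K, reflected or not, so every bound reduces
to an integral of |K|. The strongly measurable representative is used to make the kernel jointly
measurable. -/
theorem criticalKernel_of_expansion (hα : 0 < α) (hαn : α < n) (hε : 0 < ε) (hR : 0 < R)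
    (hK : AEStronglyMeasurable K volume) (hg : MemLp g (ENNReal.ofReal (qExp n α)) (surf n))
    (hloc : LocalExpansion α ε R K g) (htail : TailCondition α R K) :
    ∃ C : ℝ, 0 ≤ C ∧ CriticalKernel (qExp n α) (sphConst n α g) C (volume : Measure (Rn n))
      (volume : Measure (Rn n)) (fun x y => ENNReal.ofReal |hK.mk K (x - y)|) := by
  have hq := qExp_pos hα hαn
  have hq1 : 1 < qExp n α := (holderConjugate hα hαn).symm.lt
  obtain ⟨M', hM'⟩ := hloc
  have hM : ∀ (ω : Sn n) (r : ℝ), 0 < r → r ≤ R →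
      |K (r • (ω : Rn n)) - g ω * r ^ (α - n)| ≤ max M' 0 * r ^ (α - n + ε) := fun ω r h0 hr =>
    (hM' ω r h0 hr).trans (by gcongr; exact le_max_left _ _)
  obtain ⟨C₁, hC₁0, hC₁⟩ := weak_kernel hα hαn hε hR hK hg (le_max_right _ _) hM htail
  obtain ⟨C₂, hC₂0, hC₂⟩ := lintegral_min_kernel hα hαn hε hR hK hg (le_max_right _ _) hM htail
  have hKm : Measurable (hK.mk K) := hK.stronglyMeasurable_mk.measurable
  have hae := hK.ae_eq_mk
  set C := max C₂ (max (C₁ / (qExp n α - 1)) (qExp n α * C₁)) with hCdef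
  have hC0 : 0 ≤ C := hC₂0.trans (le_max_left _ _)
  have hCa : C₁ / (qExp n α - 1) ≤ C := (le_max_left _ _).trans (le_max_right _ _)
  have hCb : qExp n α * C₁ ≤ C := (le_max_right _ _).trans (le_max_right _ _)
  have hv : AEMeasurable (fun x => |K x|) volume := hK.aemeasurable.abs
  have hexc : ∀ κ : ℝ, 1 ≤ κ → ∫⁻ z, (ENNReal.ofReal |hK.mk K z| - .ofReal κ) ≤
      .ofReal (C * κ ^ (1 - qExp n α)) := fun κ hκ => by
    have e : ∫⁻ z, (ENNReal.ofReal |hK.mk K z| - .ofReal κ) = ∫⁻ z, ENNReal.ofReal (|K z| - κ) := by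
      apply lintegral_congr_ae
      filter_upwards [hae] with z hz
      rw [← hz, ENNReal.ofReal_sub _ (by linarith)]
    rw [e]
    refine (lintegral_excess_le_of_weak hq1 hC₁0 hv hC₁ (by linarith)).trans ?_
    gcongr
  refine ⟨C, hC0, ?_, ?_, ?_, ?_, ?_⟩
  · exact (hKm.comp (measurable_fst.sub measurable_snd)).abs.ennreal_ofReal
  · intro x κ hκ
    rw [lintegral_sub_left_eq_self
      (fun z => min (ENNReal.ofReal |hK.mk K z|) (.ofReal κ) ^ qExp n α) x]
    have e : ∫⁻ z, min (ENNReal.ofReal |hK.mk K z|) (.ofReal κ) ^ qExp n α =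
        ∫⁻ z, ENNReal.ofReal (min |K z| κ ^ qExp n α) := by
      apply lintegral_congr_ae
      filter_upwards [hae] with z hz
      have : 0 ≤ min |K z| κ := le_min (abs_nonneg _) (by linarith)
      rw [← hz, ← ENNReal.ofReal_min, ENNReal.ofReal_rpow_of_nonneg this hq.le]
    rw [e]
    refine (hC₂ κ hκ).trans ?_
    gcongr
    exact le_max_left _ _
  · intro x κ hκ
    rw [lintegral_sub_left_eq_self (fun z => ENNReal.ofReal |hK.mk K z| - .ofReal κ) x]
    exact hexc κ hκ
  · intro y κ hκ
    rw [lintegral_sub_right_eq_self (fun z => ENNReal.ofReal |hK.mk K z| - .ofReal κ) y]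
    exact hexc κ hκ
  · intro x κ κ' hκ hκκ
    rw [lintegral_sub_left_eq_self
      (fun z => min (ENNReal.ofReal |hK.mk K z| - .ofReal κ) (.ofReal κ') ^ qExp n α) x]
    have e : ∫⁻ z, min (ENNReal.ofReal |hK.mk K z| - .ofReal κ) (.ofReal κ') ^ qExp n α =
        ∫⁻ z, min (ENNReal.ofReal (|K z| - κ)) (.ofReal κ') ^ qExp n α := by
      apply lintegral_congr_ae
      filter_upwards [hae] with z hz
      rw [← hz, ENNReal.ofReal_sub _ (by linarith)]
    rw [e]
    refine (lintegral_band_le_of_weak hq1 hC₁0 hv hC₁ (by linarith) hκκ).trans ?_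
    have : 0 ≤ Real.log (κ' / κ) := Real.log_nonneg ((one_le_div (by linarith)).2 hκκ)
    gcongr

end Near

/-! ### The regularized exponential -/

theorem expReg_le_exp (N : ℕ) {t : ℝ} (ht : 0 ≤ t) : expReg N t ≤ Real.exp t :=
  sub_le_self _ (Finset.sum_nonneg fun k _ => by positivity)

/-- The tail of the exponential series is t^(N+1) Σ t^k/(k+N+1)!, and (k+N+1)! ≥ k!. -/
theorem expReg_le_pow_mul_exp (N : ℕ) {t : ℝ} (ht : 0 ≤ t) :
    expReg N t ≤ t ^ (N + 1) * Real.exp t := by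
  have hs : HasSum (fun k : ℕ => t ^ k / (k.factorial : ℝ)) (Real.exp t) := by
    rw [Real.exp_eq_exp_ℝ]
    exact NormedSpace.expSeries_div_hasSum_exp t
  have h1 : HasSum (fun k : ℕ => t ^ (k + (N + 1)) / ((k + (N + 1)).factorial : ℝ))
      (expReg N t) := (hasSum_nat_add_iff' (N + 1)).2 hs
  refine hasSum_le (fun k => ?_) h1 (hs.mul_left (t ^ (N + 1)))
  rw [pow_add, mul_comm (t ^ k), ← mul_div_assoc]
  gcongr
  omega

theorem exists_exp_le_expReg (N : ℕ) :
    ∃ t₀ : ℝ, ∀ t, t₀ ≤ t → Real.exp t / 2 ≤ expReg N t := by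
  have h : Tendsto (fun t : ℝ => ∑ k ∈ Finset.range (N + 1), t ^ k / (k.factorial : ℝ) *
      Real.exp (-t)) atTop (𝓝 (∑ k ∈ Finset.range (N + 1), 0)) := by
    refine tendsto_finsetSum _ fun k _ => ?_
    have := (Real.tendsto_pow_mul_exp_neg_atTop_nhds_zero k).div_const (k.factorial : ℝ)
    rw [zero_div] at this
    refine this.congr fun t => by ring
  rw [Finset.sum_const_zero] at h
  obtain ⟨t₀, ht₀⟩ := eventually_atTop.1 (h.eventually (ge_mem_nhds (show (0 : ℝ) < 1 / 2 by norm_num)))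
  refine ⟨t₀, fun t ht => ?_⟩
  have h1 := ht₀ t ht
  rw [← Finset.sum_mul, Real.exp_neg, ← div_eq_mul_inv, div_le_iff₀ (Real.exp_pos t)] at h1
  unfold expReg
  linarith

/-- This explains the number of subtracted terms. Since q (p - 1) = p and N + 1 ≥ p - 1, the first
surviving power of t = |u|^q is at most |u|^p wherever |u| ≤ 1. -/
theorem regOrder_bound {n : ℕ} {α : ℝ} (hα : 0 < α) (hαn : α < n) :
    pExp n α ≤ qExp n α * (regOrder n α + 1 : ℕ) := by
  have h1 : (n : ℝ) / α - 2 ≤ regOrder n α := Nat.le_ceil _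
  have hq := qExp_pos hα hαn
  have h2 := (holderConjugate hα hαn).symm.sub_one_mul_conj
  have h3 := (holderConjugate hα hαn).sub_one_mul_conj
  have h4 : pExp n α - 1 ≤ regOrder n α + 1 := by unfold pExp; linarith
  push_cast
  nlinarith

/-! ### Potentials -/

section Potential

variable {n : ℕ} {α ε R : ℝ} {K f : Rn n → ℝ} {g : Sn n → ℝ}

theorem lintegral_convolution_eq (hK : AEStronglyMeasurable K volume)
    (hf : AEStronglyMeasurable f volume) (x : Rn n) :
    ∫⁻ t, ‖K t * f (x - t)‖ₑ =
      ∫⁻ y, ENNReal.ofReal |hK.mk K (x - y)| * ENNReal.ofReal |hf.mk f y| := by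
  rw [← lintegral_sub_left_eq_self
    (fun y => ENNReal.ofReal |hK.mk K (x - y)| * ENNReal.ofReal |hf.mk f y|) x]
  apply lintegral_congr_ae
  have h2 := (quasiMeasurePreserving_sub_left (volume : Measure (Rn n)) x).ae_eq_comp hf.ae_eq_mk
  filter_upwards [hK.ae_eq_mk, h2] with t h1 h2
  simp only [Function.comp_apply] at h2
  rw [sub_sub_cancel, ← h1, ← h2, enorm_mul, Real.enorm_eq_ofReal_abs, Real.enorm_eq_ofReal_abs]

theorem enorm_pot_le (K f : Rn n → ℝ) (x : Rn n) :
    ‖pot K f x‖ₑ ≤ ∫⁻ t, ‖K t * f (x - t)‖ₑ := by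
  unfold pot convolution
  exact enorm_integral_le_lintegral_enorm _

theorem aestronglyMeasurable_pot (hK : AEStronglyMeasurable K volume)
    (hf : AEStronglyMeasurable f volume) : AEStronglyMeasurable (pot K f) volume := by
  unfold pot convolution
  exact (hK.convolution_integrand (ContinuousLinearMap.mul ℝ ℝ) hf).integral_prod_right'

theorem normLp_rpow (hα : 0 < α) (hαn : α < n) (f : Rn n → ℝ) :
    normLp α f ^ pExp n α = ∫⁻ x, ENNReal.ofReal |f x| ^ pExp n α := by
  have hp := (holderConjugate hα hαn).pos
  unfold normLp
  rw [eLpNorm_eq_lintegral_rpow_enorm_toReal (by simpa using hp) (by simp),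
    ENNReal.toReal_ofReal hp.le, ← ENNReal.rpow_mul, one_div_mul_cancel hp.ne', ENNReal.rpow_one]
  simp_rw [Real.enorm_eq_ofReal_abs]

theorem lintegral_mk_rpow (hα : 0 < α) (hαn : α < n) (hf : AEStronglyMeasurable f volume) :
    ∫⁻ x, ENNReal.ofReal |hf.mk f x| ^ pExp n α = normLp α f ^ pExp n α := by
  rw [normLp_rpow hα hαn]
  apply lintegral_congr_ae
  filter_upwards [hf.ae_eq_mk] with x hx
  rw [hx]

theorem lintegral_mk_rpow_le_one (hα : 0 < α) (hαn : α < n) (hf : AEStronglyMeasurable f volume)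
    (h1 : normLp α f ≤ 1) : ∫⁻ x, ENNReal.ofReal |hf.mk f x| ^ pExp n α ≤ 1 := by
  rw [lintegral_mk_rpow hα hαn]
  exact ENNReal.rpow_le_one h1 (holderConjugate hα hαn).pos.le

theorem measurable_mk_abs (hf : AEStronglyMeasurable f volume) :
    Measurable fun y => ENNReal.ofReal |hf.mk f y| :=
  hf.stronglyMeasurable_mk.measurable.abs.ennreal_ofReal

/-- The absolute potential is integrable on balls, with a bound linear in `‖f‖`. -/
theorem setLIntegral_abs_potential_le (hα : 0 < α) (hαn : α < n) (hε : 0 < ε) (hR : 0 < R)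
    (hK : AEStronglyMeasurable K volume) (hg : MemLp g (ENNReal.ofReal (qExp n α)) (surf n))
    (hloc : LocalExpansion α ε R K g) (htail : TailCondition α R K) (E : Set (Rn n))
    (hE : volume E ≠ ∞) :
    ∃ S : ℝ, 0 ≤ S ∧ ∀ f : Rn n → ℝ, AEStronglyMeasurable f volume →
      ∫⁻ x in E, (∫⁻ t, ‖K t * f (x - t)‖ₑ) ≤ .ofReal S * normLp α f := by
  obtain ⟨C, hC0, hC⟩ := criticalKernel_of_expansion hα hαn hε hR hK hg hloc htail
  obtain ⟨S, hS0, hS⟩ := hC.setLIntegral_potential_le (holderConjugate hα hαn) sphConst_nonneg hC0 hE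
  refine ⟨S, hS0, fun f hf => ?_⟩
  have := hS _ (measurable_mk_abs hf)
  rw [lintegral_mk_rpow hα hαn, ← ENNReal.rpow_mul,
    mul_one_div_cancel (holderConjugate hα hαn).pos.ne', ENNReal.rpow_one] at this
  simp_rw [lintegral_convolution_eq hK hf]
  exact this

/-- The potential of |f| under |K| is integrable over every ball, hence finite almost everywhere. -/
theorem ae_convolutionExistsAt (hα : 0 < α) (hαn : α < n) (hε : 0 < ε) (hR : 0 < R)
    (hK : AEStronglyMeasurable K volume) (hg : MemLp g (ENNReal.ofReal (qExp n α)) (surf n))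
    (hloc : LocalExpansion α ε R K g) (htail : TailCondition α R K) (hf : InLp α f) :
    ∀ᵐ x, ConvolutionExistsAt K f x (ContinuousLinearMap.mul ℝ ℝ) volume := by
  have hfm := hf.aestronglyMeasurable
  have hfin : ∀ᵐ x, ∫⁻ t, ‖K t * f (x - t)‖ₑ < ∞ := by
    have hcover : ∀ᵐ x ∂volume.restrict (⋃ N : ℕ, Metric.ball (0 : Rn n) N),
        ∫⁻ t, ‖K t * f (x - t)‖ₑ < ∞ := by
      rw [ae_restrict_iUnion_iff]
      intro N
      obtain ⟨S, hS0, hS⟩ := setLIntegral_abs_potential_le hα hαn hε hR hK hg hloc htail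
        (Metric.ball 0 N) measure_ball_lt_top.ne
      refine ae_lt_top' ?_ ((hS f hfm).trans_lt
        (ENNReal.mul_lt_top ENNReal.ofReal_lt_top hf.2)).ne
      simp_rw [lintegral_convolution_eq hK hfm]
      have hm : Measurable fun z : Rn n × Rn n =>
          ENNReal.ofReal |hK.mk K (z.1 - z.2)| * ENNReal.ofReal |hfm.mk f z.2| :=
        ((hK.stronglyMeasurable_mk.measurable.comp
          (measurable_fst.sub measurable_snd)).abs.ennreal_ofReal).mul
          ((measurable_mk_abs hfm).comp measurable_snd)
      exact hm.lintegral_prod_right'.aemeasurable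
    rwa [Metric.iUnion_ball_nat, Measure.restrict_univ] at hcover
  filter_upwards [hfin] with x hx
  refine ⟨?_, ?_⟩
  · exact hK.mul (hfm.comp_quasiMeasurePreserving
      (quasiMeasurePreserving_sub_left (volume : Measure (Rn n)) x))
  · exact hx

/-- The sharp exponential inequality on sets of finite measure. -/
theorem exists_expInt_le (hα : 0 < α) (hαn : α < n) (hε : 0 < ε) (hR : 0 < R)
    (hK : AEStronglyMeasurable K volume) (hg : MemLp g (ENNReal.ofReal (qExp n α)) (surf n))
    (hloc : LocalExpansion α ε R K g) (htail : TailCondition α R K) (hA : 0 < sphConst n α g) :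
    ∃ S : ℝ, 0 ≤ S ∧ ∀ f : Rn n → ℝ, InLp α f → normLp α f ≤ 1 →
      ∀ E : Set (Rn n), NullMeasurableSet E volume → volume E < ∞ →
      expInt α K (1 / sphConst n α g) E f ≤ ENNReal.ofReal S * (1 + volume E) := by
  obtain ⟨C, hC0, hC⟩ := criticalKernel_of_expansion hα hαn hε hR hK hg hloc htail
  obtain ⟨S, hS0, hS⟩ := hC.lintegral_exp_le (holderConjugate hα hαn) hA hC0
  refine ⟨S, hS0, fun f hf hf1 E hE hEt => ?_⟩
  have hfm := hf.aestronglyMeasurable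
  -- The abstract inequality wants measurable sets, so a null-measurable one is replaced by an
  -- equivalent measurable set.
  obtain ⟨E', -, hE'm, hE'⟩ := hE.exists_measurable_superset_ae_eq
  unfold expInt
  rw [setLIntegral_congr hE'.symm, ← measure_congr hE']
  refine hS _ (measurable_mk_abs hfm) (lintegral_mk_rpow_le_one hα hαn hfm hf1) E' hE'm
    (by rw [measure_congr hE']; exact hEt.ne) (fun x => |pot K f x|) (fun x => abs_nonneg _) ?_
  intro x
  rw [← lintegral_convolution_eq hK hfm, ← Real.enorm_eq_ofReal_abs]
  exact enorm_pot_le K f x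

/-- The regularized exponential integral is controlled by the size of the potential where it is
small. -/
theorem exists_regExpInt_le (hα : 0 < α) (hαn : α < n) (hε : 0 < ε) (hR : 0 < R)
    (hK : AEStronglyMeasurable K volume) (hg : MemLp g (ENNReal.ofReal (qExp n α)) (surf n))
    (hloc : LocalExpansion α ε R K g) (htail : TailCondition α R K) (hA : 0 < sphConst n α g) :
    ∃ S : ℝ, 0 < S ∧ ∀ f : Rn n → ℝ, InLp α f → normLp α f ≤ 1 →
      regExpInt α K (1 / sphConst n α g) f ≤ ENNReal.ofReal S * (1 +
        ∫⁻ x, ENNReal.ofReal (min |pot K f x| 1 ^ (qExp n α * (regOrder n α + 1 : ℕ)))) := by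
  have hq := qExp_pos hα hαn
  obtain ⟨S, hS0, hS⟩ := exists_expInt_le hα hαn hε hR hK hg hloc htail hA
  set N := regOrder n α
  set c := 1 / sphConst n α g with hc
  have hc0 : 0 < c := by positivity
  set D := c ^ (N + 1) * Real.exp c with hD
  have hD0 : 0 < D := by positivity
  refine ⟨S + D, by positivity, fun f hf hf1 => ?_⟩
  have hfm := hf.aestronglyMeasurable
  have hum : AEMeasurable (fun x => |pot K f x|) volume :=
    (aestronglyMeasurable_pot hK hfm).aemeasurable.abs
  set W := ∫⁻ x, ENNReal.ofReal (min |pot K f x| 1 ^ (qExp n α * (N + 1 : ℕ))) with hW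
  rcases eq_or_ne W ∞ with hWt | hWt
  · rw [hWt, add_top, ENNReal.mul_top (by simpa using by positivity)]
    exact le_top
  -- On E, whose measure is at most W, the unregularized inequality applies. Off E the regularized
  -- exponential is at most D |K*f|^(q(N+1)).
  set E := {x | 1 ≤ |pot K f x|} with hE
  have hEm : NullMeasurableSet E volume := nullMeasurableSet_le aemeasurable_const hum
  have hEW : volume E ≤ W := by
    rw [hW, ← lintegral_indicator_one₀ hEm]
    refine lintegral_mono fun x => ?_
    by_cases hx : x ∈ E
    · rw [Set.indicator_of_mem hx, min_eq_right (show 1 ≤ |pot K f x| from hx), Real.one_rpow]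
      simp
    · rw [Set.indicator_of_notMem hx]; exact zero_le
  have hEt : volume E < ∞ := hEW.trans_lt hWt.lt_top
  have hsplit : regExpInt α K c f ≤
      ∫⁻ x in E, ENNReal.ofReal (expReg N (c * |pot K f x| ^ qExp n α)) ∂volume +
      ∫⁻ x in Eᶜ, ENNReal.ofReal (expReg N (c * |pot K f x| ^ qExp n α)) ∂volume := by
    unfold regExpInt
    rw [← setLIntegral_univ, ← Set.union_compl_self E]
    exact lintegral_union_le _ _ _
  have h1 : ∫⁻ x in E, ENNReal.ofReal (expReg N (c * |pot K f x| ^ qExp n α)) ≤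
      ENNReal.ofReal S * (1 + W) := by
    calc _ ≤ expInt α K c E f := by
          refine lintegral_mono fun x => ENNReal.ofReal_le_ofReal (expReg_le_exp N (by positivity))
      _ ≤ ENNReal.ofReal S * (1 + volume E) := hS f hf hf1 E hEm hEt
      _ ≤ _ := by gcongr
  have h2 : ∫⁻ x in Eᶜ, ENNReal.ofReal (expReg N (c * |pot K f x| ^ qExp n α)) ≤
      ENNReal.ofReal D * W := by
    rw [hW, ← lintegral_const_mul' _ _ ENNReal.ofReal_ne_top]
    refine le_trans (lintegral_mono_ae ?_) (setLIntegral_le_lintegral Eᶜ _)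
    refine (ae_restrict_mem₀ hEm.compl).mono fun x hx => ?_
    have hx1 : |pot K f x| ≤ 1 := (not_le.1 (show ¬ 1 ≤ |pot K f x| from hx)).le
    rw [min_eq_left hx1, ← ENNReal.ofReal_mul hD0.le]
    apply ENNReal.ofReal_le_ofReal
    have hu0 := abs_nonneg (pot K f x)
    have huq : |pot K f x| ^ qExp n α ≤ 1 := Real.rpow_le_one hu0 hx1 hq.le
    calc _ ≤ (c * |pot K f x| ^ qExp n α) ^ (N + 1) * Real.exp (c * |pot K f x| ^ qExp n α) :=
          expReg_le_pow_mul_exp N (by positivity)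
      _ ≤ (c * |pot K f x| ^ qExp n α) ^ (N + 1) * Real.exp c := by
          gcongr
          exact mul_le_of_le_one_right hc0.le huq
      _ = _ := by
          rw [mul_pow, Real.rpow_mul hu0, Real.rpow_natCast, hD]
          ring
  refine hsplit.trans ((add_le_add h1 h2).trans ?_)
  rw [ENNReal.ofReal_add hS0 hD0.le, add_mul]
  gcongr
  exact le_add_left le_rfl

/-- The truncated integral may be much smaller than the L^p norm: it also tolerates a component in
L^q, as `exists_regExpInt_le_const` exploits. -/
theorem lintegral_min_pot_le (hα : 0 < α) (hαn : α < n) (K f : Rn n → ℝ) :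
    ∫⁻ x, ENNReal.ofReal (min |pot K f x| 1 ^ (qExp n α * (regOrder n α + 1 : ℕ))) ≤
      normLp α (pot K f) ^ pExp n α := by
  have hp := (holderConjugate hα hαn).pos
  have hq := qExp_pos hα hαn
  rw [normLp_rpow hα hαn]
  refine lintegral_mono fun x => ?_
  have h0 : 0 ≤ min |pot K f x| 1 := le_min (abs_nonneg _) zero_le_one
  rw [ENNReal.ofReal_rpow_of_nonneg (abs_nonneg _) hp.le]
  apply ENNReal.ofReal_le_ofReal
  calc _ ≤ min |pot K f x| 1 ^ pExp n α :=
        Real.rpow_le_rpow_of_exponent_ge_of_imp h0 (min_le_right _ _) (regOrder_bound hα hαn)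
          (fun _ h => absurd h (by positivity))
    _ ≤ _ := by gcongr; exact min_le_left _ _

end Potential

/-! ### Homogeneous kernels with a smooth angular part -/

/-- The kernel `G(x/|x|) |x|^{α-n}`. -/
def homKernel {n : ℕ} (α : ℝ) (G : Rn n → ℝ) (z : Rn n) : ℝ := G (‖z‖⁻¹ • z) * ‖z‖ ^ (α - n)

/-- The density that is extremal for the pairing with `homKernel α G` on an annulus. -/
def annularDensity {n : ℕ} (α : ℝ) (G : Rn n → ℝ) (δ r : ℝ) : Rn n → ℝ :=
  (norm ⁻¹' Set.Ioo δ r).indicator fun z =>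
    G (‖z‖⁻¹ • z) * |G (‖z‖⁻¹ • z)| ^ (qExp n α - 2) * ‖z‖ ^ (-α)

/-- By homogeneity y may be scaled to 1; the mean value theorem on [1/2, ∞) then applies. -/
theorem abs_rpow_neg_sub_le {s : ℝ} (hs : 0 < s) {x y : ℝ} (hy : 0 < y) (hxy : y / 2 ≤ x) :
    |x ^ (-s) - y ^ (-s)| ≤ s * 2 ^ (s + 1) * (|x - y| * y ^ (-s - 1)) := by
  have hder : ∀ t ∈ Set.Ici (1 / 2 : ℝ),
      HasDerivWithinAt (fun t : ℝ => t ^ (-s)) (-s * t ^ (-s - 1)) (Set.Ici (1 / 2)) t := by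
    intro t ht
    have ht0 : 0 < t := lt_of_lt_of_le (by norm_num) (Set.mem_Ici.1 ht)
    exact (Real.hasDerivAt_rpow_const (Or.inl ht0.ne')).hasDerivWithinAt
  have hbd : ∀ t ∈ Set.Ici (1 / 2 : ℝ), ‖-s * t ^ (-s - 1)‖ ≤ s * 2 ^ (s + 1) := by
    intro t ht
    have ht' := Set.mem_Ici.1 ht
    have ht0 : 0 < t := lt_of_lt_of_le (by norm_num) ht'
    rw [norm_mul, norm_neg, Real.norm_of_nonneg hs.le, Real.norm_of_nonneg (by positivity)]
    gcongr
    rw [show -s - 1 = -(s + 1) by ring, Real.rpow_neg ht0.le, ← Real.inv_rpow ht0.le]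
    apply Real.rpow_le_rpow (by positivity) _ (by linarith)
    rw [inv_le_comm₀ ht0 two_pos]
    linarith
  have hx0 : 0 < x := by linarith
  have hmem : x / y ∈ Set.Ici (1 / 2 : ℝ) := by
    rw [Set.mem_Ici, le_div_iff₀ hy]; linarith
  have h := Convex.norm_image_sub_le_of_norm_hasDerivWithin_le hder hbd (convex_Ici _)
    (show (1 : ℝ) ∈ Set.Ici (1 / 2 : ℝ) by norm_num) hmem
  rw [Real.norm_eq_abs, Real.norm_eq_abs, Real.one_rpow, Real.div_rpow hx0.le hy.le] at h
  have hys : 0 < y ^ (-s) := Real.rpow_pos_of_pos hy _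
  have e1 : |x ^ (-s) / y ^ (-s) - 1| * y ^ (-s) = |x ^ (-s) - y ^ (-s)| := by
    rw [← abs_of_pos hys, ← abs_mul, abs_of_pos hys, sub_mul, div_mul_cancel₀ _ hys.ne', one_mul]
  have e2 : |x / y - 1| * y ^ (-s) = |x - y| * y ^ (-s - 1) := by
    rw [Real.rpow_sub_one hy.ne', mul_div_assoc', mul_div_right_comm]
    congr 1
    rw [eq_div_iff hy.ne', ← abs_of_pos hy, ← abs_mul, abs_of_pos hy, sub_mul,
      div_mul_cancel₀ _ hy.ne', one_mul]
  calc |x ^ (-s) - y ^ (-s)| = |x ^ (-s) / y ^ (-s) - 1| * y ^ (-s) := e1.symm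
    _ ≤ s * 2 ^ (s + 1) * |x / y - 1| * y ^ (-s) := by gcongr
    _ = _ := by rw [mul_assoc, e2]

theorem norm_direction_sub_le {n : ℕ} {a b : Rn n} (ha : a ≠ 0) (hb : b ≠ 0) :
    ‖‖a‖⁻¹ • a - ‖b‖⁻¹ • b‖ ≤ 2 * (‖a - b‖ * ‖b‖⁻¹) := by
  have ha' : 0 < ‖a‖ := norm_pos_iff.2 ha
  have hb' : 0 < ‖b‖ := norm_pos_iff.2 hb
  have e : ‖a‖⁻¹ • a - ‖b‖⁻¹ • b = ‖b‖⁻¹ • (a - b) + (‖a‖⁻¹ - ‖b‖⁻¹) • a := by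
    rw [smul_sub, sub_smul]; abel
  rw [e]
  refine (norm_add_le _ _).trans ?_
  rw [norm_smul, norm_smul, norm_inv, norm_norm, Real.norm_eq_abs]
  have h1 : |‖a‖⁻¹ - ‖b‖⁻¹| * ‖a‖ = |‖b‖ - ‖a‖| * ‖b‖⁻¹ := by
    rw [inv_sub_inv ha'.ne' hb'.ne', abs_div, abs_of_pos (mul_pos ha' hb')]
    field_simp
  rw [h1]
  have h2 : |‖b‖ - ‖a‖| ≤ ‖a - b‖ := by
    rw [abs_sub_comm]; exact abs_norm_sub_norm_le a b
  have h3 : |‖b‖ - ‖a‖| * ‖b‖⁻¹ ≤ ‖a - b‖ * ‖b‖⁻¹ := by gcongr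
  linarith

section Extremal

variable {n : ℕ} {α ε R M : ℝ} {K : Rn n → ℝ} {g : Sn n → ℝ} {G : Rn n → ℝ}

theorem norm_direction {z : Rn n} (hz : z ≠ 0) : ‖‖z‖⁻¹ • z‖ = 1 := by
  rw [norm_smul, norm_inv, norm_norm, inv_mul_cancel₀ (norm_ne_zero_iff.2 hz)]

/-- Beyond continuity, smoothness of the angular part matters only through these bounds, which hold
by compactness. -/
theorem exists_angular_bounds (hG : ContDiff ℝ (⊤ : ℕ∞) G) :
    ∃ Γ : ℝ, 0 < Γ ∧ (∀ z : Rn n, ‖z‖ = 1 → |G z| ≤ Γ) ∧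
      ∀ a b : Rn n, ‖a‖ = 1 → ‖b‖ = 1 → |G a - G b| ≤ Γ * ‖a - b‖ := by
  have hc : IsCompact (Metric.closedBall (0 : Rn n) 1) := isCompact_closedBall _ _
  obtain ⟨C, hC⟩ := hc.exists_bound_of_continuousOn hG.continuous.continuousOn
  have hL := (hG.of_le (m := 1) (by exact_mod_cast le_top)).locallyLipschitz
  obtain ⟨L, hL⟩ := (hL.locallyLipschitzOn (s := Metric.closedBall (0 : Rn n) 1)).exists_lipschitzOnWith_of_compact hc
  refine ⟨max 1 (max C L), by positivity, fun z hz => ?_, fun a b ha hb => ?_⟩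
  · exact (hC z (by simp [hz])).trans ((le_max_left _ _).trans (le_max_right _ _))
  · have := hL.dist_le_mul a (by simp [ha]) b (by simp [hb])
    rw [Real.dist_eq, dist_eq_norm] at this
    refine this.trans ?_
    gcongr
    exact (le_max_right _ _).trans (le_max_right _ _)

/-- A gradient of degree α - n - 1, obtained from the variation of the direction and of the radius
separately; |a - b| ≤ |b|/2 keeps the two norms comparable. -/
theorem homKernel_sub_le (hαn : α < n) {Γ : ℝ} (hΓ : 0 < Γ)
    (hΓ1 : ∀ z : Rn n, ‖z‖ = 1 → |G z| ≤ Γ)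
    (hΓ2 : ∀ a b : Rn n, ‖a‖ = 1 → ‖b‖ = 1 → |G a - G b| ≤ Γ * ‖a - b‖) :
    ∃ C : ℝ, 0 ≤ C ∧ ∀ a b : Rn n, b ≠ 0 → ‖a - b‖ ≤ ‖b‖ / 2 →
      |homKernel α G a - homKernel α G b| ≤ C * (‖a - b‖ * ‖b‖ ^ (α - n - 1)) := by
  set s : ℝ := n - α with hs
  have hs0 : 0 < s := by linarith
  refine ⟨Γ * 2 * 2 ^ s + Γ * (s * 2 ^ (s + 1)), by positivity, fun a b hb hab => ?_⟩
  have hb' : 0 < ‖b‖ := norm_pos_iff.2 hb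
  have hba : ‖b‖ / 2 ≤ ‖a‖ := by
    have := norm_sub_norm_le b a
    rw [norm_sub_rev] at this
    linarith
  have ha' : 0 < ‖a‖ := by linarith
  have ha : a ≠ 0 := norm_pos_iff.1 ha'
  unfold homKernel
  rw [show α - n = -s by rw [hs]; ring]
  set a' := ‖a‖⁻¹ • a with ha'def
  set b' := ‖b‖⁻¹ • b with hb'def
  have e : G a' * ‖a‖ ^ (-s) - G b' * ‖b‖ ^ (-s) =
      (G a' - G b') * ‖a‖ ^ (-s) + G b' * (‖a‖ ^ (-s) - ‖b‖ ^ (-s)) := by ring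
  rw [e]
  refine (abs_add_le _ _).trans ?_
  rw [abs_mul, abs_mul, add_mul]
  have h1 : ‖a‖ ^ (-s) ≤ 2 ^ s * ‖b‖ ^ (-s) := by
    rw [Real.rpow_neg ha'.le, Real.rpow_neg hb'.le, ← div_eq_mul_inv, ← Real.div_rpow two_pos.le hb'.le,
      ← Real.inv_rpow ha'.le]
    apply Real.rpow_le_rpow (by positivity) _ hs0.le
    rw [inv_le_comm₀ ha' (by positivity), inv_div]
    exact hba
  have h2 : |G a' - G b'| ≤ Γ * (2 * (‖a - b‖ * ‖b‖⁻¹)) :=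
    (hΓ2 _ _ (norm_direction ha) (norm_direction hb)).trans (by
      gcongr; exact norm_direction_sub_le ha hb)
  have h3 := abs_rpow_neg_sub_le hs0 hb' hba
  have h4 : |‖a‖ - ‖b‖| ≤ ‖a - b‖ := abs_norm_sub_norm_le a b
  refine add_le_add ?_ ?_
  · rw [abs_of_nonneg (a := ‖a‖ ^ (-s)) (by positivity)]
    calc _ ≤ Γ * (2 * (‖a - b‖ * ‖b‖⁻¹)) * (2 ^ s * ‖b‖ ^ (-s)) := by gcongr
      _ = _ := by
        rw [Real.rpow_sub_one hb'.ne']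
        ring
  · calc _ ≤ Γ * (s * 2 ^ (s + 1) * (‖a - b‖ * ‖b‖ ^ (-s - 1))) := by
          refine mul_le_mul (hΓ1 _ (norm_direction hb)) (h3.trans ?_) (abs_nonneg _) hΓ.le
          gcongr
      _ = _ := by ring

theorem direction_smul (ω : Sn n) {r : ℝ} (hr : 0 < r) :
    ‖r • (ω : Rn n)‖ = r ∧ ‖r • (ω : Rn n)‖⁻¹ • (r • (ω : Rn n)) = ω := by
  have h1 : ‖r • (ω : Rn n)‖ = r := by
    rw [norm_smul, norm_eq_of_mem_sphere ω, mul_one, Real.norm_of_nonneg hr.le]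
  refine ⟨h1, ?_⟩
  rw [h1, smul_smul, inv_mul_cancel₀ hr.ne', one_smul]

theorem measurable_annularDensity (hG : Continuous G) (δ r : ℝ) :
    Measurable (annularDensity α G δ r) := by
  have hGm := hG.measurable
  refine Measurable.indicator ?_ (measurable_norm measurableSet_Ioo)
  fun_prop

theorem measurable_homKernel (hG : Continuous G) : Measurable (homKernel α G) := by
  have hGm := hG.measurable
  unfold homKernel
  fun_prop

theorem abs_mul_abs_rpow_sub_two {q x : ℝ} (hq : 1 < q) :
    |x * |x| ^ (q - 2)| = |x| ^ (q - 1) := by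
  rcases eq_or_ne x 0 with rfl | hx
  · have : q - 1 ≠ 0 := by linarith
    simp [Real.zero_rpow this]
  · have hx' : 0 < |x| := abs_pos.2 hx
    rw [abs_mul, abs_of_nonneg (a := |x| ^ (q - 2)) (by positivity), mul_comm,
      ← Real.rpow_add_one hx'.ne']
    congr 1
    ring

theorem mul_self_mul_abs_rpow_sub_two {q x : ℝ} (hq : 1 < q) :
    x * (x * |x| ^ (q - 2)) = |x| ^ q := by
  rcases eq_or_ne x 0 with rfl | hx
  · have : q ≠ 0 := by linarith
    simp [Real.zero_rpow this]
  · have hx' : 0 < |x| := abs_pos.2 hx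
    rw [← mul_assoc, ← abs_mul_abs_self x, mul_assoc, ← mul_assoc, mul_comm, ← pow_two,
      ← Real.rpow_natCast, ← Real.rpow_add hx']
    congr 1
    push_cast
    ring

/-- The mass common to the pairing and to the `p`-th power of the norm. -/
theorem lintegral_annulus (hα : 0 < α) (hαn : α < n) (hG : Continuous G)
    (hGg : ∀ ω : Sn n, G ω = g ω) (hg : MemLp g (ENNReal.ofReal (qExp n α)) (surf n))
    {δ r : ℝ} (hδ : 0 < δ) (hδr : δ ≤ r) :
    ∫⁻ z in norm ⁻¹' Set.Ioo δ r, ENNReal.ofReal (|G (‖z‖⁻¹ • z)| ^ qExp n α * ‖z‖ ^ (-(n : ℝ))) =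
      ENNReal.ofReal (sphConst n α g * (n * Real.log (r / δ))) := by
  have hn := natCast_pos_of_lt hα hαn
  have hlog : 0 ≤ Real.log (r / δ) := Real.log_nonneg ((one_le_div hδ).2 hδr)
  have hA0 : 0 ≤ sphConst n α g := sphConst_nonneg
  have hGm := hG.measurable
  rw [setLIntegral_polar hn (Measurable.aemeasurable (by fun_prop)) measurableSet_Ioo
    (fun t ht => hδ.trans ht.1)]
  calc _ = ∫⁻ ω : Sn n, ENNReal.ofReal (|g ω| ^ qExp n α) * ENNReal.ofReal (Real.log (r / δ))
        ∂(surf n) := by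
        refine lintegral_congr fun ω => ?_
        rw [← lintegral_Ioo_inv hδ hδr, ← lintegral_const_mul' _ _ ENNReal.ofReal_ne_top]
        refine setLIntegral_congr_fun measurableSet_Ioo fun t ht => ?_
        have ht0 : 0 < t := hδ.trans ht.1
        rw [(direction_smul ω ht0).2, (direction_smul ω ht0).1, hGg,
          ENNReal.ofReal_mul (by positivity), mul_left_comm, ofReal_pow_mul_ofReal_rpow hn ht0,
          show ((n : ℝ) - 1 + -n) = -1 by ring, Real.rpow_neg_one]
    _ = _ := by
        rw [lintegral_mul_const' _ _ ENNReal.ofReal_ne_top, lintegral_rpow_sphere hα hαn hg,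
          ← ENNReal.ofReal_mul (by positivity)]
        congr 1
        ring

/-- Equality case of Hölder's inequality: as (q-1) p = q and α p = n, the p-th power of the density
is the integrand of its pairing with the kernel. -/
theorem lintegral_annularDensity_rpow (hα : 0 < α) (hαn : α < n) (hG : Continuous G)
    (hGg : ∀ ω : Sn n, G ω = g ω) (hg : MemLp g (ENNReal.ofReal (qExp n α)) (surf n))
    {δ r : ℝ} (hδ : 0 < δ) (hδr : δ ≤ r) :
    ∫⁻ z, ENNReal.ofReal |annularDensity α G δ r z| ^ pExp n α =
      ENNReal.ofReal (sphConst n α g * (n * Real.log (r / δ))) := by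
  have hc := holderConjugate hα hαn
  have hm : MeasurableSet (norm ⁻¹' Set.Ioo δ r : Set (Rn n)) := measurable_norm measurableSet_Ioo
  rw [← lintegral_annulus hα hαn hG hGg hg hδ hδr, ← lintegral_indicator hm]
  congr 1
  ext z
  unfold annularDensity
  by_cases hz : z ∈ (norm ⁻¹' Set.Ioo δ r : Set (Rn n))
  · have hz0 : 0 < ‖z‖ := hδ.trans hz.1
    rw [Set.indicator_of_mem hz, Set.indicator_of_mem hz,
      ENNReal.ofReal_rpow_of_nonneg (abs_nonneg _) hc.pos.le, abs_mul,
      abs_mul_abs_rpow_sub_two hc.symm.lt, abs_of_nonneg (a := ‖z‖ ^ (-α)) (by positivity),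
      Real.mul_rpow (by positivity) (by positivity), ← Real.rpow_mul (by positivity),
      ← Real.rpow_mul hz0.le, hc.symm.sub_one_mul_conj]
    congr 3
    unfold pExp
    field_simp
  · rw [Set.indicator_of_notMem hz, Set.indicator_of_notMem hz, abs_zero, ENNReal.ofReal_zero,
      ENNReal.zero_rpow_of_pos hc.pos]

theorem homKernel_mul_annularDensity (hα : 0 < α) (hαn : α < n) {δ r : ℝ} (hδ : 0 < δ) (z : Rn n) :
    homKernel α G z * annularDensity α G δ r z = (norm ⁻¹' Set.Ioo δ r).indicator
      (fun z => |G (‖z‖⁻¹ • z)| ^ qExp n α * ‖z‖ ^ (-(n : ℝ))) z := by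
  have hc := holderConjugate hα hαn
  unfold annularDensity homKernel
  by_cases hz : z ∈ (norm ⁻¹' Set.Ioo δ r : Set (Rn n))
  · have hz0 : 0 < ‖z‖ := hδ.trans hz.1
    rw [Set.indicator_of_mem hz, Set.indicator_of_mem hz,
      ← mul_self_mul_abs_rpow_sub_two hc.symm.lt, show -(n : ℝ) = (α - n) + -α by ring,
      Real.rpow_add hz0]
    ring
  · rw [Set.indicator_of_notMem hz, Set.indicator_of_notMem hz, mul_zero]

theorem integral_homKernel_mul_annularDensity (hα : 0 < α) (hαn : α < n) (hG : Continuous G)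
    (hGg : ∀ ω : Sn n, G ω = g ω) (hg : MemLp g (ENNReal.ofReal (qExp n α)) (surf n))
    {δ r : ℝ} (hδ : 0 < δ) (hδr : δ ≤ r) :
    Integrable (fun z => homKernel α G z * annularDensity α G δ r z) volume ∧
    ∫ z, homKernel α G z * annularDensity α G δ r z =
      sphConst n α g * (n * Real.log (r / δ)) := by
  have hm : MeasurableSet (norm ⁻¹' Set.Ioo δ r : Set (Rn n)) := measurable_norm measurableSet_Ioo
  have hlog : 0 ≤ Real.log (r / δ) := Real.log_nonneg ((one_le_div hδ).2 hδr)
  have hA0 : 0 ≤ sphConst n α g := sphConst_nonneg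
  have hGm := hG.measurable
  simp_rw [homKernel_mul_annularDensity hα hαn hδ]
  have hmeas : Measurable fun z : Rn n => |G (‖z‖⁻¹ • z)| ^ qExp n α * ‖z‖ ^ (-(n : ℝ)) := by
    fun_prop
  have hl := lintegral_annulus hα hαn hG hGg hg hδ hδr
  rw [integral_indicator hm, integrable_indicator_iff hm]
  have hnn : 0 ≤ᵐ[volume.restrict (norm ⁻¹' Set.Ioo δ r)] fun z : Rn n =>
    |G (‖z‖⁻¹ • z)| ^ qExp n α * ‖z‖ ^ (-(n : ℝ)) := Filter.Eventually.of_forall fun z => by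
      positivity
  constructor
  · refine ⟨hmeas.aestronglyMeasurable, ?_⟩
    rw [hasFiniteIntegral_iff_ofReal hnn, hl]
    exact ENNReal.ofReal_lt_top
  · rw [integral_eq_lintegral_of_nonneg_ae hnn hmeas.aestronglyMeasurable, hl,
      ENNReal.toReal_ofReal (by positivity)]

/-- The density is integrable uniformly in the inner radius. -/
theorem lintegral_abs_annularDensity_le (hα : 0 < α) (hαn : α < n) {Γ : ℝ}
    (hΓ1 : ∀ z : Rn n, ‖z‖ = 1 → |G z| ≤ Γ) (r : ℝ) (hr : 0 < r) :
    ∃ C : ℝ, 0 ≤ C ∧ ∀ δ, 0 < δ →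
      ∫⁻ z, ENNReal.ofReal |annularDensity α G δ r z| ≤ .ofReal C := by
  have hn := natCast_pos_of_lt hα hαn
  have hc := holderConjugate hα hαn
  have hΓ0 : 0 ≤ Γ := by
    have : Nontrivial (Rn n) := by
      have : Nonempty (Fin n) := ⟨⟨0, hn⟩⟩
      infer_instance
    obtain ⟨z, hz⟩ := exists_norm_eq (Rn n) zero_le_one
    exact (abs_nonneg _).trans (hΓ1 z hz)
  set c := Γ ^ (qExp n α - 1) with hcdef
  set v := c * (r ^ ((n : ℝ) - α) / ((n : ℝ) - α)) with hv
  have hna : 0 < (n : ℝ) - α := by linarith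
  have hst : (surf n) Set.univ ≠ ∞ := measure_ne_top _ _
  refine ⟨v * ((surf n) Set.univ).toReal, by positivity, fun δ hδ => ?_⟩
  have hm : MeasurableSet (norm ⁻¹' Set.Ioo 0 r : Set (Rn n)) := measurable_norm measurableSet_Ioo
  -- The density is at most Γ^(q-1) |z|^(-α), which is integrable at the origin because α < n.
  calc _ ≤ ∫⁻ z in norm ⁻¹' Set.Ioo 0 r, ENNReal.ofReal (c * ‖z‖ ^ (-α)) := by
        rw [← lintegral_indicator hm]
        refine lintegral_mono fun z => ?_
        unfold annularDensity
        by_cases hz : z ∈ (norm ⁻¹' Set.Ioo δ r : Set (Rn n))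
        · have hz0 : 0 < ‖z‖ := hδ.trans hz.1
          rw [Set.indicator_of_mem hz, Set.indicator_of_mem
            (show z ∈ (norm ⁻¹' Set.Ioo 0 r : Set (Rn n)) from ⟨hz0, hz.2⟩), abs_mul,
            abs_mul_abs_rpow_sub_two hc.symm.lt, abs_of_nonneg (a := ‖z‖ ^ (-α)) (by positivity)]
          apply ENNReal.ofReal_le_ofReal
          gcongr
          exact Real.rpow_le_rpow (abs_nonneg _) (hΓ1 _ (norm_direction (norm_pos_iff.1 hz0)))
            (by linarith [hc.symm.lt])
        · rw [Set.indicator_of_notMem hz, abs_zero, ENNReal.ofReal_zero]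
          exact zero_le
    _ = ∫⁻ _ω : Sn n, ENNReal.ofReal v ∂(surf n) := by
        rw [setLIntegral_polar hn (Measurable.aemeasurable (by fun_prop)) measurableSet_Ioo
          (fun t ht => ht.1)]
        refine lintegral_congr fun ω => ?_
        rw [hv, ENNReal.ofReal_mul (by positivity), show (n : ℝ) - α = ((n : ℝ) - 1 + -α) + 1 by ring,
          ← lintegral_Ioo_rpow hr.le (by linarith), ← lintegral_const_mul' _ _ ENNReal.ofReal_ne_top]
        refine setLIntegral_congr_fun measurableSet_Ioo fun t ht => ?_
        rw [(direction_smul ω ht.1).1, ENNReal.ofReal_mul (by positivity), mul_left_comm,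
          ofReal_pow_mul_ofReal_rpow hn ht.1]
    _ = _ := by
        rw [lintegral_const, ENNReal.ofReal_mul (p := v) (by positivity), ENNReal.ofReal_toReal hst]

theorem rpow_le_of_comparable {x y e : ℝ} (hy : 0 < y) (h1 : y / 2 ≤ x) (h2 : x ≤ 2 * y) :
    x ^ e ≤ 2 ^ |e| * y ^ e := by
  have hx : 0 < x := by linarith
  rcases le_total 0 e with he | he
  · rw [abs_of_nonneg he, ← Real.mul_rpow two_pos.le hy.le]
    exact Real.rpow_le_rpow hx.le h2 he
  · rw [abs_of_nonpos he]
    calc x ^ e ≤ (y / 2) ^ e := Real.rpow_le_rpow_of_nonpos (by positivity) h1 he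
      _ = _ := by
        rw [Real.div_rpow hy.le two_pos.le, Real.rpow_neg two_pos.le]
        field_simp

theorem abs_kernel_sub_homKernel_le
    (hGg : ∀ ω : Sn n, G ω = g ω) (hM : ∀ (ω : Sn n) (r : ℝ), 0 < r → r ≤ R →
      |K (r • (ω : Rn n)) - g ω * r ^ (α - n)| ≤ M * r ^ (α - n + ε)) {z : Rn n} (hz : z ≠ 0)
    (hzR : ‖z‖ ≤ R) : |K z - homKernel α G z| ≤ M * ‖z‖ ^ (α - n + ε) := by
  have hz' : 0 < ‖z‖ := norm_pos_iff.2 hz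
  have h := hM ⟨‖z‖⁻¹ • z, by simp [norm_smul, hz'.ne']⟩ ‖z‖ hz' hzR
  rw [← hGg] at h
  simp only [smul_smul, mul_inv_cancel₀ hz'.ne', one_smul] at h
  exact h

theorem lintegral_Ioo_mul_rpow_neg_two_le {δ r : ℝ} (hδ : 0 < δ) :
    ∫⁻ t in Set.Ioo δ r, ENNReal.ofReal (δ * t ^ (-2 : ℝ)) ≤ 1 := by
  calc _ ≤ ∫⁻ t in Set.Ioi δ, ENNReal.ofReal (δ * t ^ (-2 : ℝ)) :=
        lintegral_mono_set Set.Ioo_subset_Ioi_self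
    _ = ENNReal.ofReal 1 := by
        rw [← ofReal_integral_eq_lintegral_ofReal
          ((integrableOn_Ioi_rpow_of_lt (by norm_num) hδ).const_mul δ), integral_const_mul,
          integral_Ioi_rpow_of_lt (by norm_num) hδ]
        · congr 1
          norm_num
          rw [Real.rpow_neg_one, mul_inv_cancel₀ hδ.ne']
        · refine (ae_restrict_mem measurableSet_Ioi).mono fun t ht => ?_
          have : 0 < t := hδ.trans ht
          simp only [Pi.zero_apply]
          positivity
    _ = 1 := by simp

/-- On the ball of half the inner radius, the potential of the reflected annular density equals the
mass of the density up to a bounded error. -/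
theorem exists_pot_annularDensity (hα : 0 < α) (hαn : α < n) (hε : 0 < ε) (hR : 0 < R)
    (hK : AEStronglyMeasurable K volume) (hg : MemLp g (ENNReal.ofReal (qExp n α)) (surf n))
    (hloc : LocalExpansion α ε R K g) (hG : ContDiff ℝ (⊤ : ℕ∞) G) (hGg : ∀ ω : Sn n, G ω = g ω) :
    ∃ C : ℝ, 0 ≤ C ∧ ∀ δ : ℝ, 0 < δ → δ ≤ R / 2 → ∀ x : Rn n, ‖x‖ ≤ δ / 2 →
      Integrable (fun t => K t * annularDensity α G δ (R / 2) (-(x - t))) volume ∧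
      |pot K (fun y => annularDensity α G δ (R / 2) (-y)) x -
        sphConst n α g * (n * Real.log (R / 2 / δ))| ≤ C := by
  have hn := natCast_pos_of_lt hα hαn
  have hc := holderConjugate hα hαn
  obtain ⟨Γ, hΓ, hΓ1, hΓ2⟩ := exists_angular_bounds hG
  obtain ⟨C₁, hC₁0, hC₁⟩ := homKernel_sub_le (α := α) hαn hΓ hΓ1 hΓ2
  obtain ⟨M', hM'⟩ := hloc
  set M := max M' 0 with hMdef
  have hM0 : 0 ≤ M := le_max_right _ _
  have hM : ∀ (ω : Sn n) (r : ℝ), 0 < r → r ≤ R →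
      |K (r • (ω : Rn n)) - g ω * r ^ (α - n)| ≤ M * r ^ (α - n + ε) := fun ω r h0 hr =>
    (hM' ω r h0 hr).trans (by gcongr; exact le_max_left _ _)
  set r := R / 2 with hr
  have hr0 : 0 < r := by positivity
  set c := Γ ^ (qExp n α - 1) with hcdef
  have hc0 : 0 < c := by positivity
  set M₂ := M * 2 ^ |α - n + ε| with hM₂
  have hM₂0 : 0 ≤ M₂ := by positivity
  set v := c * M₂ * (r ^ ε / ε) + c * C₁ with hv
  have hv0 : 0 ≤ v := by positivity
  have hst : (surf n) Set.univ ≠ ∞ := measure_ne_top _ _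
  refine ⟨v * ((surf n) Set.univ).toReal, by positivity, fun δ hδ hδr x hx => ?_⟩
  set ψ := annularDensity α G δ r with hψ
  have hψm : Measurable ψ := measurable_annularDensity hG.continuous δ r
  obtain ⟨hint0, hval0⟩ := integral_homKernel_mul_annularDensity (g := g) (G := G) hα hαn
    hG.continuous hGg hg hδ hδr
  -- Reflection of the density turns K(x - y) into K(x + z). The error has two sources: the
  -- expansion at x + z, giving |z|^(ε-n), and the translation by |x| ≤ δ/2, giving δ |z|^(-n-1).
  -- Both integrate over the annulus to constants independent of δ. The outer radius R/2 keeps x + z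
  -- inside the range of the expansion.
  set D : Rn n → ℝ := fun z => (K (x + z) - homKernel α G z) * ψ z with hD
  have hDm : AEStronglyMeasurable D volume := by
    refine AEStronglyMeasurable.mul (AEStronglyMeasurable.sub ?_
      (measurable_homKernel hG.continuous).aestronglyMeasurable) hψm.aestronglyMeasurable
    exact hK.comp_measurePreserving (measurePreserving_add_left volume x)
  have hms : MeasurableSet (norm ⁻¹' Set.Ioo δ r : Set (Rn n)) := measurable_norm measurableSet_Ioo
  have hDbd : ∫⁻ z, ‖D z‖ₑ ≤ ENNReal.ofReal (v * ((surf n) Set.univ).toReal) := by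
    calc ∫⁻ z, ‖D z‖ₑ ≤ ∫⁻ z in norm ⁻¹' Set.Ioo δ r, ENNReal.ofReal
          (c * M₂ * ‖z‖ ^ (ε - n) + c * C₁ * (δ * ‖z‖ ^ (-(n : ℝ) - 1))) := by
          rw [← lintegral_indicator hms]
          refine lintegral_mono fun z => ?_
          by_cases hz : z ∈ (norm ⁻¹' Set.Ioo δ r : Set (Rn n))
          · have hz1 : δ < ‖z‖ := hz.1
            have hz2 : ‖z‖ < r := hz.2
            have hz0 : 0 < ‖z‖ := hδ.trans hz1
            have hzne : z ≠ 0 := norm_pos_iff.1 hz0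
            rw [Set.indicator_of_mem hz, Real.enorm_eq_ofReal_abs]
            apply ENNReal.ofReal_le_ofReal
            have hup : ‖x + z‖ ≤ 3 / 2 * ‖z‖ := by
              have := norm_add_le x z; linarith
            have hlow : ‖z‖ / 2 ≤ ‖x + z‖ := by
              have h := norm_sub_norm_le z (-x)
              rw [norm_neg, sub_neg_eq_add, add_comm z x] at h
              linarith
            have hxz : x + z ≠ 0 := norm_pos_iff.1 (by linarith)
            have h1 : |K (x + z) - homKernel α G (x + z)| ≤ M₂ * ‖z‖ ^ (α - n + ε) := by
              refine (abs_kernel_sub_homKernel_le hGg hM hxz (by linarith)).trans ?_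
              rw [hM₂, mul_assoc]
              gcongr
              exact rpow_le_of_comparable hz0 hlow (by linarith)
            have h2 : |homKernel α G (x + z) - homKernel α G z| ≤
                C₁ * (δ * ‖z‖ ^ (α - n - 1)) := by
              have := hC₁ (x + z) z hzne (by rw [add_sub_cancel_right]; linarith)
              rw [add_sub_cancel_right] at this
              refine this.trans ?_
              gcongr
              linarith
            have h3 : |ψ z| ≤ c * ‖z‖ ^ (-α) := by
              rw [hψ, annularDensity, Set.indicator_of_mem hz, abs_mul,
                abs_mul_abs_rpow_sub_two hc.symm.lt, abs_of_nonneg (a := ‖z‖ ^ (-α)) (by positivity)]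
              gcongr
              exact Real.rpow_le_rpow (abs_nonneg _) (hΓ1 _ (norm_direction hzne))
                (by linarith [hc.symm.lt])
            have h4 : |K (x + z) - homKernel α G z| ≤
                M₂ * ‖z‖ ^ (α - n + ε) + C₁ * (δ * ‖z‖ ^ (α - n - 1)) := by
              have := abs_sub_le (K (x + z)) (homKernel α G (x + z)) (homKernel α G z)
              linarith
            rw [hD, abs_mul]
            calc _ ≤ (M₂ * ‖z‖ ^ (α - n + ε) + C₁ * (δ * ‖z‖ ^ (α - n - 1))) *
                  (c * ‖z‖ ^ (-α)) := by gcongr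
              _ = _ := by
                have e1 : ‖z‖ ^ (ε - (n : ℝ)) = ‖z‖ ^ (α - n + ε) * ‖z‖ ^ (-α) := by
                  rw [← Real.rpow_add hz0]; congr 1; ring
                have e2 : ‖z‖ ^ (-(n : ℝ) - 1) = ‖z‖ ^ (α - n - 1) * ‖z‖ ^ (-α) := by
                  rw [← Real.rpow_add hz0]; congr 1; ring
                rw [e1, e2]; ring
          · have : ψ z = 0 := Set.indicator_of_notMem hz _
            simp [hD, this]
      _ ≤ ∫⁻ _ω : Sn n, ENNReal.ofReal v ∂(surf n) := by
          rw [setLIntegral_polar hn (Measurable.aemeasurable (by fun_prop)) measurableSet_Ioo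
            (fun t ht => hδ.trans ht.1)]
          refine lintegral_mono fun ω => ?_
          calc _ = ∫⁻ t in Set.Ioo δ r, (ENNReal.ofReal (c * M₂) * ENNReal.ofReal (t ^ (ε - 1)) +
                ENNReal.ofReal (c * C₁) * ENNReal.ofReal (δ * t ^ (-2 : ℝ))) := by
                refine setLIntegral_congr_fun measurableSet_Ioo fun t ht => ?_
                have ht0 : 0 < t := hδ.trans ht.1
                have hpow : t ^ (n - 1) = t ^ ((n : ℝ) - 1) := by
                  rw [← Real.rpow_natCast, Nat.cast_sub hn, Nat.cast_one]
                rw [(direction_smul ω ht0).1, hpow, ← ENNReal.ofReal_mul (by positivity),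
                  ← ENNReal.ofReal_mul (by positivity), ← ENNReal.ofReal_mul (by positivity),
                  ← ENNReal.ofReal_add (by positivity) (by positivity)]
                congr 1
                rw [show ε - 1 = ((n : ℝ) - 1) + (ε - n) by ring,
                  show (-2 : ℝ) = ((n : ℝ) - 1) + (-(n : ℝ) - 1) by ring, Real.rpow_add ht0,
                  Real.rpow_add ht0]
                ring
            _ ≤ ENNReal.ofReal (c * M₂) * ENNReal.ofReal (r ^ ε / ε) + ENNReal.ofReal (c * C₁) * 1 := by
                rw [lintegral_add_left (by fun_prop), lintegral_const_mul' _ _ ENNReal.ofReal_ne_top,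
                  lintegral_const_mul' _ _ ENNReal.ofReal_ne_top]
                gcongr
                · have := lintegral_Ioo_rpow hr0.le (show -1 < ε - 1 by linarith)
                  rw [sub_add_cancel] at this
                  rw [← this]
                  exact lintegral_mono_set (Set.Ioo_subset_Ioo_left hδ.le)
                · exact lintegral_Ioo_mul_rpow_neg_two_le hδ
            _ = _ := by
                rw [mul_one, ← ENNReal.ofReal_mul (by positivity),
                  ← ENNReal.ofReal_add (by positivity) (by positivity)]
      _ = _ := by
          rw [lintegral_const, ENNReal.ofReal_mul (p := v) hv0, ENNReal.ofReal_toReal hst]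
  have hDint : Integrable D volume := ⟨hDm, hDbd.trans_lt ENNReal.ofReal_lt_top⟩
  have hsum : (fun z => K (x + z) * ψ z) = fun z => homKernel α G z * ψ z + D z := by
    ext z; simp only [hD]; ring
  have hint : Integrable (fun z => K (x + z) * ψ z) volume := by
    rw [hsum]; exact hint0.add hDint
  have htrans : (fun t => K t * ψ (-(x - t))) = fun t => (fun z => K (x + z) * ψ z) (t - x) := by
    ext t; simp
  refine ⟨?_, ?_⟩
  · rw [htrans]
    exact hint.comp_sub_right x
  · have hpot : pot K (fun y => ψ (-y)) x = ∫ z, K (x + z) * ψ z := by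
      rw [← integral_sub_right_eq_self (fun z => K (x + z) * ψ z) x]
      unfold pot convolution
      simp only [ContinuousLinearMap.mul_apply']
      rw [htrans]
    rw [hpot, hsum, integral_add hint0 hDint, hval0, add_sub_cancel_left]
    have h := (enorm_integral_le_lintegral_enorm D).trans hDbd
    rw [Real.enorm_eq_ofReal_abs] at h
    exact (ENNReal.ofReal_le_ofReal_iff (by positivity)).1 h

end Extremal

/-! ### Removing polynomial moments -/

section Moments

variable {n : ℕ}

theorem continuous_evalPolynomial (P : MvPolynomial (Fin n) ℝ) :
    Continuous fun y : Rn n => MvPolynomial.eval (fun i => y i) P := by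
  have h : Continuous fun y : Rn n => (fun i => y i : Fin n → ℝ) := by fun_prop
  exact (MvPolynomial.continuous_eval P).comp h

theorem exists_polynomial_bound (P : MvPolynomial (Fin n) ℝ) (ρ : ℝ) :
    ∃ D : ℝ, 0 ≤ D ∧ ∀ y : Rn n, ‖y‖ ≤ ρ → |MvPolynomial.eval (fun i => y i) P| ≤ D := by
  obtain ⟨D, hD⟩ := (isCompact_closedBall (0 : Rn n) ρ).exists_bound_of_continuousOn
    (continuous_evalPolynomial P).continuousOn
  exact ⟨max D 0, le_max_right _ _, fun y hy =>
    (hD y (by simpa using hy)).trans (le_max_left _ _)⟩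

theorem integrableOn_ball_polynomial (P : MvPolynomial (Fin n) ℝ) :
    IntegrableOn (fun y : Rn n => MvPolynomial.eval (fun i => y i) P) (Metric.ball 0 1) volume :=
  ((continuous_evalPolynomial P).continuousOn.integrableOn_compact
    (isCompact_closedBall 0 1)).mono_set Metric.ball_subset_closedBall

theorem integrable_polynomial_mul {φ : Rn n → ℝ} {ρ : ℝ} (hφ : Integrable φ volume)
    (hs : ∀ y, ρ < ‖y‖ → φ y = 0) (P : MvPolynomial (Fin n) ℝ) :
    Integrable (fun y => MvPolynomial.eval (fun i => y i) P * φ y) volume ∧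
      ∀ D : ℝ, (∀ y : Rn n, ‖y‖ ≤ ρ → |MvPolynomial.eval (fun i => y i) P| ≤ D) →
      |∫ y, MvPolynomial.eval (fun i => y i) P * φ y| ≤ D * ∫ y, |φ y| := by
  have hb : ∀ D : ℝ, (∀ y : Rn n, ‖y‖ ≤ ρ → |MvPolynomial.eval (fun i => y i) P| ≤ D) →
      ∀ y, |MvPolynomial.eval (fun i => y i) P * φ y| ≤ D * |φ y| := by
    intro D hD y
    rw [abs_mul]
    rcases le_or_gt ‖y‖ ρ with hy | hy
    · gcongr; exact hD y hy
    · simp [hs y hy]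
  have hi : Integrable (fun y => MvPolynomial.eval (fun i => y i) P * φ y) volume := by
    obtain ⟨D, -, hD⟩ := exists_polynomial_bound P ρ
    exact (hφ.abs.const_mul D).mono'
      ((continuous_evalPolynomial P).aestronglyMeasurable.mul hφ.1) (.of_forall (hb D hD))
  refine ⟨hi, fun D hD => ?_⟩
  rw [← integral_const_mul]
  exact (abs_integral_le_integral_abs).trans
    (integral_mono hi.abs (hφ.abs.const_mul D) (hb D hD))

/-- A continuous nonnegative function of zero integral vanishes on the ball. The ball contains a
small cube around the origin, and a polynomial vanishing on a product of infinite sets is zero. -/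
theorem eq_zero_of_integral_sq_eq_zero {P : MvPolynomial (Fin n) ℝ}
    (h : ∫ y : Rn n in Metric.ball 0 1, MvPolynomial.eval (fun i => y i) (P * P) = 0) : P = 0 := by
  have h0 : (fun y : Rn n => MvPolynomial.eval (fun i => y i) (P * P)) =ᵐ[volume.restrict
      (Metric.ball 0 1)] 0 := by
    rw [← setIntegral_eq_zero_iff_of_nonneg_ae _ (integrableOn_ball_polynomial _)]
    · exact h
    · exact .of_forall fun y => by simp [mul_self_nonneg]
  have h1 : Set.EqOn (fun y : Rn n => MvPolynomial.eval (fun i => y i) (P * P)) 0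
      (Metric.ball 0 1) :=
    Measure.eqOn_open_of_ae_eq h0 Metric.isOpen_ball
      (continuous_evalPolynomial _).continuousOn continuousOn_const
  have hs : ∃ s : Set ℝ, s.Infinite ∧ ∀ v : Fin n → ℝ, (∀ i, v i ∈ s) →
      ‖WithLp.toLp 2 v‖ < 1 := by
    have hc : ContinuousAt (fun v : Fin n → ℝ => ‖WithLp.toLp 2 v‖) 0 := by fun_prop
    have h0 : ‖WithLp.toLp 2 (0 : Fin n → ℝ)‖ < 1 := by simp
    have := hc.eventually_lt_const h0
    obtain ⟨e, he, hb⟩ := Metric.eventually_nhds_iff.1 this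
    refine ⟨Set.Ioo (-e) e, Set.Ioo_infinite (by linarith), fun v hv => hb ?_⟩
    rw [dist_zero_right, pi_norm_lt_iff he]
    exact fun i => abs_lt.2 (hv i)
  obtain ⟨s, hs, hsb⟩ := hs
  apply MvPolynomial.funext_set (fun _ => s) (fun _ => hs)
  intro v hv
  have := h1 (x := WithLp.toLp 2 v) (by simpa using hsb v (fun i => hv i trivial))
  simpa using this

/-- The moments of a compactly supported function can be removed by adding a function which is
supported in the unit ball and bounded by a multiple of the `L¹` norm. -/
theorem exists_moment_correction (n m : ℕ) (ρ : ℝ) : ∃ C : ℝ, 0 ≤ C ∧ ∀ φ : Rn n → ℝ,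
    Integrable φ volume → (∀ y, ρ < ‖y‖ → φ y = 0) → ∃ w : Rn n → ℝ, Measurable w ∧
      (∀ y, 1 ≤ ‖y‖ → w y = 0) ∧ (∀ y, |w y| ≤ C * ∫ y, |φ y|) ∧
      VanishingMoments m fun y => φ y + w y := by
  let V := MvPolynomial.restrictTotalDegree (Fin n) ℝ m
  have : FiniteDimensional ℝ V := inferInstance
  let I : MvPolynomial (Fin n) ℝ →ₗ[ℝ] ℝ :=
    { toFun := fun P => ∫ y : Rn n in Metric.ball 0 1, MvPolynomial.eval (fun i => y i) P
      map_add' := fun P Q => by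
        simp only [map_add]
        exact integral_add (integrableOn_ball_polynomial P) (integrableOn_ball_polynomial Q)
      map_smul' := fun c P => by
        simp only [MvPolynomial.smul_eval, RingHom.id_apply, smul_eq_mul]
        exact integral_const_mul _ _ }
  -- The L² pairing on the unit ball is positive definite on polynomials of degree at most m, so it
  -- has dual bases, and a polynomial cut off to the ball can realize any prescribed moments.
  -- Including degree m itself is harmless.
  let B : LinearMap.BilinForm ℝ V :=
    (((LinearMap.mul ℝ (MvPolynomial (Fin n) ℝ)).compr₂ I).domRestrict₁₂ V V)
  have hdef : ∀ P : V, B P P = 0 → P = 0 := fun P hP =>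
    Subtype.ext (eq_zero_of_integral_sq_eq_zero hP)
  have hB : B.Nondegenerate :=
    ⟨fun P hP => hdef P (hP P), fun P hP => hdef P (hP P)⟩
  let b := Module.finBasis ℝ V
  let Q := B.dualBasis hB b
  have hQ : ∀ i j, B (Q i) (b j) = if j = i then 1 else 0 := B.apply_dualBasis_left hB b
  choose D₁ hD₁ hD₁' using fun i => exists_polynomial_bound (b i : MvPolynomial (Fin n) ℝ) ρ
  choose D₂ hD₂ hD₂' using fun i => exists_polynomial_bound (Q i : MvPolynomial (Fin n) ℝ) 1
  refine ⟨∑ i, D₁ i * D₂ i, Finset.sum_nonneg fun i _ => mul_nonneg (hD₁ i) (hD₂ i),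
    fun φ hφ hs => ?_⟩
  have hmom := fun P => integrable_polynomial_mul hφ hs P
  -- The correction must have the opposite moments of φ; they are bounded by its L¹ norm, and so is
  -- the correction.
  set a := fun i => -∫ y, MvPolynomial.eval (fun k => y k) (b i : MvPolynomial (Fin n) ℝ) * φ y
    with ha
  let W : V := ∑ i, a i • Q i
  have hW : ∀ i, B W (b i) = a i := by
    intro i
    simp [W, hQ]
  let w : Rn n → ℝ := (Metric.ball 0 1).indicator fun y =>
    MvPolynomial.eval (fun k => y k) (W : MvPolynomial (Fin n) ℝ)
  have hwW : ∀ P : V, ∫ y, MvPolynomial.eval (fun k => y k) (P : MvPolynomial (Fin n) ℝ) * w y =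
      B W P := by
    intro P
    have : ∀ y, MvPolynomial.eval (fun k => y k) (P : MvPolynomial (Fin n) ℝ) * w y =
        (Metric.ball 0 1).indicator (fun y : Rn n =>
          MvPolynomial.eval (fun k => y k) (W * P : MvPolynomial (Fin n) ℝ)) y := by
      intro y
      by_cases hy : y ∈ Metric.ball (0 : Rn n) 1
      · simp [w, Set.indicator_of_mem hy, mul_comm]
      · simp [w, Set.indicator_of_notMem hy]
    simp_rw [this]
    rw [integral_indicator Metric.isOpen_ball.measurableSet]
    rfl
  have hwi : ∀ P : MvPolynomial (Fin n) ℝ,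
      Integrable (fun y => MvPolynomial.eval (fun k => y k) P * w y) volume := by
    intro P
    have : (fun y => MvPolynomial.eval (fun k => y k) P * w y) =
        (Metric.ball 0 1).indicator (fun y : Rn n =>
          MvPolynomial.eval (fun k => y k) (P * W : MvPolynomial (Fin n) ℝ)) := by
      ext y
      by_cases hy : y ∈ Metric.ball (0 : Rn n) 1
      · simp [w, Set.indicator_of_mem hy]
      · simp [w, Set.indicator_of_notMem hy]
    rw [this, integrable_indicator_iff Metric.isOpen_ball.measurableSet]
    exact integrableOn_ball_polynomial _
  refine ⟨w, (continuous_evalPolynomial _).measurable.indicator Metric.isOpen_ball.measurableSet,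
    fun y hy => Set.indicator_of_notMem (by simpa using hy) _, fun y => ?_, fun P hP => ?_⟩
  · have hI : 0 ≤ ∫ y, |φ y| := integral_nonneg fun _ => abs_nonneg _
    by_cases hy : y ∈ Metric.ball (0 : Rn n) 1
    · simp only [w, Set.indicator_of_mem hy, W, Submodule.coe_sum, Submodule.coe_smul, map_sum,
        MvPolynomial.smul_eval]
      rw [Finset.sum_mul]
      refine (Finset.abs_sum_le_sum_abs _ _).trans (Finset.sum_le_sum fun i _ => ?_)
      rw [abs_mul, mul_right_comm]
      refine mul_le_mul ?_ (hD₂' i y (by simpa using (mem_ball_zero_iff.1 hy).le)) (abs_nonneg _)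
        (mul_nonneg (hD₁ i) hI)
      rw [ha, abs_neg]
      exact (hmom _).2 _ (hD₁' i)
    · simp only [w, Set.indicator_of_notMem hy, abs_zero]
      exact mul_nonneg (Finset.sum_nonneg fun i _ => mul_nonneg (hD₁ i) (hD₂ i)) hI
  · let P' : V := ⟨P, (MvPolynomial.mem_restrictTotalDegree _ _ _).2 hP.le⟩
    simp_rw [mul_add]
    rw [integral_add (hmom P).1 (hwi P), show ∫ y, MvPolynomial.eval (fun k => y k) P * w y =
      B W P' from hwW P']
    obtain ⟨c, hc⟩ : ∃ c : Fin _ → ℝ, P' = ∑ i, c i • b i := ⟨b.repr P', (b.sum_repr P').symm⟩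
    have hP' : P = ∑ i, c i • (b i : MvPolynomial (Fin n) ℝ) := by
      have := congrArg Subtype.val hc
      simpa only [Submodule.coe_sum, Submodule.coe_smul] using this
    have h1 : ∫ y, MvPolynomial.eval (fun k => y k) P * φ y = -∑ i, c i * a i := by
      rw [hP']
      simp only [map_sum, MvPolynomial.smul_eval, Finset.sum_mul, mul_assoc]
      rw [integral_finsetSum _ fun i _ => (hmom _).1.const_mul _, ← Finset.sum_neg_distrib]
      refine Finset.sum_congr rfl fun i _ => ?_
      rw [integral_const_mul, ha]
      ring
    have h2 : B W P' = ∑ i, c i * a i := by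
      rw [hc]
      simp [hW]
    rw [h1, h2, neg_add_cancel]

end Moments

/-! ### The normalized extremal family -/

theorem eventually_mul_le_rpow {p q : ℝ} (hpq : p.HolderConjugate q) (a b : ℝ) {θ : ℝ}
    (hθ : θ < 1) (hb : 0 ≤ b) :
    ∀ᶠ J : ℝ in atTop, ∀ u, J - a ≤ u → θ * J ≤ |u / (J ^ (1 / p) + b)| ^ q := by
  have hp := hpq.pos
  have hq := hpq.symm.pos
  -- Here J is the p-th power of the norm of the annular density, as well as its potential up to a
  -- bounded error. The normalized potential is therefore of order J/J^(1/p) = J^(1/q), and bounded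
  -- errors in numerator and denominator vanish in the limit.
  have hlim : Tendsto (fun J : ℝ => ((1 - a * J⁻¹) / (1 + b * J ^ (-(1 / p)))) ^ q) atTop (𝓝 1) := by
    have h1 : Tendsto (fun J : ℝ => 1 - a * J⁻¹) atTop (𝓝 1) := by
      simpa using (tendsto_inv_atTop_zero.const_mul a).const_sub (1 : ℝ)
    have h2 : Tendsto (fun J : ℝ => 1 + b * J ^ (-(1 / p))) atTop (𝓝 1) := by
      simpa using ((tendsto_rpow_neg_atTop (show 0 < 1 / p by positivity)).const_mul b).const_add 1
    have h3 := (h1.div h2 one_ne_zero).rpow_const (p := q) (Or.inr hq.le)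
    simpa using h3
  filter_upwards [hlim.eventually_const_lt hθ, eventually_gt_atTop 0, eventually_ge_atTop a]
    with J hJ hJ0 hJa u hu
  have hpow : 0 < J ^ (1 / p) := by positivity
  have hden : 0 < J ^ (1 / p) + b := by positivity
  have hu0 : 0 ≤ u := by linarith
  have e1 : (1 - a * J⁻¹) / (1 + b * J ^ (-(1 / p))) = (J - a) / (J ^ (1 / p) + b) * J ^ (-(1 / q)) := by
    have : J ^ (-(1 / q)) = J⁻¹ * J ^ (1 / p) := by
      rw [← Real.rpow_neg_one, ← Real.rpow_add hJ0]
      congr 1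
      have := hpq.inv_add_inv_eq_one
      simp only [one_div]
      linarith
    rw [this, Real.rpow_neg hJ0.le, div_mul_eq_mul_div, div_eq_div_iff (by positivity) hden.ne']
    field_simp
  rw [e1, Real.mul_rpow (div_nonneg (by linarith) hden.le) (by positivity), ← Real.rpow_mul hJ0.le,
    show -(1 / q) * q = -1 by field_simp, Real.rpow_neg_one] at hJ
  have h4 : θ * J ≤ ((J - a) / (J ^ (1 / p) + b)) ^ q := by
    rw [← div_eq_mul_inv, lt_div_iff₀ hJ0] at hJ
    exact hJ.le
  refine h4.trans ?_
  rw [abs_of_nonneg (by positivity)]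
  exact Real.rpow_le_rpow (div_nonneg (by linarith) hden.le) (by gcongr) hq.le

section Family

variable {n : ℕ} {α ε R M : ℝ} {K : Rn n → ℝ} {g : Sn n → ℝ} {G : Rn n → ℝ}

/-- The excess of |K| above 1 is globally integrable, and the remainder is at most 1 on a ball of
finite volume. -/
theorem integrableOn_closedBall_kernel (hα : 0 < α) (hαn : α < n) (hε : 0 < ε) (hR : 0 < R)
    (hK : AEStronglyMeasurable K volume) (hg : MemLp g (ENNReal.ofReal (qExp n α)) (surf n))
    (hloc : LocalExpansion α ε R K g) (htail : TailCondition α R K) (ρ : ℝ) :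
    IntegrableOn K (Metric.closedBall 0 ρ) volume := by
  obtain ⟨C, hC0, hC⟩ := criticalKernel_of_expansion hα hαn hε hR hK hg hloc htail
  refine ⟨hK.restrict, ?_⟩
  have hC1 := hC.excess_left 0 1 le_rfl
  rw [Real.one_rpow, mul_one, ENNReal.ofReal_one] at hC1
  simp only [zero_sub] at hC1
  rw [lintegral_neg_eq_self (fun y => ENNReal.ofReal |hK.mk K y| - 1)] at hC1
  have h1 : ∫⁻ y in Metric.closedBall 0 ρ, ‖K y‖ₑ ≤
      ∫⁻ y in Metric.closedBall 0 ρ, ((ENNReal.ofReal |hK.mk K y| - 1) + 1) := by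
    apply lintegral_mono_ae
    filter_upwards [ae_restrict_of_ae hK.ae_eq_mk] with y hy
    rw [Real.enorm_eq_ofReal_abs, hy]
    exact le_tsub_add
  refine h1.trans_lt ?_
  rw [lintegral_add_right _ measurable_const]
  refine ENNReal.add_lt_top.2 ⟨(setLIntegral_le_lintegral _ _).trans_lt
    (hC1.trans_lt ENNReal.ofReal_lt_top), ?_⟩
  simp [measure_closedBall_lt_top]

/-- Applied to the moment correction: its potential stays bounded near the origin and does not
disturb the growth of the main term. -/
theorem pot_bounded_density (hK : AEStronglyMeasurable K volume) {r : ℝ}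
    (hKi : IntegrableOn K (Metric.closedBall 0 (r + 1)) volume) {w : Rn n → ℝ} {W : ℝ}
    (hw : Measurable w) (hw1 : ∀ y, 1 ≤ ‖y‖ → w y = 0) (hwW : ∀ y, |w y| ≤ W) {x : Rn n}
    (hx : ‖x‖ ≤ r) : Integrable (fun t => K t * w (x - t)) volume ∧
      |pot K w x| ≤ ∫ t in Metric.closedBall 0 (r + 1), |K t| * W := by
  have hb : ∀ t, |K t * w (x - t)| ≤
      (Metric.closedBall (0 : Rn n) (r + 1)).indicator (fun t => |K t| * W) t := by
    intro t
    by_cases ht : t ∈ Metric.closedBall (0 : Rn n) (r + 1)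
    · rw [Set.indicator_of_mem ht, abs_mul]
      gcongr
      exact hwW _
    · rw [Set.indicator_of_notMem ht, hw1, mul_zero, abs_zero]
      have h1 := norm_sub_norm_le t x
      rw [norm_sub_rev] at h1
      rw [mem_closedBall_zero_iff, not_le] at ht
      linarith
  have hi : Integrable ((Metric.closedBall (0 : Rn n) (r + 1)).indicator (fun t => |K t| * W))
      volume :=
    (integrable_indicator_iff Metric.isClosed_closedBall.measurableSet).2 (hKi.abs.mul_const W)
  have hi' : Integrable (fun t => K t * w (x - t)) volume :=
    hi.mono' (hK.mul (hw.comp (measurable_const.sub measurable_id)).aestronglyMeasurable)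
      (.of_forall hb)
  refine ⟨hi', ?_⟩
  rw [← integral_indicator Metric.isClosed_closedBall.measurableSet]
  exact (abs_integral_le_integral_abs).trans (integral_mono hi'.abs hi hb)

theorem pot_add_div {φ w : Rn n → ℝ} {x : Rn n} (h1 : Integrable (fun t => K t * φ (x - t)) volume)
    (h2 : Integrable (fun t => K t * w (x - t)) volume) (N : ℝ) :
    pot K (fun y => (φ y + w y) / N) x = (pot K φ x + pot K w x) / N := by
  unfold pot convolution
  simp only [ContinuousLinearMap.mul_apply']
  rw [← integral_add h1 h2, ← integral_div]
  congr 1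
  ext t
  ring

theorem normLp_le_of_bounded (hα : 0 < α) (hαn : α < n) {w : Rn n → ℝ} {W : ℝ}
    (hw1 : ∀ y, 1 ≤ ‖y‖ → w y = 0) (hwW : ∀ y, |w y| ≤ W) :
    normLp α w ≤ volume (Metric.ball (0 : Rn n) 1) ^ (pExp n α)⁻¹ * ENNReal.ofReal W := by
  have hp := (holderConjugate hα hαn).pos
  have hi : w = (Metric.ball (0 : Rn n) 1).indicator w := by
    ext y
    by_cases hy : y ∈ Metric.ball (0 : Rn n) 1
    · rw [Set.indicator_of_mem hy]
    · rw [Set.indicator_of_notMem hy, hw1 y (by simpa using hy)]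
  unfold normLp
  rw [hi, eLpNorm_indicator_eq_eLpNorm_restrict Metric.isOpen_ball.measurableSet]
  refine (eLpNorm_le_of_ae_bound (C := W) (.of_forall hwW)).trans ?_
  rw [Measure.restrict_apply_univ, ENNReal.toReal_ofReal hp.le]

/-- Densities, with prescribed vanishing moments, which are extremal for the exponential
inequality. -/
theorem exists_extremal_family (hα : 0 < α) (hαn : α < n) (hε : 0 < ε) (hR : 0 < R)
    (hK : AEStronglyMeasurable K volume) (hg : MemLp g (ENNReal.ofReal (qExp n α)) (surf n))
    (hloc : LocalExpansion α ε R K g) (htail : TailCondition α R K) (hA : 0 < sphConst n α g)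
    (hsm : SmoothOnSphere g) (m : ℕ) :
    ∃ ρ r C : ℝ, 0 < r ∧ 0 ≤ C ∧ ∃ f : ℝ → Rn n → ℝ,
      (∀ L, 0 ≤ L → InLp α (f L) ∧ normLp α (f L) ≤ 1 ∧ (∀ y, ρ < ‖y‖ → f L y = 0) ∧
        VanishingMoments m (f L) ∧ ∫⁻ y, ENNReal.ofReal |f L y| ≤ ENNReal.ofReal C) ∧
      ∀ θ < 1, ∀ᶠ L : ℝ in atTop, ∀ x, ‖x‖ ≤ r * Real.exp (-L) →
        θ * (sphConst n α g * (n * L)) ≤ |pot K (f L) x| ^ qExp n α := by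
  obtain ⟨G, hG, hGg⟩ := hsm
  have hn := natCast_pos_of_lt hα hαn
  have hn' : (0 : ℝ) < n := by exact_mod_cast hn
  have hc := holderConjugate hα hαn
  have hp := hc.pos
  obtain ⟨Γ, hΓ, hΓ1, hΓ2⟩ := exists_angular_bounds hG
  set r := R / 2 with hr
  have hr0 : 0 < r := by positivity
  obtain ⟨C₁, hC₁0, hC₁⟩ := exists_pot_annularDensity hα hαn hε hR hK hg hloc hG hGg
  obtain ⟨C₂, hC₂0, hC₂⟩ := lintegral_abs_annularDensity_le hα hαn hΓ1 r hr0
  obtain ⟨C₃, hC₃0, hC₃⟩ := exists_moment_correction n m r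
  have hKi := integrableOn_closedBall_kernel hα hαn hε hR hK hg hloc htail (r + 1)
  set A := sphConst n α g with hAdef
  set W := C₃ * C₂ with hW
  have hW0 : 0 ≤ W := by positivity
  set C₄ := ∫ t in Metric.closedBall (0 : Rn n) (r + 1), |K t| * W with hC₄
  set V := (volume (Metric.ball (0 : Rn n) 1) ^ (pExp n α)⁻¹ * ENNReal.ofReal W).toReal with hV
  have hVt : volume (Metric.ball (0 : Rn n) 1) ^ (pExp n α)⁻¹ * ENNReal.ofReal W =
      ENNReal.ofReal V := by
    rw [hV, ENNReal.ofReal_toReal]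
    exact ENNReal.mul_ne_top (ENNReal.rpow_ne_top_of_nonneg (by positivity)
      measure_ball_lt_top.ne) ENNReal.ofReal_ne_top
  have hV0 : 0 ≤ V := ENNReal.toReal_nonneg
  set U := W * (volume (Metric.ball (0 : Rn n) 1)).toReal with hU
  have hU0 : 0 ≤ U := by positivity
  -- Inner radius r e^(-L), so that log(r/δ) = L and the mass is A n L.
  set φ : ℝ → Rn n → ℝ := fun L y => annularDensity α G (r * Real.exp (-L)) r (-y) with hφ
  have hφm : ∀ L, Measurable (φ L) := fun L =>
    (measurable_annularDensity hG.continuous _ r).comp measurable_neg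
  have hφ1 : ∀ L, ∫⁻ y, ENNReal.ofReal |φ L y| ≤ ENNReal.ofReal C₂ := fun L => by
    rw [hφ, lintegral_neg_eq_self
      (fun y => ENNReal.ofReal |annularDensity α G (r * Real.exp (-L)) r y|)]
    exact hC₂ _ (by positivity)
  have hφi : ∀ L, Integrable (φ L) volume := fun L => by
    refine ⟨(hφm L).aestronglyMeasurable, ?_⟩
    simp_rw [HasFiniteIntegral, Real.enorm_eq_ofReal_abs]
    exact (hφ1 L).trans_lt ENNReal.ofReal_lt_top
  have hφ1' : ∀ L, ∫ y, |φ L y| ≤ C₂ := fun L => by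
    rw [integral_eq_lintegral_of_nonneg_ae (.of_forall fun _ => abs_nonneg _)
      (hφi L).abs.1]
    exact ENNReal.toReal_le_of_le_ofReal hC₂0 (hφ1 L)
  have hφs : ∀ L y, r < ‖y‖ → φ L y = 0 := fun L y hy =>
    Set.indicator_of_notMem (fun h => by
      have := h.2; rw [norm_neg] at this; linarith) _
  choose w hwm hw1 hwb hwv using fun L => hC₃ (φ L) (hφi L) (hφs L)
  have hwW : ∀ L y, |w L y| ≤ W := fun L y => (hwb L y).trans (by rw [hW]; gcongr; exact hφ1' L)
  have hφp : ∀ L, 0 ≤ L → normLp α (φ L) = ENNReal.ofReal ((A * (n * L)) ^ (1 / pExp n α)) := by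
    intro L hL
    have h1 := normLp_rpow hα hαn (φ L)
    rw [hφ, lintegral_neg_eq_self (fun y => ENNReal.ofReal
      |annularDensity α G (r * Real.exp (-L)) r y| ^ pExp n α),
      lintegral_annularDensity_rpow hα hαn hG.continuous hGg hg (by positivity)
        (mul_le_of_le_one_right hr0.le (Real.exp_le_one_iff.2 (by linarith)))] at h1
    have h2 : Real.log (r / (r * Real.exp (-L))) = L := by
      rw [div_mul_cancel_left₀ hr0.ne', ← Real.exp_neg, neg_neg, Real.log_exp]
    rw [h2] at h1
    rw [← ENNReal.ofReal_rpow_of_nonneg (by positivity) (by positivity), ← h1, ← ENNReal.rpow_mul,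
      mul_one_div_cancel hp.ne', ENNReal.rpow_one]
  -- The normalizer bounds the norm of φ + w, with V bounding that of w; the additional 1 gives N ≥
  -- 1, so dividing does not increase the L¹ norm.
  set N : ℝ → ℝ := fun L => (A * (n * L)) ^ (1 / pExp n α) + (V + 1) with hN
  have hN1 : ∀ L, 0 ≤ L → 1 ≤ N L := fun L hL => by
    have : 0 ≤ (A * (n * L)) ^ (1 / pExp n α) := by positivity
    simp only [hN]; linarith
  have hfm : ∀ L, AEStronglyMeasurable (fun y => (φ L y + w L y) / N L) volume := fun L =>
    (((hφm L).add (hwm L)).div_const _).aestronglyMeasurable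
  have hnorm : ∀ L, 0 ≤ L → normLp α (fun y => (φ L y + w L y) / N L) ≤ 1 := by
    intro L hL
    have hN0 : 0 < N L := by linarith [hN1 L hL]
    have e : (fun y => (φ L y + w L y) / N L) = (N L)⁻¹ • (φ L + w L) := by
      ext y; simp [div_eq_inv_mul]
    have h1 : normLp α (φ L + w L) ≤ ENNReal.ofReal (N L) := by
      have hp1 : (1 : ℝ≥0∞) ≤ ENNReal.ofReal (pExp n α) := by
        rw [← ENNReal.ofReal_one]; exact ENNReal.ofReal_le_ofReal hc.lt.le
      refine (eLpNorm_add_le (hφm L).aestronglyMeasurable (hwm L).aestronglyMeasurable hp1).trans ?_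
      have h2 := normLp_le_of_bounded hα hαn (hw1 L) (hwW L)
      have h3 := hφp L hL
      unfold normLp at h2 h3
      rw [hVt] at h2
      rw [h3]
      refine (add_le_add_right h2 _).trans ?_
      rw [← ENNReal.ofReal_add (by positivity) hV0]
      apply ENNReal.ofReal_le_ofReal
      simp only [hN]; linarith
    unfold normLp at h1 ⊢
    rw [e, eLpNorm_const_smul, Real.enorm_eq_ofReal_abs, abs_of_pos (inv_pos.2 hN0)]
    refine (mul_le_mul_right h1 _).trans ?_
    rw [← ENNReal.ofReal_mul (inv_pos.2 hN0).le, inv_mul_cancel₀ hN0.ne', ENNReal.ofReal_one]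
  -- The support radius covers the annulus and the unit ball carrying the correction; r/2 appears
  -- because the potential is controlled on half of the inner radius.
  refine ⟨max r 1, r / 2, C₂ + U, by positivity, by positivity,
    fun L y => (φ L y + w L y) / N L, fun L hL => ⟨⟨hfm L, (hnorm L hL).trans_lt ENNReal.one_lt_top⟩,
      hnorm L hL, fun y hy => ?_, fun P hP => ?_, ?_⟩, fun θ hθ => ?_⟩
  · rw [max_lt_iff] at hy
    simp [hφs L y hy.1, hw1 L y hy.2.le]
  · have := hwv L P hP
    simp_rw [← mul_div_assoc]
    rw [integral_div, this, zero_div]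
  · calc ∫⁻ y, ENNReal.ofReal |(φ L y + w L y) / N L| ≤
          ∫⁻ y, (ENNReal.ofReal |φ L y| + (Metric.ball (0 : Rn n) 1).indicator
            (fun _ => ENNReal.ofReal W) y) := by
          refine lintegral_mono fun y => ?_
          have h0 : |(φ L y + w L y) / N L| ≤ |φ L y| + |w L y| := by
            rw [abs_div, abs_of_pos (by linarith [hN1 L hL] : 0 < N L)]
            exact (div_le_self (abs_nonneg _) (hN1 L hL)).trans (abs_add_le _ _)
          refine (ENNReal.ofReal_le_ofReal h0).trans ?_
          rw [ENNReal.ofReal_add (abs_nonneg _) (abs_nonneg _)]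
          gcongr
          by_cases hy : y ∈ Metric.ball (0 : Rn n) 1
          · rw [Set.indicator_of_mem hy]; exact ENNReal.ofReal_le_ofReal (hwW L y)
          · rw [hw1 L y (by simpa using hy)]; simp
      _ ≤ ENNReal.ofReal C₂ + ENNReal.ofReal W * volume (Metric.ball (0 : Rn n) 1) := by
          rw [lintegral_add_left (hφm L).abs.ennreal_ofReal,
            lintegral_indicator Metric.isOpen_ball.measurableSet, setLIntegral_const]
          gcongr
          exact hφ1 L
      _ = _ := by
          rw [ENNReal.ofReal_add hC₂0 hU0, hU, ENNReal.ofReal_mul hW0,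
            ENNReal.ofReal_toReal measure_ball_lt_top.ne]
  · have hJ : Tendsto (fun L : ℝ => A * (n * L)) atTop atTop :=
      (tendsto_id.const_mul_atTop hn').const_mul_atTop hA
    filter_upwards [hJ.eventually (eventually_mul_le_rpow hc (C₁ + C₄) (V + 1) hθ (by positivity)),
      eventually_ge_atTop 0] with L hL hL0 x hx
    have hexp : Real.exp (-L) ≤ 1 := Real.exp_le_one_iff.2 (by linarith)
    have hδr : r * Real.exp (-L) ≤ r := mul_le_of_le_one_right hr0.le hexp
    have hx2 : ‖x‖ ≤ r * Real.exp (-L) / 2 := by linarith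
    obtain ⟨hi, hb⟩ := hC₁ (r * Real.exp (-L)) (by positivity) hδr x hx2
    obtain ⟨hi', hb'⟩ := pot_bounded_density hK hKi (hwm L) (hw1 L) (hwW L)
      (show ‖x‖ ≤ r by linarith)
    rw [pot_add_div hi hi']
    apply hL
    have h2 : Real.log (r / (r * Real.exp (-L))) = L := by
      rw [div_mul_cancel_left₀ hr0.ne', ← Real.exp_neg, neg_neg, Real.log_exp]
    rw [h2] at hb
    have h3 := (abs_le.1 hb).1
    have h4 := (abs_le.1 hb').1
    simp only [hφ]
    linarith

end Family

/-! ### Divergence above the critical constant -/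

section LowerBounds

variable {n : ℕ} {α ε R c : ℝ} {K : Rn n → ℝ} {g : Sn n → ℝ}

/-- An exponential of rate larger than the dimension beats the volume of an exponentially small
ball. -/
theorem tendsto_exp_mul_volume_closedBall (hn : 0 < n) {κ r : ℝ} (hκ : 1 < κ) (hr : 0 < r)
    (x : Rn n) :
    Tendsto (fun L : ℝ => ENNReal.ofReal (Real.exp (κ * (n * L)) / 2) *
      volume (Metric.closedBall x (r * Real.exp (-L)))) atTop (𝓝 ⊤) := by
  have hn' : (0 : ℝ) < n := by exact_mod_cast hn
  set v := (volume (Metric.ball (0 : Rn n) 1)).toReal with hv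
  have hv0 : 0 < v := ENNReal.toReal_pos (Metric.measure_ball_pos _ _ one_pos).ne'
    measure_ball_lt_top.ne
  have hvol : ∀ L : ℝ, ENNReal.ofReal (Real.exp (κ * (n * L)) / 2) *
      volume (Metric.closedBall x (r * Real.exp (-L))) =
      ENNReal.ofReal (r ^ n * v / 2 * Real.exp ((κ - 1) * (n * L))) := by
    intro L
    rw [Measure.addHaar_closedBall _ _ (by positivity), finrank_euclideanSpace_fin,
      ← ENNReal.ofReal_toReal (measure_ball_lt_top (μ := (volume : Measure (Rn n)))
        (x := 0) (r := 1)).ne, ← hv, ← ENNReal.ofReal_mul (by positivity),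
      ← ENNReal.ofReal_mul (by positivity)]
    congr 1
    have e : Real.exp ((κ - 1) * (n * L)) = Real.exp (κ * (n * L)) * Real.exp (-L) ^ n := by
      rw [← Real.exp_nat_mul, ← Real.exp_add]
      congr 1; ring
    rw [e]; ring
  simp_rw [hvol]
  refine ENNReal.tendsto_ofReal_atTop.comp ?_
  refine Tendsto.const_mul_atTop (by positivity) (Real.tendsto_exp_atTop.comp ?_)
  exact (tendsto_id.const_mul_atTop hn').const_mul_atTop (by linarith)

theorem exists_rate_gt_one {A : ℝ} (hA : 0 < A) (hc : 1 / A < c) :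
    ∃ θ < 1, 1 < c * (θ * A) ∧ 0 < c := by
  have hc0 : 0 < c := (by positivity : 0 < 1 / A).trans hc
  have h1 : 1 < c * A := by rwa [div_lt_iff₀ hA] at hc
  -- The midpoint between 1/(cA) and 1, so that θ < 1 while c θ A > 1.
  refine ⟨((c * A)⁻¹ + 1) / 2, ?_, ?_, hc0⟩
  · have := inv_lt_one_of_one_lt₀ h1
    linarith
  · have : c * (((c * A)⁻¹ + 1) / 2 * A) = (1 + c * A) / 2 := by
      field_simp
    linarith

theorem pot_translate (K f : Rn n → ℝ) (a x : Rn n) :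
    pot K (fun y => f (y - a)) x = pot K f (x - a) := by
  unfold pot convolution
  simp only [sub_right_comm]

theorem normLp_translate {f : Rn n → ℝ} (hf : AEStronglyMeasurable f volume) (a : Rn n) :
    normLp α (fun y => f (y - a)) = normLp α f :=
  eLpNorm_comp_measurePreserving hf (measurePreserving_sub_right volume a)

/-- Extremal densities concentrating at a density point of the set. -/
theorem exists_expInt_gt {f : ℝ → Rn n → ℝ} {r A : ℝ} (hn : 0 < n) (hr : 0 < r) (hA : 0 < A)
    (hf : ∀ L, 0 ≤ L → InLp α (f L) ∧ normLp α (f L) ≤ 1)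
    (hlow : ∀ θ < 1, ∀ᶠ L : ℝ in atTop, ∀ x, ‖x‖ ≤ r * Real.exp (-L) →
        θ * (A * (n * L)) ≤ |pot K (f L) x| ^ qExp n α)
    {E : Set (Rn n)} (hE : NullMeasurableSet E volume) (hE0 : 0 < volume E) (hc : 1 / A < c)
    {B : ℝ≥0∞} (hB : B < ⊤) : ∃ h : Rn n → ℝ, InLp α h ∧ normLp α h ≤ 1 ∧ B < expInt α K c E h := by
  obtain ⟨θ, hθ, hκ, hc0⟩ := exists_rate_gt_one hA hc
  -- A Lebesgue density point of E. The extremal densities are translated there, and eventually more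
  -- than half of each shrinking ball lies in E.
  obtain ⟨x₀, hx₀⟩ : ∃ x₀ : Rn n, Tendsto (fun s => volume (E ∩ Metric.closedBall x₀ s) /
      volume (Metric.closedBall x₀ s)) (𝓝[>] 0) (𝓝 1) := by
    have : NeZero (volume.restrict E) := ⟨by
      rw [Ne, Measure.restrict_eq_zero]; exact hE0.ne'⟩
    exact (Besicovitch.ae_tendsto_measure_inter_div volume E).exists
  have hs : Tendsto (fun L : ℝ => r * Real.exp (-L)) atTop (𝓝[>] 0) := by
    refine tendsto_nhdsWithin_iff.2 ⟨?_, .of_forall fun L => by simp only [Set.mem_Ioi]; positivity⟩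
    simpa using (Real.tendsto_exp_neg_atTop_nhds_zero).const_mul r
  have hhalf := (hx₀.comp hs).eventually_const_lt (u := 2⁻¹) ENNReal.one_half_lt_one
  obtain ⟨L, hL1, hL2, hL3, hL0⟩ := (hhalf.and ((hlow θ hθ).and
    (((tendsto_exp_mul_volume_closedBall hn hκ hr x₀).eventually_const_lt hB).and
      (eventually_ge_atTop 0)))).exists
  obtain ⟨hfL, hfL1⟩ := hf L hL0
  refine ⟨fun y => f L (y - x₀),
    hfL.comp_measurePreserving (measurePreserving_sub_right volume x₀), ?_, hL3.trans_le ?_⟩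
  · rwa [normLp_translate hfL.1]
  set D := Metric.closedBall x₀ (r * Real.exp (-L)) with hD
  have hD2 : volume D ≤ 2 * volume (E ∩ D) := by
    have h0 : volume D ≠ 0 := (Metric.measure_closedBall_pos _ _ (by positivity)).ne'
    have ht : volume D ≠ ⊤ := measure_closedBall_lt_top.ne
    simp only [Function.comp_apply] at hL1
    rw [ENNReal.lt_div_iff_mul_lt (.inl h0) (.inl ht), mul_comm, ← div_eq_mul_inv,
      ENNReal.div_lt_iff (.inl two_ne_zero) (.inl (by simp))] at hL1
    rw [mul_comm]
    exact hL1.le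
  unfold expInt
  calc ENNReal.ofReal (Real.exp (c * (θ * A) * (n * L)) / 2) * volume D
      ≤ ENNReal.ofReal (Real.exp (c * (θ * A) * (n * L)) / 2) * (2 * volume (E ∩ D)) := by gcongr
    _ = ENNReal.ofReal (Real.exp (c * (θ * A) * (n * L))) * volume (E ∩ D) := by
        rw [← mul_assoc]
        congr 1
        rw [← ENNReal.ofReal_ofNat, ← ENNReal.ofReal_mul (by positivity)]
        congr 1; ring
    _ = ∫⁻ x in E ∩ D, ENNReal.ofReal (Real.exp (c * (θ * A) * (n * L))) := by
        rw [setLIntegral_const]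
    _ ≤ ∫⁻ x in E ∩ D, ENNReal.ofReal (Real.exp (c *
          |pot K (fun y => f L (y - x₀)) x| ^ qExp n α)) := by
        apply lintegral_mono_ae
        filter_upwards [ae_restrict_mem₀ (hE.inter
          Metric.isClosed_closedBall.measurableSet.nullMeasurableSet)] with x hx
        rw [pot_translate]
        refine ENNReal.ofReal_le_ofReal (Real.exp_le_exp.2 ?_)
        have := hL2 (x - x₀) (by simpa [hD, dist_eq_norm] using hx.2)
        calc _ = c * (θ * (A * (n * L))) := by ring
          _ ≤ _ := by gcongr
    _ ≤ _ := lintegral_mono_set Set.inter_subset_left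

/-- On the ball of radius r e^(-L) the exponent is at least c θ A n L with c θ A > 1, which beats
the volume of order e^(-nL). For large arguments the subtracted polynomial costs at most half of the
exponential. -/
theorem tendsto_regExpInt {f : ℝ → Rn n → ℝ} {r A : ℝ} (hn : 0 < n) (hr : 0 < r) (hA : 0 < A)
    (hlow : ∀ θ < 1, ∀ᶠ L : ℝ in atTop, ∀ x, ‖x‖ ≤ r * Real.exp (-L) →
        θ * (A * (n * L)) ≤ |pot K (f L) x| ^ qExp n α) (hc : 1 / A < c) :
    Tendsto (fun L => regExpInt α K c (f L)) atTop (𝓝 ⊤) := by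
  obtain ⟨θ, hθ, hκ, hc0⟩ := exists_rate_gt_one hA hc
  have hn' : (0 : ℝ) < n := by exact_mod_cast hn
  obtain ⟨t₀, ht₀⟩ := exists_exp_le_expReg (regOrder n α)
  refine tendsto_nhds_top_mono (tendsto_exp_mul_volume_closedBall hn hκ hr 0) ?_
  have hlin : Tendsto (fun L : ℝ => c * (θ * A) * (n * L)) atTop atTop :=
    (tendsto_id.const_mul_atTop hn').const_mul_atTop (by linarith)
  filter_upwards [hlow θ hθ, hlin.eventually_ge_atTop t₀] with L hL hLt
  unfold regExpInt
  rw [← setLIntegral_const]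
  refine le_trans ?_ (setLIntegral_le_lintegral (Metric.closedBall 0 (r * Real.exp (-L))) _)
  refine setLIntegral_mono' Metric.isClosed_closedBall.measurableSet fun x hx => ?_
  apply ENNReal.ofReal_le_ofReal
  have h1 : c * (θ * A) * (n * L) ≤ c * |pot K (f L) x| ^ qExp n α := by
    have := hL x (by simpa using hx)
    calc _ = c * (θ * (A * (n * L))) := by ring
      _ ≤ _ := by gcongr
  refine le_trans ?_ (ht₀ _ (hLt.trans h1))
  gcongr

end LowerBounds

/-! ### Young's inequality and the splitting of a potential into near and far parts -/

section Young

variable {n : ℕ} {k h : Rn n → ℝ≥0∞} {s : ℝ}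

/-- **Young's inequality** with the density in `L¹`. -/
theorem lintegral_conv_rpow_le (hs : 1 < s) (hk : Measurable k) (hh : Measurable h) :
    ∫⁻ x, (∫⁻ y, k (x - y) * h y) ^ s ≤ (∫⁻ y, h y) ^ s * ∫⁻ y, k y ^ s := by
  have hm : Measurable fun z : Rn n × Rn n => h z.2 * k (z.1 - z.2) ^ s :=
    (hh.comp measurable_snd).mul ((hk.comp (measurable_fst.sub measurable_snd)).pow_const s)
  calc _ ≤ ∫⁻ x, (∫⁻ y, h y) ^ (s - 1) * ∫⁻ y, h y * k (x - y) ^ s := by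
        refine lintegral_mono fun x => ?_
        simp_rw [mul_comm (k _)]
        exact lintegral_mul_rpow_le hs hh.aemeasurable
          (hk.comp (measurable_const.sub measurable_id)).aemeasurable
    _ = (∫⁻ y, h y) ^ (s - 1) * ∫⁻ y, h y * ∫⁻ x, k x ^ s := by
        rw [lintegral_const_mul _ hm.lintegral_prod_right',
          lintegral_lintegral_swap hm.aemeasurable]
        congr 2
        ext y
        exact (lintegral_const_mul (h y) (by fun_prop)).trans
          (congrArg (h y * ·) (lintegral_sub_right_eq_self (μ := volume) (fun x => k x ^ s) y))
    _ = _ := by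
        rw [lintegral_mul_const _ hh, ← mul_assoc]
        congr 1
        nth_rewrite 2 [← ENNReal.rpow_one (∫⁻ y, h y)]
        rw [← ENNReal.rpow_add_of_nonneg _ _ (by linarith) zero_le_one, sub_add_cancel]

theorem lintegral_conv_comm (k h : Rn n → ℝ≥0∞) (x : Rn n) :
    ∫⁻ y, k (x - y) * h y = ∫⁻ y, h (x - y) * k y := by
  rw [← lintegral_sub_left_eq_self (fun y => k (x - y) * h y) x]
  simp only [sub_sub_cancel, mul_comm]

end Young

theorem add_rpow_le_two_rpow (a b : ℝ≥0∞) {s : ℝ} (hs : 0 ≤ s) :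
    (a + b) ^ s ≤ 2 ^ s * a ^ s + 2 ^ s * b ^ s := by
  rw [← ENNReal.mul_rpow_of_nonneg _ _ hs, ← ENNReal.mul_rpow_of_nonneg _ _ hs]
  rcases le_total a b with h | h
  · refine le_add_of_nonneg_of_le zero_le (ENNReal.rpow_le_rpow ?_ hs)
    rw [two_mul]; gcongr
  · refine le_add_of_le_of_nonneg (ENNReal.rpow_le_rpow ?_ hs) zero_le
    rw [two_mul]; gcongr

/-- A quantity at most 1 allows its exponent to be lowered, and the larger of the two summands
decides whether to lower it to p or to q. -/
theorem min_add_rpow_le (a b : ℝ≥0∞) {s p q : ℝ} (hp : 0 ≤ p) (hq : 0 ≤ q) (hps : p ≤ s)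
    (hqs : q ≤ s) : min (a + b) 1 ^ s ≤ 2 ^ p * a ^ p + 2 ^ q * b ^ q := by
  rw [← ENNReal.mul_rpow_of_nonneg _ _ hp, ← ENNReal.mul_rpow_of_nonneg _ _ hq]
  rcases le_total b a with h | h
  · refine le_add_of_le_of_nonneg ((ENNReal.rpow_le_rpow_of_exponent_ge (min_le_right _ _)
      hps).trans (ENNReal.rpow_le_rpow ((min_le_left _ _).trans ?_) hp)) zero_le
    rw [two_mul]; gcongr
  · refine le_add_of_nonneg_of_le zero_le ((ENNReal.rpow_le_rpow_of_exponent_ge (min_le_right _ _)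
      hqs).trans (ENNReal.rpow_le_rpow ((min_le_left _ _).trans ?_) hq))
    rw [two_mul]; gcongr

section Splitting

variable {n : ℕ} {α ε R : ℝ} {K : Rn n → ℝ} {g : Sn n → ℝ}

/-- Interpolation |K|^s = |K|^(s-q) |K|^q; this is where the L^∞ half of the tail condition is used.
-/
theorem lintegral_rpow_far_lt_top_of_le (hα : 0 < α) (hαn : α < n) (htail : TailCondition α R K)
    {s : ℝ} (hs : qExp n α ≤ s) :
    ∫⁻ y in {x : Rn n | R ≤ ‖x‖}, ENNReal.ofReal |K y| ^ s < ∞ := by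
  have hq := qExp_pos hα hαn
  set μ := volume.restrict {x : Rn n | R ≤ ‖x‖} with hμ
  have hM : eLpNormEssSup K μ ≠ ∞ := by
    rw [← eLpNorm_exponent_top]; exact htail.2.2.ne
  calc ∫⁻ y, ENNReal.ofReal |K y| ^ s ∂μ ≤
        ∫⁻ y, eLpNormEssSup K μ ^ (s - qExp n α) * ENNReal.ofReal (|K y| ^ qExp n α) ∂μ := by
        apply lintegral_mono_ae
        filter_upwards [ae_le_eLpNormEssSup (f := K) (μ := μ)] with y hy
        rw [Real.enorm_eq_ofReal_abs] at hy
        rw [← ENNReal.ofReal_rpow_of_nonneg (abs_nonneg _) hq.le]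
        calc ENNReal.ofReal |K y| ^ s =
              ENNReal.ofReal |K y| ^ (s - qExp n α) * ENNReal.ofReal |K y| ^ qExp n α := by
              rw [← ENNReal.rpow_add_of_nonneg _ _ (by linarith) hq.le, sub_add_cancel]
          _ ≤ _ := by gcongr
    _ < ∞ := by
        rw [lintegral_const_mul' _ _ (ENNReal.rpow_ne_top_of_nonneg (by linarith) hM)]
        exact ENNReal.mul_lt_top (ENNReal.rpow_lt_top_of_nonneg (by linarith) hM)
          (lintegral_rpow_far_lt_top hα hαn htail.1)

/-- A potential is dominated by a near part, bounded in `L^{n/α}`, and a far part, bounded in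
`L^s` for every `s ≥ n/(n-α)` by the `L¹` norm of the density. -/
theorem exists_potential_split (hα : 0 < α) (hαn : α < n) (hε : 0 < ε) (hR : 0 < R)
    (hK : AEStronglyMeasurable K volume) (hg : MemLp g (ENNReal.ofReal (qExp n α)) (surf n))
    (hloc : LocalExpansion α ε R K g) (htail : TailCondition α R K) {s : ℝ}
    (hs : qExp n α ≤ s) :
    ∃ S : ℝ≥0∞, S < ∞ ∧ ∀ f : Rn n → ℝ, InLp α f → normLp α f ≤ 1 →
      ∃ U₁ U₂ : Rn n → ℝ≥0∞, Measurable U₁ ∧ Measurable U₂ ∧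
        (∀ x, ENNReal.ofReal |pot K f x| ≤ U₁ x + U₂ x) ∧ ∫⁻ x, U₁ x ^ pExp n α ≤ S ∧
        ∫⁻ x, U₂ x ^ s ≤ (∫⁻ y, ENNReal.ofReal |f y|) ^ s * S := by
  have hc := holderConjugate hα hαn
  have hKi := integrableOn_closedBall_kernel hα hαn hε hR hK hg hloc htail R
  set k := fun y => ENNReal.ofReal |hK.mk K y| with hk
  have hkm : Measurable k := hK.stronglyMeasurable_mk.measurable.abs.ennreal_ofReal
  have hkK : ∀ᵐ y, k y = ENNReal.ofReal |K y| := by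
    filter_upwards [hK.ae_eq_mk] with y hy
    rw [hk, hy]
  set F : Set (Rn n) := {x | R ≤ ‖x‖} with hF
  have hFm : MeasurableSet F := measurableSet_le measurable_const measurable_norm
  have hs1 : 1 < s := hc.symm.lt.trans_le hs
  have hnear : ∫⁻ y, Fᶜ.indicator k y < ∞ := by
    rw [lintegral_indicator hFm.compl]
    have : ∫⁻ y in Fᶜ, k y = ∫⁻ y in Fᶜ, ‖K y‖ₑ := by
      apply lintegral_congr_ae
      filter_upwards [ae_restrict_of_ae hkK] with y hy
      rw [hy, Real.enorm_eq_ofReal_abs]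
    rw [this]
    refine (lintegral_mono_set ?_).trans_lt hKi.2
    intro y hy
    simp only [hF, Set.mem_compl_iff, Set.mem_ofPred_eq, not_le] at hy
    simpa using hy.le
  have hfar : ∫⁻ y, F.indicator k y ^ s < ∞ := by
    have : ∀ y, F.indicator k y ^ s = F.indicator (fun y => k y ^ s) y := by
      intro y
      by_cases hy : y ∈ F
      · simp [hy]
      · simp [hy, (zero_lt_one.trans hs1)]
    simp_rw [this]
    rw [lintegral_indicator hFm]
    have : ∫⁻ y in F, k y ^ s = ∫⁻ y in F, ENNReal.ofReal |K y| ^ s := by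
      apply lintegral_congr_ae
      filter_upwards [ae_restrict_of_ae hkK] with y hy
      rw [hy]
    rw [this]
    exact lintegral_rpow_far_lt_top_of_le hα hαn htail hs
  refine ⟨(∫⁻ y, Fᶜ.indicator k y) ^ pExp n α + ∫⁻ y, F.indicator k y ^ s,
    ENNReal.add_lt_top.2 ⟨ENNReal.rpow_lt_top_of_nonneg hc.pos.le hnear.ne, hfar⟩,
    fun f hf hf1 => ?_⟩
  have hfm := hf.1
  set h := fun y => ENNReal.ofReal |hfm.mk f y| with hh
  have hhm : Measurable h := measurable_mk_abs hfm
  have hm : ∀ k' : Rn n → ℝ≥0∞, Measurable k' → Measurable fun x => ∫⁻ y, k' (x - y) * h y :=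
    fun k' hk' => Measurable.lintegral_prod_right' (f := fun z : Rn n × Rn n =>
      k' (z.1 - z.2) * h z.2) ((hk'.comp (measurable_fst.sub measurable_snd)).mul
        (hhm.comp measurable_snd))
  have h1m := hkm.indicator hFm.compl
  have h2m := hkm.indicator hFm
  refine ⟨_, _, hm _ h1m, hm _ h2m, fun x => ?_, ?_, ?_⟩
  · have := enorm_pot_le K f x
    rw [lintegral_convolution_eq hK hfm, Real.enorm_eq_ofReal_abs] at this
    refine this.trans (le_of_eq ?_)
    rw [← lintegral_add_left (by fun_prop)]
    congr 1
    ext y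
    rw [← add_mul]
    congr 1
    exact (congrFun (Set.indicator_compl_add_self F k) (x - y)).symm
  -- For the near part the kernel is the integrable factor, so kernel and density exchange roles in
  -- Young's inequality.
  · simp_rw [lintegral_conv_comm (Fᶜ.indicator k) h]
    refine (lintegral_conv_rpow_le hc.lt hhm h1m).trans ?_
    refine (mul_le_of_le_one_right' ?_).trans le_self_add
    exact lintegral_mk_rpow_le_one hα hαn hfm hf1
  · refine (lintegral_conv_rpow_le hs1 h2m hhm).trans ?_
    have : ∫⁻ y, h y = ∫⁻ y, ENNReal.ofReal |f y| := by
      apply lintegral_congr_ae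
      filter_upwards [hfm.ae_eq_mk] with y hy
      rw [hh, hy]
    rw [this]
    gcongr
    exact le_add_self

end Splitting

/-! ### Uniform bounds along the extremal family -/

section UniformBounds

variable {n : ℕ} {α ε R : ℝ} {K : Rn n → ℝ} {g : Sn n → ℝ}

theorem pot_congr_ae {f f' : Rn n → ℝ} (h : f =ᵐ[volume] f') : pot K f = pot K f' :=
  convolution_congr _ (ae_eq_refl K) h

/-- Along a family bounded in `L¹`, the regularized exponential integrals stay bounded. -/
theorem exists_regExpInt_le_const (hα : 0 < α) (hαn : α < n) (hε : 0 < ε) (hR : 0 < R)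
    (hK : AEStronglyMeasurable K volume) (hg : MemLp g (ENNReal.ofReal (qExp n α)) (surf n))
    (hloc : LocalExpansion α ε R K g) (htail : TailCondition α R K) (hA : 0 < sphConst n α g)
    (C : ℝ) : ∃ B : ℝ, ∀ f : Rn n → ℝ, InLp α f → normLp α f ≤ 1 →
      ∫⁻ y, ENNReal.ofReal |f y| ≤ ENNReal.ofReal C →
      regExpInt α K (1 / sphConst n α g) f ≤ ENNReal.ofReal B := by
  have hc := holderConjugate hα hαn
  have hp := hc.pos
  have hq := hc.symm.pos
  obtain ⟨S, -, hS⟩ := exists_regExpInt_le hα hαn hε hR hK hg hloc htail hA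
  obtain ⟨S', hS't, hS'⟩ := exists_potential_split hα hαn hε hR hK hg hloc htail le_rfl
  set D := ENNReal.ofReal S * (1 + (2 ^ pExp n α * S' +
    2 ^ qExp n α * (ENNReal.ofReal C ^ qExp n α * S'))) with hD
  have h2 : ∀ t : ℝ, 0 ≤ t → (2 : ℝ≥0∞) ^ t < ∞ := fun t ht =>
    ENNReal.rpow_lt_top_of_nonneg ht (by simp)
  have hDt : D ≠ ∞ := by
    refine (ENNReal.mul_lt_top ENNReal.ofReal_lt_top (ENNReal.add_lt_top.2 ⟨ENNReal.one_lt_top,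
      ENNReal.add_lt_top.2 ⟨ENNReal.mul_lt_top (h2 _ hp.le) hS't, ENNReal.mul_lt_top (h2 _ hq.le)
        (ENNReal.mul_lt_top (ENNReal.rpow_lt_top_of_nonneg hq.le ENNReal.ofReal_ne_top) hS't)⟩⟩)).ne
  refine ⟨D.toReal, fun f hf hf1 hfC => ?_⟩
  rw [ENNReal.ofReal_toReal hDt]
  refine (hS f hf hf1).trans ?_
  obtain ⟨U₁, U₂, hU₁m, hU₂m, hU, hU₁, hU₂⟩ := hS' f hf hf1
  -- Both p and q are at most q(N+1), so the truncated potential may be measured in L^p on its near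
  -- part and in L^q on its far part.
  have hexp : qExp n α ≤ qExp n α * (regOrder n α + 1 : ℕ) :=
    le_mul_of_one_le_right hq.le (by exact_mod_cast Nat.le_add_left 1 _)
  rw [hD]
  gcongr
  calc _ ≤ ∫⁻ x, (2 ^ pExp n α * U₁ x ^ pExp n α + 2 ^ qExp n α * U₂ x ^ qExp n α) := by
        refine lintegral_mono fun x => ?_
        have h0 : 0 ≤ min |pot K f x| 1 := le_min (abs_nonneg _) zero_le_one
        rw [← ENNReal.ofReal_rpow_of_nonneg h0 (by positivity), ENNReal.ofReal_min,
          ENNReal.ofReal_one]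
        refine le_trans ?_ (min_add_rpow_le _ _ hp.le hq.le (regOrder_bound hα hαn) hexp)
        gcongr
        exact hU x
    _ ≤ _ := by
        rw [lintegral_add_left (by fun_prop), lintegral_const_mul' _ _ (h2 _ hp.le).ne,
          lintegral_const_mul' _ _ (h2 _ hq.le).ne]
        gcongr
        refine hU₂.trans ?_
        gcongr

/-- The condition α ≤ n/2 says q ≤ p, so the far part of the potential can also be taken in L^p. -/
theorem exists_normLp_pot_le_of_le_half (hα : 0 < α) (hαn : α < n) (hε : 0 < ε) (hR : 0 < R)
    (hK : AEStronglyMeasurable K volume) (hg : MemLp g (ENNReal.ofReal (qExp n α)) (surf n))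
    (hloc : LocalExpansion α ε R K g) (htail : TailCondition α R K) (h2α : α ≤ (n : ℝ) / 2)
    (C : ℝ) : ∃ B < ∞, ∀ f : Rn n → ℝ, InLp α f → normLp α f ≤ 1 →
      ∫⁻ y, ENNReal.ofReal |f y| ≤ ENNReal.ofReal C → normLp α (pot K f) ^ pExp n α ≤ B := by
  have hc := holderConjugate hα hαn
  have hp := hc.pos
  have hqp : qExp n α ≤ pExp n α := by
    unfold qExp pExp
    gcongr
    linarith
  obtain ⟨S, hSt, hS⟩ := exists_potential_split hα hαn hε hR hK hg hloc htail hqp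
  have h2 : (2 : ℝ≥0∞) ^ pExp n α < ∞ := ENNReal.rpow_lt_top_of_nonneg hp.le (by simp)
  refine ⟨2 ^ pExp n α * S + 2 ^ pExp n α * (ENNReal.ofReal C ^ pExp n α * S),
    ENNReal.add_lt_top.2 ⟨ENNReal.mul_lt_top h2 hSt, ENNReal.mul_lt_top h2
      (ENNReal.mul_lt_top (ENNReal.rpow_lt_top_of_nonneg hp.le ENNReal.ofReal_ne_top) hSt)⟩,
    fun f hf hf1 hfC => ?_⟩
  obtain ⟨U₁, U₂, hU₁m, hU₂m, hU, hU₁, hU₂⟩ := hS f hf hf1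
  rw [normLp_rpow hα hαn]
  calc _ ≤ ∫⁻ x, (2 ^ pExp n α * U₁ x ^ pExp n α + 2 ^ pExp n α * U₂ x ^ pExp n α) := by
        refine lintegral_mono fun x => le_trans ?_ (add_rpow_le_two_rpow _ _ hp.le)
        gcongr
        exact hU x
    _ ≤ _ := by
        rw [lintegral_add_left (by fun_prop), lintegral_const_mul' _ _ h2.ne,
          lintegral_const_mul' _ _ h2.ne]
        gcongr
        refine hU₂.trans ?_
        gcongr

/-- By the closed graph theorem, potentials of the densities with vanishing moments and support in
a fixed ball are uniformly bounded in `L^{n/α}` as soon as each of them lies in this space. -/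
theorem exists_normLp_pot_le_of_potentialsInLp (hα : 0 < α) (hαn : α < n) (hε : 0 < ε) (hR : 0 < R)
    (hK : AEStronglyMeasurable K volume) (hg : MemLp g (ENNReal.ofReal (qExp n α)) (surf n))
    (hloc : LocalExpansion α ε R K g) (htail : TailCondition α R K) {m : ℕ}
    (hm : ∀ f : Rn n → ℝ, InLp α f → HasCompactSupport f → VanishingMoments m f →
      InLp α (pot K f)) (ρ : ℝ) :
    ∃ B < ∞, ∀ f : Rn n → ℝ, InLp α f → normLp α f ≤ 1 → (∀ y, ρ < ‖y‖ → f y = 0) →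
      VanishingMoments m f → normLp α (pot K f) ≤ B := by
  have hc := holderConjugate hα hαn
  set P := ENNReal.ofReal (pExp n α) with hP
  set Q := ENNReal.ofReal (qExp n α) with hQ
  have hP1 : Fact (1 ≤ P) := ⟨by
    rw [hP, ← ENNReal.ofReal_one]; exact ENNReal.ofReal_le_ofReal hc.lt.le⟩
  have hQ1 : Fact (1 ≤ Q) := ⟨by
    rw [hQ, ← ENNReal.ofReal_one]; exact ENNReal.ofReal_le_ofReal hc.symm.lt.le⟩
  have hQP : ENNReal.HolderConjugate Q P := hc.symm.ennrealOfReal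
  set D : Set (Rn n) := Metric.closedBall 0 ρ with hD
  have hDm : MeasurableSet D := Metric.isClosed_closedBall.measurableSet
  set μ := (volume : Measure (Rn n)).restrict D with hμ
  have hμf : IsFiniteMeasure μ := ⟨by
    rw [hμ, Measure.restrict_apply_univ]; exact measure_closedBall_lt_top⟩
  have hpoly : ∀ p : MvPolynomial (Fin n) ℝ,
      MemLp (fun y : Rn n => MvPolynomial.eval (fun i => y i) p) Q μ := by
    intro p
    obtain ⟨B, -, hB⟩ := exists_polynomial_bound p ρ
    refine MemLp.of_bound (continuous_evalPolynomial p).aestronglyMeasurable B ?_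
    filter_upwards [ae_restrict_mem hDm] with y hy
    exact hB y (by simpa [hD] using hy)
  let Λ : MvPolynomial (Fin n) ℝ → Lp ℝ P μ →L[ℝ] ℝ := fun p =>
    (ContinuousLinearMap.mul ℝ ℝ).lpPairing μ Q P (hpoly p).toLp
  have hΛ : ∀ p v, Λ p v = ∫ y, MvPolynomial.eval (fun i => y i) p * v y ∂μ := by
    intro p v
    simp only [Λ, ContinuousLinearMap.lpPairing_eq_integral, ContinuousLinearMap.mul_apply']
    apply integral_congr_ae
    filter_upwards [(hpoly p).coeFn_toLp] with y hy
    rw [hy]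
  -- The moment functionals are continuous on L^p of the ball, polynomials being bounded there.
  -- Their common kernel is thus closed, hence a Banach space, as the closed graph theorem requires.
  let V : Submodule ℝ (Lp ℝ P μ) :=
    ⨅ p : {p : MvPolynomial (Fin n) ℝ // p.totalDegree < m}, (Λ p).ker
  have hVclosed : IsClosed (V : Set (Lp ℝ P μ)) := by
    rw [Submodule.coe_iInf]
    exact isClosed_iInter fun p => (Λ p).isClosed_ker
  have hVc : CompleteSpace V := hVclosed.completeSpace_coe
  let ext : Lp ℝ P μ → Rn n → ℝ := fun v => D.indicator v
  have hext : ∀ v, InLp α (ext v) := fun v =>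
    (memLp_indicator_iff_restrict hDm).2 (Lp.memLp v)
  have hextn : ∀ v, normLp α (ext v) = ‖v‖ₑ := fun v => by
    rw [Lp.enorm_def]
    exact eLpNorm_indicator_eq_eLpNorm_restrict hDm
  have hextadd : ∀ u v, ext (u + v) =ᵐ[volume] fun y => ext u y + ext v y := by
    intro u v
    refine ((ae_eq_restrict_iff_indicator_ae_eq hDm).1 (Lp.coeFn_add u v)).trans
      (.of_forall fun y => ?_)
    simp only [ext, Set.indicator_add']
    rfl
  have hextsmul : ∀ (a : ℝ) v, ext (a • v) =ᵐ[volume] fun y => a * ext v y := by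
    intro a v
    refine ((ae_eq_restrict_iff_indicator_ae_eq hDm).1 (Lp.coeFn_smul a v)).trans
      (.of_forall fun y => ?_)
    by_cases hy : y ∈ D <;> simp [ext, hy]
  have hV : ∀ v, v ∈ V ↔ VanishingMoments m (ext v) := by
    intro v
    simp only [V, Submodule.mem_iInf, LinearMap.mem_ker, Subtype.forall, VanishingMoments]
    refine forall₂_congr fun p hp => ?_
    have : ∀ y : Rn n, MvPolynomial.eval (fun i => y i) p * ext v y =
        D.indicator (fun y => MvPolynomial.eval (fun i => y i) p * v y) y := by
      intro y
      by_cases hy : y ∈ D <;> simp [ext, hy]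
    simp_rw [this]
    rw [integral_indicator hDm]
    exact (hΛ p v ▸ Iff.rfl)
  have hTm : ∀ v : V, MemLp (pot K (ext v)) P volume := fun v =>
    hm _ (hext v) (HasCompactSupport.intro (isCompact_closedBall 0 ρ)
      fun y hy => Set.indicator_of_notMem hy _) ((hV v).1 v.2)
  have hpadd : ∀ u v, pot K (ext (u + v)) =ᵐ[volume] fun x => pot K (ext u) x + pot K (ext v) x := by
    intro u v
    rw [pot_congr_ae (hextadd u v)]
    filter_upwards [ae_convolutionExistsAt hα hαn hε hR hK hg hloc htail (hext u),
      ae_convolutionExistsAt hα hαn hε hR hK hg hloc htail (hext v)] with x hu hv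
    exact hu.distrib_add hv
  have hpsmul : ∀ (a : ℝ) v, pot K (ext (a • v)) = fun x => a * pot K (ext v) x := by
    intro a v
    rw [pot_congr_ae (hextsmul a v)]
    exact convolution_smul
  let T : V →ₗ[ℝ] Lp ℝ P (volume : Measure (Rn n)) :=
    { toFun := fun v => (hTm v).toLp
      map_add' := fun u v => by
        rw [← MemLp.toLp_add]
        exact MemLp.toLp_congr _ _ (hpadd u v)
      map_smul' := fun a v => by
        rw [← MemLp.toLp_const_smul]
        refine MemLp.toLp_congr _ _ (.of_forall fun x => ?_)
        exact congrFun (hpsmul a v) x }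
  have hTcont : Continuous T := by
    -- The two candidate limits are compared in L¹ of each ball: L^p convergence implies L¹
    -- convergence there, and `setLIntegral_abs_potential_le` makes the potential continuous from
    -- L^p into that L¹.
    apply LinearMap.continuous_of_seq_closed_graph
    intro u v y hu hy
    have hTae : ∀ v, T v =ᵐ[volume] pot K (ext v) := fun v => (hTm v).coeFn_toLp
    have hball : ∀ N : ℕ, ∫⁻ x in Metric.ball (0 : Rn n) N, ‖(y - T v) x‖ₑ = 0 := by
      intro N
      obtain ⟨S, hS0, hS⟩ := setLIntegral_abs_potential_le hα hαn hε hR hK hg hloc htail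
        (Metric.ball 0 N) measure_ball_lt_top.ne
      set c := volume (Metric.ball (0 : Rn n) N) ^ (1 / (1 : ℝ≥0∞).toReal - 1 / P.toReal) with hc'
      have hct : c ≠ ∞ := by
        refine ENNReal.rpow_ne_top_of_nonneg ?_ measure_ball_lt_top.ne
        rw [hP, ENNReal.toReal_ofReal hc.pos.le, ENNReal.toReal_one, sub_nonneg]
        exact one_div_le_one_div_of_le one_pos hc.lt.le
      have hle : ∀ z : Lp ℝ P (volume : Measure (Rn n)),
          ∫⁻ x in Metric.ball (0 : Rn n) N, ‖z x‖ₑ ≤ c * ‖z‖ₑ := by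
        intro z
        have := eLpNorm_le_eLpNorm_mul_rpow_measure_univ (μ := volume.restrict (Metric.ball 0 N))
          hP1.out (Lp.aestronglyMeasurable z).restrict
        rw [eLpNorm_one_eq_lintegral_enorm, Measure.restrict_apply_univ, mul_comm] at this
        refine this.trans ?_
        rw [Lp.enorm_def]
        gcongr
        exact Measure.restrict_le_self
      have hk : ∀ k, ∫⁻ x in Metric.ball (0 : Rn n) N, ‖(y - T v) x‖ₑ ≤
          c * ‖y - T (u k)‖ₑ + ENNReal.ofReal S * ‖u k - v‖ₑ := by
        intro k
        have e : y - T v = (y - T (u k)) + T (u k - v) := by rw [map_sub]; abel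
        calc _ ≤ ∫⁻ x in Metric.ball (0 : Rn n) N,
              (‖(y - T (u k)) x‖ₑ + ‖pot K (ext (u k - v : V)) x‖ₑ) := by
              apply lintegral_mono_ae
              filter_upwards [ae_restrict_of_ae (Lp.coeFn_add (y - T (u k)) (T (u k - v))),
                ae_restrict_of_ae (hTae (u k - v))] with x hx hx'
              rw [e, hx, Pi.add_apply, hx']
              exact enorm_add_le _ _
          _ ≤ _ := by
              rw [lintegral_add_left' (Lp.aestronglyMeasurable _).restrict.enorm]
              refine add_le_add (hle _) ?_
              refine (lintegral_mono fun x => enorm_pot_le _ _ _).trans ?_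
              refine (hS _ (hext _).1).trans ?_
              rw [hextn]
              rfl
      have h1 : Tendsto (fun k => ‖y - T (u k)‖ₑ) atTop (𝓝 0) := by
        have := (tendsto_const_nhds (x := y)).sub hy |>.enorm
        simpa using this
      have h2 : Tendsto (fun k => ‖u k - v‖ₑ) atTop (𝓝 0) := by
        have := (((continuous_subtype_val.tendsto v).comp hu).sub
          (tendsto_const_nhds (x := (v : Lp ℝ P μ)))).enorm
        rwa [sub_self, enorm_zero] at this
      have h3 := (ENNReal.Tendsto.const_mul h1 (.inr hct)).add
        (ENNReal.Tendsto.const_mul h2 (.inr (ENNReal.ofReal_ne_top (r := S))))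
      rw [mul_zero, mul_zero, add_zero] at h3
      exact le_antisymm (ge_of_tendsto' h3 hk) zero_le
    have hz : ((y - T v : Lp ℝ P (volume : Measure (Rn n))) : Rn n → ℝ) =ᵐ[volume] 0 := by
      have hcover : ∀ᵐ x ∂volume.restrict (⋃ N : ℕ, Metric.ball (0 : Rn n) N),
          (y - T v : Lp ℝ P (volume : Measure (Rn n))) x = 0 := by
        rw [ae_restrict_iUnion_iff]
        intro N
        have := (lintegral_eq_zero_iff' (Lp.aestronglyMeasurable (y - T v)).restrict.enorm).1
          (hball N)
        filter_upwards [this] with x hx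
        simpa using hx
      rwa [Metric.iUnion_ball_nat, Measure.restrict_univ] at hcover
    exact sub_eq_zero.1 ((Lp.eq_zero_iff_ae_eq_zero).2 hz)
  obtain ⟨B, hB0, hB⟩ := (⟨T, hTcont⟩ : V →L[ℝ] Lp ℝ P (volume : Measure (Rn n))).bound
  refine ⟨ENNReal.ofReal B, ENNReal.ofReal_lt_top, fun f hf hf1 hfs hfm => ?_⟩
  have hfμ : MemLp f P μ := hf.restrict D
  have hfe : ext hfμ.toLp =ᵐ[volume] f := by
    refine ((ae_eq_restrict_iff_indicator_ae_eq hDm).1 hfμ.coeFn_toLp).trans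
      (.of_forall fun y => ?_)
    by_cases hy : y ∈ D
    · simp [hy]
    · rw [Set.indicator_of_notMem hy, hfs y (by simpa [hD] using hy)]
  have hfV : hfμ.toLp ∈ V := by
    rw [hV]
    intro p hp
    rw [← hfm p hp]
    apply integral_congr_ae
    filter_upwards [hfe] with y hy
    rw [hy]
  have h1 := hB ⟨_, hfV⟩
  have h2 : normLp α (pot K (ext hfμ.toLp)) = ENNReal.ofReal ‖T ⟨_, hfV⟩‖ := by
    rw [ofReal_norm, Lp.enorm_def]
    exact (eLpNorm_congr_ae (hTm ⟨_, hfV⟩).coeFn_toLp).symm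
  have h3 : ‖hfμ.toLp‖ ≤ 1 := by
    rw [← ENNReal.ofReal_le_ofReal_iff zero_le_one, ofReal_norm, Lp.enorm_def, ENNReal.ofReal_one,
      eLpNorm_congr_ae hfμ.coeFn_toLp]
    exact (eLpNorm_mono_measure f Measure.restrict_le_self).trans hf1
  rw [← pot_congr_ae hfe, h2]
  exact ENNReal.ofReal_le_ofReal (h1.trans (mul_le_of_le_one_right hB0.le h3))

end UniformBounds

end CriticalPotential

end

/-! ### Assembly of the theorem -/

open CriticalPotential in
theorem corollary4 (n : ℕ) (α ε R : ℝ) (hα : 0 < α) (hαn : α < n) (hε : 0 < ε) (hR : 0 < R)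
    (K : Rn n → ℝ) (g : Sn n → ℝ)
    (hK : AEStronglyMeasurable K volume)
    (hg : MemLp g (ENNReal.ofReal (qExp n α)) (surf n))
    (hloc : LocalExpansion α ε R K g)
    (htail : TailCondition α R K) :
    -- `K * f` is finite almost everywhere (the integral converges absolutely)
    (∀ f : Rn n → ℝ, InLp α f →
      ∀ᵐ x, ConvolutionExistsAt K f x (ContinuousLinearMap.mul ℝ ℝ) volume) ∧
    (0 < sphConst n α g →
      -- the two inequalities
      (∃ C : ℝ, 0 < C ∧
        (∀ f : Rn n → ℝ, InLp α f → normLp α f ≤ 1 →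
          ∀ E : Set (Rn n), NullMeasurableSet E volume → volume E < ⊤ →
            expInt α K (1 / sphConst n α g) E f ≤ ENNReal.ofReal C * (1 + volume E)) ∧
        (∀ f : Rn n → ℝ, InLp α f → normLp α f ≤ 1 →
          regExpInt α K (1 / sphConst n α g) f ≤
            ENNReal.ofReal C * (1 + normLp α (pot K f) ^ pExp n α))) ∧
      -- sharpness of the exponential constant
      (SmoothOnSphere g →
        (∀ E : Set (Rn n), NullMeasurableSet E volume → 0 < volume E → volume E < ⊤ →
          ∀ c : ℝ, 1 / sphConst n α g < c →
            ¬ ∃ C : ℝ, ∀ f : Rn n → ℝ, InLp α f → normLp α f ≤ 1 →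
              expInt α K c E f ≤ ENNReal.ofReal C * (1 + volume E)) ∧
        (∃ f : ℕ → Rn n → ℝ, (∀ j, InLp α (f j) ∧ normLp α (f j) ≤ 1) ∧
          (∃ C : ℝ, ∀ j, regExpInt α K (1 / sphConst n α g) (f j) ≤ ENNReal.ofReal C) ∧
          ∀ c : ℝ, 1 / sphConst n α g < c →
            Tendsto (fun j => regExpInt α K c (f j)) atTop (𝓝 ⊤)) ∧
        (α ≤ (n : ℝ) / 2 ∨ PotentialsInLp α K →
          ∀ c : ℝ, 1 / sphConst n α g < c →
            ¬ ∃ C : ℝ, ∀ f : Rn n → ℝ, InLp α f → normLp α f ≤ 1 →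
              regExpInt α K c f ≤ ENNReal.ofReal C * (1 + normLp α (pot K f) ^ pExp n α)))) := by
  have hn := natCast_pos_of_lt hα hαn
  have hp := (holderConjugate hα hαn).pos
  refine ⟨fun f hf => ae_convolutionExistsAt hα hαn hε hR hK hg hloc htail hf,
    fun hA => ⟨?_, fun hsm => ⟨?_, ?_, ?_⟩⟩⟩
  · obtain ⟨S, hS0, hS⟩ := exists_expInt_le hα hαn hε hR hK hg hloc htail hA
    obtain ⟨S', hS'0, hS'⟩ := exists_regExpInt_le hα hαn hε hR hK hg hloc htail hA
    refine ⟨S + S', by positivity, fun f hf hf1 E hE hEt => ?_, fun f hf hf1 => ?_⟩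
    · refine (hS f hf hf1 E hE hEt).trans ?_
      gcongr
      linarith
    · refine (hS' f hf hf1).trans ?_
      gcongr
      · linarith
      · exact lintegral_min_pot_le hα hαn K f
  · rintro E hE hE0 hEt c hc ⟨C, hC⟩
    obtain ⟨ρ, r, C', hr, -, f, hf, hlow⟩ :=
      exists_extremal_family hα hαn hε hR hK hg hloc htail hA hsm 0
    obtain ⟨h, hh, hh1, hlt⟩ := exists_expInt_gt hn hr hA
      (fun L hL => ⟨(hf L hL).1, (hf L hL).2.1⟩) hlow hE hE0 hc
      (B := ENNReal.ofReal C * (1 + volume E))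
      (ENNReal.mul_lt_top ENNReal.ofReal_lt_top (ENNReal.add_lt_top.2 ⟨ENNReal.one_lt_top, hEt⟩))
    exact (hC h hh hh1).not_gt hlt
  · obtain ⟨ρ, r, C, hr, -, f, hf, hlow⟩ :=
      exists_extremal_family hα hαn hε hR hK hg hloc htail hA hsm 0
    obtain ⟨B, hB⟩ := exists_regExpInt_le_const hα hαn hε hR hK hg hloc htail hA C
    have hf' := fun j : ℕ => hf j (Nat.cast_nonneg j)
    exact ⟨fun j => f j, fun j => ⟨(hf' j).1, (hf' j).2.1⟩,
      ⟨B, fun j => hB _ (hf' j).1 (hf' j).2.1 (hf' j).2.2.2.2⟩,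
      fun c hc => (tendsto_regExpInt hn hr hA hlow hc).comp tendsto_natCast_atTop_atTop⟩
  · rintro hcase c hc ⟨C, hC⟩
    -- A family whose potentials stay bounded in L^p while the left side diverges refutes any
    -- constant. Moments up to the order given by the hypothesis are removed only in the second
    -- case.
    have key : ∃ f : ℝ → Rn n → ℝ, ∃ B < (⊤ : ENNReal),
        Tendsto (fun L => regExpInt α K c (f L)) atTop (𝓝 ⊤) ∧ ∀ L, 0 ≤ L →
        InLp α (f L) ∧ normLp α (f L) ≤ 1 ∧ normLp α (pot K (f L)) ^ pExp n α ≤ B := by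
      rcases hcase with h2α | ⟨m, hm⟩
      · obtain ⟨ρ, r, C', hr, -, f, hf, hlow⟩ :=
          exists_extremal_family hα hαn hε hR hK hg hloc htail hA hsm 0
        obtain ⟨B, hBt, hB⟩ :=
          exists_normLp_pot_le_of_le_half hα hαn hε hR hK hg hloc htail h2α C'
        exact ⟨f, B, hBt, tendsto_regExpInt hn hr hA hlow hc, fun L hL =>
          ⟨(hf L hL).1, (hf L hL).2.1, hB _ (hf L hL).1 (hf L hL).2.1 (hf L hL).2.2.2.2⟩⟩
      · obtain ⟨ρ, r, C', hr, -, f, hf, hlow⟩ :=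
          exists_extremal_family hα hαn hε hR hK hg hloc htail hA hsm m
        obtain ⟨B, hBt, hB⟩ :=
          exists_normLp_pot_le_of_potentialsInLp hα hαn hε hR hK hg hloc htail hm ρ
        refine ⟨f, B ^ pExp n α, ENNReal.rpow_lt_top_of_nonneg hp.le hBt.ne,
          tendsto_regExpInt hn hr hA hlow hc, fun L hL => ?_⟩
        obtain ⟨h1, h2, h3, h4, -⟩ := hf L hL
        exact ⟨h1, h2, ENNReal.rpow_le_rpow (hB _ h1 h2 h3 h4) hp.le⟩
    obtain ⟨f, B, hBt, hlim, hf⟩ := key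
    have hlt : ENNReal.ofReal C * (1 + B) < ⊤ := ENNReal.mul_lt_top ENNReal.ofReal_lt_top
      (ENNReal.add_lt_top.2 ⟨ENNReal.one_lt_top, hBt⟩)
    obtain ⟨L, hL, hL0⟩ := ((hlim.eventually_const_lt hlt).and (eventually_ge_atTop 0)).exists
    obtain ⟨h1, h2, h3⟩ := hf L hL0
    refine ((hC _ h1 h2).trans ?_).not_gt hL
    gcongr
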